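/- Let $L>0$, $\mathbb T_L=\mathbb R/2\pi L\mathbb Z$, and for $c>0$ let $Q_c(x)=\frac{3c}{2}\cosh^{-2}\bigl(\frac{\sqrt c\,x}{2}\bigr)$, regarded as a function on $\mathbb R\times\mathbb T_L$ that does not depend on $y$. Let $n_0\in\mathbb Z\setminus\{-1,0,1\}$ and $c^*=\frac{4n_0^2}{5L^2}$. Then there exist constants $C_*,\delta_0>0$ and maps $\check c\in C^2((-\delta_0,\delta_0)^2,(0,\infty))$ and $\varphi_{c^*}\in C^2((-\delta_0,\delta_0)^2,H^2(\mathbb R\times\mathbb T_L))$ (real-valued functions) such that the following holds for $\boldsymbol a=(a_0,a_1)\in(-\delta_0,\delta_0)^2$, with $|\boldsymbol a|=(a_0^2+a_1^2)^{1/2}$. 1. $\varphi_{c^*}(\boldsymbol a)(x,y)>0$ and $\varphi_{c^*}(\boldsymbol a)(x,y)=\varphi_{c^*}(\boldsymbol a)(-x,y)$ for all $(x,y)$ (for the continuous representative). 2. $\check c(\boldsymbol a)$ depends only on $|\boldsymbol a|$; that is, $\check c(\boldsymbol a)=\check c(|\boldsymbol a|,0)$, where $\check c$ is suitably extended to $(|\boldsymbol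 a|,0)$ when $|\boldsymbol a|\ge\delta_0$. 3. $-\Delta\varphi_{c^*}(\boldsymbol a)+\check c(\boldsymbol a)\varphi_{c^*}(\boldsymbol a)-(\varphi_{c^*}(\boldsymbol a))^2=0$ almost everywhere on $\mathbb R\times\mathbb T_L$. 4. As $|\boldsymbol a|\to0$, $$\varphi_{c^*}(\boldsymbol a)=Q_{c^*}+a_0Q_{c^*}^{3/2}\cos\frac{n_0y}{L}+a_1Q_{c^*}^{3/2}\sin\frac{n_0y}{L}+O(|\boldsymbol a|^2)\quad\text{in }H^2(\mathbb R\times\mathbb T_L),$$ $$\|\varphi_{c^*}(\boldsymbol a)\|_{L^2}^2=\|Q_{c^*}\|_{L^2}^2+\frac{C_{2,c^*}}{2}|\boldsymbol a|^2+o(|\boldsymbol a|^2),\qquad \check c(\boldsymbol a)=c^*+\frac{C_*}{2}|\boldsymbol a|^2+o(|\boldsymbol a|^2),$$ where $$C_{2,c^*}=\frac{3C_*\|Q_{c^*}\|_{L^2}^2}{2c^*}-\frac52\Bigl\|Q_{c^*}^{3/2}\cos\frac{n_0y}{L}\Bigr\|_{L^2}^2>0.$$ Here all $L^2$ norms are taken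 over $\mathbb R\times\mathbb T_L$. -/

import Mathlib

open MeasureTheory Filter Topology Asymptotics
open scoped ContDiff

/-- For `L > 0` the period `2πL` is positive. -/
instance fact_two_pi_mul_pos (L : ℝ) [hL : Fact (0 < L)] : Fact (0 < 2 * Real.pi * L) :=
  ⟨mul_pos Real.two_pi_pos hL.out⟩

/-- The cylinder `ℝ × 𝕋_L`, `𝕋_L = ℝ / 2πLℤ`. It carries the product of the Lebesgue measures,
so that its circle factor has total length `2πL`. -/
abbrev Cyl (L : ℝ) : Type := ℝ × AddCircle (2 * Real.pi * L)

/-! ### Test functions on the cylinder -/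

/-- The pull-back of a function on the cylinder to the plane. -/
noncomputable def Cyl.lift {L : ℝ} (ζ : Cyl L → ℝ) : ℝ × ℝ → ℝ :=
  fun p => ζ (p.1, (p.2 : AddCircle (2 * Real.pi * L)))

/-- `C_c^∞` functions on the cylinder: smooth in the covering coordinates, compactly supported. -/
structure Cyl.IsTest {L : ℝ} (ζ : Cyl L → ℝ) : Prop where
  smooth : ContDiff ℝ ∞ (Cyl.lift ζ)
  compact : HasCompactSupport ζ

/-- The classical partial derivative `∂_x`. -/
noncomputable def Cyl.dx {L : ℝ} (ζ : Cyl L → ℝ) : Cyl L → ℝ :=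
  fun p => deriv (fun s : ℝ => ζ (s, p.2)) p.1

/-- The classical partial derivative `∂_y`. -/
noncomputable def Cyl.dy {L : ℝ} (ζ : Cyl L → ℝ) : Cyl L → ℝ :=
  fun p => deriv (fun s : ℝ => ζ (p.1, p.2 + (s : AddCircle (2 * Real.pi * L)))) 0

theorem Cyl.lift_dx {L : ℝ} {ζ : Cyl L → ℝ} (h : ContDiff ℝ ∞ (Cyl.lift ζ)) (p : ℝ × ℝ) :
    Cyl.lift (Cyl.dx ζ) p = fderiv ℝ (Cyl.lift ζ) p (1, 0) := by
  have h1 : HasFDerivAt (Cyl.lift ζ) (fderiv ℝ (Cyl.lift ζ) p) p :=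
    ((h.differentiable (by simp)) p).hasFDerivAt
  have h2 : HasDerivAt (fun s : ℝ => ((s, p.2) : ℝ × ℝ)) (1, 0) p.1 :=
    (hasDerivAt_id p.1).prodMk (hasDerivAt_const _ _)
  exact (h1.comp_hasDerivAt (x := p.1) (f := fun s : ℝ => ((s, p.2) : ℝ × ℝ)) h2).deriv

theorem Cyl.lift_dy {L : ℝ} {ζ : Cyl L → ℝ} (h : ContDiff ℝ ∞ (Cyl.lift ζ)) (p : ℝ × ℝ) :
    Cyl.lift (Cyl.dy ζ) p = fderiv ℝ (Cyl.lift ζ) p (0, 1) := by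
  have h1 : HasFDerivAt (Cyl.lift ζ) (fderiv ℝ (Cyl.lift ζ) p) (p.1, p.2 + 0) := by
    simpa using ((h.differentiable (by simp)) p).hasFDerivAt
  have h2 : HasDerivAt (fun s : ℝ => ((p.1, p.2 + s) : ℝ × ℝ)) (0, 1) 0 :=
    (hasDerivAt_const _ _).prodMk ((hasDerivAt_id (0 : ℝ)).const_add p.2)
  have h3 := (h1.comp_hasDerivAt (x := (0 : ℝ))
    (f := fun s : ℝ => ((p.1, p.2 + s) : ℝ × ℝ)) h2).deriv
  rw [← h3]
  rfl

theorem Cyl.continuous_of_lift {L : ℝ} {ζ : Cyl L → ℝ} (h : Continuous (Cyl.lift ζ)) :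
    Continuous ζ := by
  have hq : IsOpenQuotientMap
      (Prod.map (id : ℝ → ℝ) (fun y : ℝ => (y : AddCircle (2 * Real.pi * L)))) :=
    IsOpenQuotientMap.id.prodMap QuotientAddGroup.isOpenQuotientMap_mk
  exact hq.continuous_comp_iff.1 h

theorem Cyl.IsTest.dx {L : ℝ} {ζ : Cyl L → ℝ} (h : Cyl.IsTest ζ) : Cyl.IsTest (Cyl.dx ζ) := by
  constructor
  · have : Cyl.lift (Cyl.dx ζ) = fun p => fderiv ℝ (Cyl.lift ζ) p (1, 0) :=
      funext (Cyl.lift_dx h.smooth)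
    rw [this]
    exact (h.smooth.fderiv_right (m := ∞) (by simp)).clm_apply contDiff_const
  · refine HasCompactSupport.intro h.compact fun p hp => ?_
    have hz : ζ =ᶠ[𝓝 p] 0 := notMem_tsupport_iff_eventuallyEq.1 hp
    have hc : Tendsto (fun s : ℝ => ((s, p.2) : Cyl L)) (𝓝 p.1) (𝓝 p) :=
      Continuous.tendsto (by fun_prop) p.1
    have he : (fun s : ℝ => ζ (s, p.2)) =ᶠ[𝓝 p.1] fun _ => (0 : ℝ) := hc.eventually hz
    simpa [Cyl.dx] using he.deriv_eq

theorem Cyl.IsTest.dy {L : ℝ} {ζ : Cyl L → ℝ} (h : Cyl.IsTest ζ) : Cyl.IsTest (Cyl.dy ζ) := by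
  constructor
  · have : Cyl.lift (Cyl.dy ζ) = fun p => fderiv ℝ (Cyl.lift ζ) p (0, 1) :=
      funext (Cyl.lift_dy h.smooth)
    rw [this]
    exact (h.smooth.fderiv_right (m := ∞) (by simp)).clm_apply contDiff_const
  · refine HasCompactSupport.intro h.compact fun p hp => ?_
    have hz : ζ =ᶠ[𝓝 p] 0 := notMem_tsupport_iff_eventuallyEq.1 hp
    have hc : Tendsto (fun s : ℝ => ((p.1, p.2 + (s : AddCircle (2 * Real.pi * L))) : Cyl L))
        (𝓝 0) (𝓝 p) := by
      have hcont : Continuous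
          (fun s : ℝ => ((p.1, p.2 + (s : AddCircle (2 * Real.pi * L))) : Cyl L)) :=
        continuous_const.prodMk (continuous_const.add (AddCircle.continuous_mk' _))
      simpa using hcont.tendsto 0
    have he : (fun s : ℝ => ζ (p.1, p.2 + (s : AddCircle (2 * Real.pi * L)))) =ᶠ[𝓝 0]
        fun _ => (0 : ℝ) := hc.eventually hz
    simpa [Cyl.dy] using he.deriv_eq

/-- The mixed derivative `∂_x^i ∂_y^j`. -/
noncomputable def Cyl.dxy {L : ℝ} (i j : ℕ) (ζ : Cyl L → ℝ) : Cyl L → ℝ :=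
  Cyl.dx^[i] (Cyl.dy^[j] ζ)

theorem Cyl.IsTest.dxy {L : ℝ} {ζ : Cyl L → ℝ} (h : Cyl.IsTest ζ) (i j : ℕ) :
    Cyl.IsTest (Cyl.dxy i j ζ) := by
  have hy : Cyl.IsTest (Cyl.dy^[j] ζ) := by
    induction j with
    | zero => exact h
    | succ n ih => rw [Function.iterate_succ_apply']; exact ih.dy
  unfold Cyl.dxy
  induction i with
  | zero => exact hy
  | succ n ih => rw [Function.iterate_succ_apply']; exact ih.dx

theorem Cyl.IsTest.memLp {L : ℝ} [Fact (0 < L)] {ζ : Cyl L → ℝ} (h : Cyl.IsTest ζ) :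
    MemLp ζ 2 (volume : Measure (Cyl L)) :=
  (Cyl.continuous_of_lift h.smooth.continuous).memLp_of_hasCompactSupport h.compact

/-! ### Sobolev spaces on the cylinder -/

/-- The real space `L²(ℝ × 𝕋_L)`. -/
abbrev L2 (L : ℝ) [Fact (0 < L)] : Type := Lp ℝ 2 (volume : Measure (Cyl L))

/-- `v` is the weak derivative `∂_x^i ∂_y^j u`. -/
def IsWeakDeriv {L : ℝ} [Fact (0 < L)] (i j : ℕ) (u v : L2 L) : Prop :=
  ∀ ζ : Cyl L → ℝ, Cyl.IsTest ζ →
    ∫ p, u p * Cyl.dxy i j ζ p = (-1) ^ (i + j) * ∫ p, v p * ζ p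

theorem L2.integrable_mul {L : ℝ} [Fact (0 < L)] (u : L2 L) {ζ : Cyl L → ℝ}
    (h : Cyl.IsTest ζ) : Integrable (fun p => u p * ζ p) :=
  (Lp.memLp u).integrable_mul h.memLp

theorem L2.integral_add_mul {L : ℝ} [Fact (0 < L)] (u v : L2 L) {ζ : Cyl L → ℝ}
    (h : Cyl.IsTest ζ) : ∫ p, (u + v) p * ζ p = (∫ p, u p * ζ p) + ∫ p, v p * ζ p := by
  rw [← integral_add (u.integrable_mul h) (v.integrable_mul h)]
  refine integral_congr_ae ?_
  filter_upwards [Lp.coeFn_add u v] with p hp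
  rw [hp, Pi.add_apply, add_mul]

theorem L2.integral_smul_mul {L : ℝ} [Fact (0 < L)] (r : ℝ) (u : L2 L) (ζ : Cyl L → ℝ) :
    ∫ p, (r • u) p * ζ p = r * ∫ p, u p * ζ p := by
  rw [← integral_const_mul]
  refine integral_congr_ae ?_
  filter_upwards [Lp.coeFn_smul r u] with p hp
  rw [hp, Pi.smul_apply, smul_eq_mul, mul_assoc]

theorem L2.integral_zero_mul {L : ℝ} [Fact (0 < L)] (ζ : Cyl L → ℝ) :
    ∫ p, (0 : L2 L) p * ζ p = 0 := by
  have := L2.integral_smul_mul (0 : ℝ) (0 : L2 L) ζ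
  rwa [zero_smul, zero_mul] at this

/-- The orders of differentiation `(i, j)` with `i + j ≤ k`. -/
def derivIdx (k : ℕ) : Finset (ℕ × ℕ) :=
  (Finset.range (k + 1) ×ˢ Finset.range (k + 1)).filter fun α => α.1 + α.2 ≤ k

theorem mem_derivIdx {k i j : ℕ} : (i, j) ∈ derivIdx k ↔ i + j ≤ k := by
  simp only [derivIdx, Finset.mem_filter, Finset.mem_product, Finset.mem_range]
  omega

/-- The Sobolev space `H^k(ℝ × 𝕋_L)` of real functions. An element is stored as the family
`(∂_x^i ∂_y^j u)_{i + j ≤ k}` of all weak derivatives of a function `u`, each in `L²`; `u` is the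
component `(0, 0)` and determines the others. The norm inherited from the `ℓ²`-sum is the usual
one, `‖u‖² = ∑_{i + j ≤ k} ‖∂_x^i ∂_y^j u‖²_{L²}`. -/
noncomputable def SobolevH (L : ℝ) [Fact (0 < L)] (k : ℕ) :
    Submodule ℝ (PiLp 2 fun _ : derivIdx k => L2 L) where
  carrier := {u | ∀ α : derivIdx k,
    IsWeakDeriv α.1.1 α.1.2 (u ⟨(0, 0), mem_derivIdx.2 (Nat.zero_le k)⟩) (u α)}
  zero_mem' := by
    intro α ζ _
    simp only [PiLp.zero_apply]
    rw [L2.integral_zero_mul, L2.integral_zero_mul, mul_zero]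
  add_mem' := by
    intro u v hu hv α ζ hζ
    simp only [PiLp.add_apply]
    rw [L2.integral_add_mul _ _ (hζ.dxy _ _), L2.integral_add_mul _ _ hζ, hu α ζ hζ, hv α ζ hζ,
      mul_add]
  smul_mem' := by
    intro r u hu α ζ hζ
    simp only [PiLp.smul_apply]
    rw [L2.integral_smul_mul, L2.integral_smul_mul, hu α ζ hζ]
    ring

/-- The weak derivative `∂_x^i ∂_y^j u`, `i + j ≤ k`, of `u ∈ H^k`. -/
noncomputable def SobolevH.D {L : ℝ} [Fact (0 < L)] {k : ℕ} (u : SobolevH L k) (i j : ℕ)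
    (h : i + j ≤ k) : L2 L :=
  u.1 ⟨(i, j), mem_derivIdx.2 h⟩

/-- The function `u ∈ L²` underlying an element of `H^k`. -/
noncomputable def SobolevH.fn {L : ℝ} [Fact (0 < L)] {k : ℕ} (u : SobolevH L k) : L2 L :=
  SobolevH.D u 0 0 (Nat.zero_le k)

/-- The Laplacian `∂_x² u + ∂_y² u` of `u ∈ H²`. -/
noncomputable def SobolevH.laplacian {L : ℝ} [Fact (0 < L)] (u : SobolevH L 2) : L2 L :=
  SobolevH.D u 2 0 le_rfl + SobolevH.D u 0 2 le_rfl

/-! ### Line solitary waves and transverse modes -/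

/-- `‖f‖²_{L²} = ∫ |f|²` over the cylinder. -/
noncomputable def normSqL2 {L : ℝ} [Fact (0 < L)] (f : Cyl L → ℝ) : ℝ := ∫ p, |f p| ^ 2

/-- The profile `Q_c(x) = (3c/2) cosh⁻²(√c x / 2)` of the line solitary wave. -/
noncomputable def lineSoliton (c x : ℝ) : ℝ :=
  3 * c / 2 * (Real.cosh (Real.sqrt c * x / 2) ^ 2)⁻¹

theorem periodic_cos_mode (L : ℝ) (n : ℤ) :
    Function.Periodic (fun y : ℝ => Real.cos (n * y / L)) (2 * Real.pi * L) := by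
  intro y
  rcases eq_or_ne L 0 with rfl | hL
  · simp
  · have : (n : ℝ) * (y + 2 * Real.pi * L) / L = n * y / L + n * (2 * Real.pi) := by
      field_simp
    simp only [this, Real.cos_add_int_mul_two_pi]

theorem periodic_sin_mode (L : ℝ) (n : ℤ) :
    Function.Periodic (fun y : ℝ => Real.sin (n * y / L)) (2 * Real.pi * L) := by
  intro y
  rcases eq_or_ne L 0 with rfl | hL
  · simp
  · have : (n : ℝ) * (y + 2 * Real.pi * L) / L = n * y / L + n * (2 * Real.pi) := by
      field_simp
    simp only [this, Real.sin_add_int_mul_two_pi]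

/-- `y ↦ cos (n y / L)` on `𝕋_L`. -/
noncomputable def cosMode (L : ℝ) (n : ℤ) : AddCircle (2 * Real.pi * L) → ℝ :=
  (periodic_cos_mode L n).lift

/-- `y ↦ sin (n y / L)` on `𝕋_L`. -/
noncomputable def sinMode (L : ℝ) (n : ℤ) : AddCircle (2 * Real.pi * L) → ℝ :=
  (periodic_sin_mode L n).lift

/-- `Q_c` as a function on the cylinder, independent of `y`. -/
noncomputable def lineQ (L c : ℝ) : Cyl L → ℝ := fun p => lineSoliton c p.1

/-- `Q_c^{3/2} cos (n y / L)`. -/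
noncomputable def cosDir (L c : ℝ) (n : ℤ) : Cyl L → ℝ :=
  fun p => lineSoliton c p.1 ^ (3 / 2 : ℝ) * cosMode L n p.2

/-- `Q_c^{3/2} sin (n y / L)`. -/
noncomputable def sinDir (L c : ℝ) (n : ℤ) : Cyl L → ℝ :=
  fun p => lineSoliton c p.1 ^ (3 / 2 : ℝ) * sinMode L n p.2

/-- The open square `(-δ, δ)²` in the Euclidean plane. -/
def openSquare (δ : ℝ) : Set (EuclideanSpace ℝ (Fin 2)) := {a | ∀ i, a i ∈ Set.Ioo (-δ) δ}

/-! Write c* = 4σ², so that (n₀/L)² = 5σ², put z = σx, and look for solutions of speed σ²(4 + γ) in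
the form φ = σ² sech(z) Σ_m ε_m u_m(z) Re((w e^{-i n₀ y/L})^m), with w complex, ε_0 = 1 and ε_m = ε
for m ≥ 1. The power w^m is factored out of mode m. By the product formula
`two_mul_re_pow_mul_re_pow` the equation then becomes a system for the u_m in which w occurs only
through t = |w|². With w proportional to a₀ + i a₁ this gives at once that the speed depends on |a|
only, and that φ is as smooth in a as the u_m are in t, since the synthesis is a convergent power
series in w (`synth`, `synth_modeBilin`).

Mode m is governed by -∂² + 4 + 5m² - 12 sech². For m = 0 this is invertible on even functions. For
m = 1 the kernel is spanned by sech³, which is proportional to Q^{3/2}. For m ≥ 2 the inverse of the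
free part has norm at most 1/23 in the space weighted by sech, so that 12 sech² is a small
perturbation. The inverses come from explicit pairs of solutions (`greenEven`, `greenGround`,
`greenFree`). The unknowns are the sources f_m fed to these inverses and the shift γ, which is fixed
by the solvability condition ∫ sech³ · sech f_1 = 0 of mode 1. The linearization of this system at
(ε, t) = (0, 0) is bijective; the decisive number is the transversality constant in
`groundPairing_nondegenerate`. The implicit function theorem gives a branch in (ε, t)
(`exists_branch`), and afterwards a small ε > 0 is frozen (`exists_modeBranch`). The scale ε makes
the base point explicit: at t = 0 the products of positive modes still force the higher modes, but
at ε = 0 they do not. At t = 0 the modes 0 and 1 decouple from the rest, so by uniqueness they equal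
the soliton and sech³ there, with γ = 0.

The second order expansions come from differentiating the system in t at 0 (`modeBranch_deriv`).
Integrals of sech^n are exact, pairings with the inverse of mode 0 are computed by moving the
inverse to an explicit function, and only the contribution of mode 2 is estimated rather than
computed. With g = γ'(0)/ε² one gets C = 432σ⁴g and C₂ = (15552g - 576)πLσ⁵. Since 15552/27 = 576,
the bound g > 1/27 is exactly what positivity of C₂ requires.

Positivity of φ follows from closeness to the soliton on |σx| ≤ 2, and from a minimum principle with
an exponential barrier beyond (`solFun_pos`, `pos_of_laplacian_eq`). -/

/-! ### Summable sequences and power series with operator coefficients -/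

section SummableSequences

variable {X E F : Type*} [NormedAddCommGroup X] [NormedSpace ℝ X]
  [NormedAddCommGroup E] [NormedSpace ℝ E] [NormedAddCommGroup F] [NormedSpace ℝ F]

/-- The space of absolutely summable sequences in `X`. -/
def SeqL1 (X : Type*) [NormedAddCommGroup X] : Type _ := lp (fun _ : ℕ => X) 1

noncomputable instance SeqL1.instNormedAddCommGroup : NormedAddCommGroup (SeqL1 X) :=
  inferInstanceAs (NormedAddCommGroup (lp (fun _ : ℕ => X) 1))

noncomputable instance SeqL1.instNormedSpace : NormedSpace ℝ (SeqL1 X) :=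
  inferInstanceAs (NormedSpace ℝ (lp (fun _ : ℕ => X) 1))

instance SeqL1.instCompleteSpace [CompleteSpace X] : CompleteSpace (SeqL1 X) :=
  inferInstanceAs (CompleteSpace (lp (fun _ : ℕ => X) 1))

/-- The entries of a summable sequence. -/
def SeqL1.entry (u : SeqL1 X) : ℕ → X := u.1

instance SeqL1.instCoeFun : CoeFun (SeqL1 X) fun _ => ℕ → X := ⟨SeqL1.entry⟩

omit [NormedSpace ℝ X] in
theorem SeqL1.add_apply (u v : SeqL1 X) (i : ℕ) : (u + v) i = u i + v i := rfl

omit [NormedSpace ℝ X] in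
theorem SeqL1.sub_apply (u v : SeqL1 X) (i : ℕ) : (u - v) i = u i - v i := rfl

theorem SeqL1.smul_apply (c : ℝ) (u : SeqL1 X) (i : ℕ) : (c • u) i = c • u i := rfl

omit [NormedSpace ℝ X] in
theorem SeqL1.zero_apply (i : ℕ) : (0 : SeqL1 X) i = 0 := rfl

/-- The sequence with the single entry `x` in position `i`. -/
noncomputable def SeqL1.single (i : ℕ) : X →L[ℝ] SeqL1 X :=
  lp.singleContinuousLinearMap ℝ (fun _ : ℕ => X) 1 i

/-- The `i`-th entry of a sequence. -/
noncomputable def SeqL1.coord (i : ℕ) : SeqL1 X →L[ℝ] X :=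
  lp.evalCLM ℝ (fun _ : ℕ => X) 1 i

theorem SeqL1.single_eq (i : ℕ) (x : X) :
    SeqL1.single i x = lp.single (E := fun _ : ℕ => X) 1 i x := rfl

theorem SeqL1.single_apply_self (i : ℕ) (x : X) : (SeqL1.single i x : SeqL1 X) i = x := by
  rw [SeqL1.single_eq]
  exact lp.single_apply_self (E := fun _ : ℕ => X) 1 i x

theorem SeqL1.single_apply_ne {i j : ℕ} (h : j ≠ i) (x : X) :
    (SeqL1.single i x : SeqL1 X) j = 0 := by
  rw [SeqL1.single_eq]
  exact lp.single_apply_ne (E := fun _ : ℕ => X) 1 i x h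

theorem SeqL1.coord_apply (i : ℕ) (u : SeqL1 X) : SeqL1.coord i u = u i := rfl

theorem SeqL1.norm_single (i : ℕ) (x : X) : ‖(SeqL1.single i x : SeqL1 X)‖ = ‖x‖ := by
  rw [SeqL1.single_eq]
  exact lp.norm_single (E := fun _ : ℕ => X) one_pos i x

omit [NormedSpace ℝ X] in
theorem SeqL1.norm_apply_le (u : SeqL1 X) (i : ℕ) : ‖u i‖ ≤ ‖u‖ :=
  lp.norm_apply_le_norm (by norm_num) u i

omit [NormedSpace ℝ X] in
theorem SeqL1.hasSum_norm (u : SeqL1 X) : HasSum (fun i => ‖u i‖) ‖u‖ := by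
  have h := lp.hasSum_norm (E := fun _ : ℕ => X) (by norm_num : 0 < (1 : ENNReal).toReal) u
  simp only [ENNReal.toReal_one, Real.rpow_one] at h
  exact h

/-- Finitely supported sequences are dense in ℓ¹. Operator identities for the mode system are
therefore verified on sequences with one entry, where they become statements about single modes. -/
theorem SeqL1.clm_ext {S T : SeqL1 X →L[ℝ] E}
    (h : ∀ i x, S (SeqL1.single i x) = T (SeqL1.single i x)) : S = T :=
  lp.ext_continuousLinearMap (by norm_num) fun i => ContinuousLinearMap.ext fun x => h i x

theorem SeqL1.clm_ext₂ {S T : SeqL1 X →L[ℝ] SeqL1 X →L[ℝ] E}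
    (h : ∀ i j x y, S (SeqL1.single i x) (SeqL1.single j y)
      = T (SeqL1.single i x) (SeqL1.single j y)) : S = T :=
  SeqL1.clm_ext fun i x => SeqL1.clm_ext fun j y => h i j x y

section Lift

variable [CompleteSpace E] (Λ : ℕ → X →L[ℝ] E) (K : ℝ) (h : ∀ i, ‖Λ i‖ ≤ K)
include h

/-- This is the reason for working in ℓ¹: uniformly bounded components already define a bounded
operator with the same bound, and likewise for bilinear operators, so convolutions of modes need no
further estimate. -/
theorem SeqL1.summable_lift (u : SeqL1 X) : Summable fun i => Λ i (u i) :=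
  Summable.of_norm_bounded ((SeqL1.hasSum_norm u).summable.mul_left K) fun i =>
    (Λ i).le_of_opNorm_le (h i) _

/-- The operator on summable sequences with components `Λ i`. -/
noncomputable def SeqL1.lift : SeqL1 X →L[ℝ] E :=
  LinearMap.mkContinuous
    { toFun := fun u => ∑' i, Λ i (u i)
      map_add' := fun u v => by
        rw [← (SeqL1.summable_lift Λ K h u).tsum_add (SeqL1.summable_lift Λ K h v)]
        simp [SeqL1.add_apply]
      map_smul' := fun c u => by
        rw [RingHom.id_apply, ← (SeqL1.summable_lift Λ K h u).tsum_const_smul]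
        simp [SeqL1.smul_apply] }
    K fun u => by
      have := (SeqL1.hasSum_norm u).mul_left K
      exact tsum_of_norm_bounded this fun i => (Λ i).le_of_opNorm_le (h i) _

theorem SeqL1.hasSum_lift (u : SeqL1 X) : HasSum (fun i => Λ i (u i)) (SeqL1.lift Λ K h u) :=
  (SeqL1.summable_lift Λ K h u).hasSum

theorem SeqL1.lift_single (i : ℕ) (x : X) : SeqL1.lift Λ K h (SeqL1.single i x) = Λ i x := by
  refine (SeqL1.hasSum_lift Λ K h (SeqL1.single i x)).unique ?_
  convert! _root_.hasSum_single i fun j hj => ?_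
  · rw [SeqL1.single_apply_self]
  · rw [SeqL1.single_apply_ne hj, map_zero]

theorem SeqL1.norm_lift_le : ‖SeqL1.lift Λ K h‖ ≤ K :=
  LinearMap.mkContinuous_norm_le _ ((norm_nonneg _).trans (h 0)) _

end Lift

section Diag

variable [CompleteSpace X] (Λ : ℕ → X →L[ℝ] X) (K : ℝ) (h : ∀ i, ‖Λ i‖ ≤ K)

omit [CompleteSpace X] in
include h in
theorem SeqL1.norm_single_comp_le (i j : ℕ) : ‖(SeqL1.single j).comp (Λ i)‖ ≤ K :=
  ContinuousLinearMap.opNorm_le_bound _ ((norm_nonneg _).trans (h i)) fun x => by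
    rw [ContinuousLinearMap.comp_apply, SeqL1.norm_single]
    exact (Λ i).le_of_opNorm_le (h i) x

/-- The diagonal operator with entries `Λ i`. -/
noncomputable def SeqL1.diag : SeqL1 X →L[ℝ] SeqL1 X :=
  SeqL1.lift (fun i => (SeqL1.single i).comp (Λ i)) K fun i => SeqL1.norm_single_comp_le Λ K h i i

theorem SeqL1.diag_single (i : ℕ) (x : X) :
    SeqL1.diag Λ K h (SeqL1.single i x) = SeqL1.single i (Λ i x) :=
  SeqL1.lift_single _ _ _ i x

theorem SeqL1.diag_apply (u : SeqL1 X) (i : ℕ) : SeqL1.diag Λ K h u i = Λ i (u i) := by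
  suffices hs : (SeqL1.coord i).comp (SeqL1.diag Λ K h) = (Λ i).comp (SeqL1.coord i) from
    congr($hs u)
  refine SeqL1.clm_ext fun j x => ?_
  simp only [ContinuousLinearMap.comp_apply, SeqL1.diag_single, SeqL1.coord_apply]
  rcases eq_or_ne i j with rfl | hij
  · rw [SeqL1.single_apply_self, SeqL1.single_apply_self]
  · rw [SeqL1.single_apply_ne hij, SeqL1.single_apply_ne hij, map_zero]

theorem SeqL1.norm_diag_le : ‖SeqL1.diag Λ K h‖ ≤ K := SeqL1.norm_lift_le _ _ _

end Diag

section Bilinear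

variable [CompleteSpace E] (β : ℕ → ℕ → X →L[ℝ] X →L[ℝ] E) (K : ℝ) (h : ∀ i j, ‖β i j‖ ≤ K)

/-- The bilinear operator on summable sequences with components `β i j`. -/
noncomputable def SeqL1.lift₂ : SeqL1 X →L[ℝ] SeqL1 X →L[ℝ] E :=
  SeqL1.lift
    (fun i => (SeqL1.lift (fun j => (β i j).flip) K
      fun j => (ContinuousLinearMap.opNorm_flip (β i j)).trans_le (h i j)).flip) K
    fun _ => (ContinuousLinearMap.opNorm_flip _).trans_le (SeqL1.norm_lift_le _ _ _)

theorem SeqL1.lift₂_single (i j : ℕ) (x y : X) :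
    SeqL1.lift₂ β K h (SeqL1.single i x) (SeqL1.single j y) = β i j x y := by
  rw [SeqL1.lift₂, SeqL1.lift_single, ContinuousLinearMap.flip_apply, SeqL1.lift_single,
    ContinuousLinearMap.flip_apply]

end Bilinear

end SummableSequences

/-! ### Power series with operator coefficients growing at most like 4^n. -/

section PowerSeries

variable {A F : Type*} [NormedCommRing A] [NormOneClass A] [NormedAlgebra ℝ A]
  [NormedAddCommGroup F] [NormedSpace ℝ F]

/-- The formal power series `∑ Λ_n (w ^ n)`. -/
noncomputable def opPowerSeries (Λ : ℕ → A →L[ℝ] F) : FormalMultilinearSeries ℝ A F :=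
  fun n => (Λ n).compContinuousMultilinearMap (ContinuousMultilinearMap.mkPiAlgebraFin ℝ n A)

/-- The function `w ↦ ∑ Λ_n (w ^ n)`. -/
noncomputable def opSum (Λ : ℕ → A →L[ℝ] F) (w : A) : F := ∑' n, Λ n (w ^ n)

omit [NormOneClass A] in
theorem opPowerSeries_apply (Λ : ℕ → A →L[ℝ] F) (n : ℕ) (w : A) :
    (opPowerSeries Λ n fun _ => w) = Λ n (w ^ n) := by
  simp [opPowerSeries]

variable {Λ : ℕ → A →L[ℝ] F} {K : ℝ} (h : ∀ n, ‖Λ n‖ ≤ K * 4 ^ n)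
include h

/-- The rate 4^n is generous for `damp`, but it is what absorbs the factors m and m² of two
derivatives in y in the synthesis; it fixes the radius 1/4 used throughout. -/
theorem le_radius_opPowerSeries : ((1 / 4 : NNReal) : ENNReal) ≤ (opPowerSeries Λ).radius := by
  refine FormalMultilinearSeries.le_radius_of_bound _ K fun n => ?_
  have h1 : ‖opPowerSeries Λ n‖ ≤ ‖Λ n‖ := by
    refine ((Λ n).norm_compContinuousMultilinearMap_le _).trans ?_
    simp
  calc ‖opPowerSeries Λ n‖ * (((1 / 4 : NNReal) : NNReal) : ℝ) ^ n
      ≤ (K * 4 ^ n) * (1 / 4) ^ n := by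
        push_cast
        gcongr
        exact h1.trans (h n)
    _ = K := by rw [mul_assoc, ← mul_pow]; norm_num

theorem hasFPowerSeriesOnBall_opSum [CompleteSpace F] :
    HasFPowerSeriesOnBall (opSum Λ) (opPowerSeries Λ) 0 ((1 / 4 : NNReal) : ENNReal) := by
  have h1 := (opPowerSeries Λ).hasFPowerSeriesOnBall
    (lt_of_lt_of_le (by norm_num) (le_radius_opPowerSeries h))
  have h2 : (opPowerSeries Λ).sum = opSum Λ := by
    funext w
    simp only [FormalMultilinearSeries.sum, opSum, opPowerSeries_apply]
  rw [h2] at h1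
  exact h1.mono (by norm_num) (le_radius_opPowerSeries h)

theorem contDiffAt_opSum [CompleteSpace F] {w : A} (hw : ‖w‖ < 1 / 4) {n : ℕ∞ω} :
    ContDiffAt ℝ n (opSum Λ) w := by
  refine ((hasFPowerSeriesOnBall_opSum h).analyticAt_of_mem ?_).contDiffAt
  rw [Metric.eball_coe]
  simpa using hw

theorem hasFDerivAt_opSum_zero [CompleteSpace F] : HasFDerivAt (opSum Λ) (Λ 1) 0 := by
  have h1 := (hasFPowerSeriesOnBall_opSum h).hasFPowerSeriesAt.hasFDerivAt
  convert! h1 using 1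
  ext v
  simp [opPowerSeries]

theorem hasSum_opSum [CompleteSpace F] {w : A} (hw : ‖w‖ < 1 / 4) :
    HasSum (fun n => Λ n (w ^ n)) (opSum Λ w) := by
  have := (hasFPowerSeriesOnBall_opSum h).hasSum (y := w) (by
    rw [Metric.eball_coe]; simpa using hw)
  simpa only [opPowerSeries_apply, zero_add] using this

omit [NormOneClass A] h in
theorem opSum_zero : opSum Λ 0 = Λ 0 1 := by
  rw [opSum, tsum_eq_single 0 fun n hn => by rw [zero_pow hn, map_zero], pow_zero]

end PowerSeries

/-! ### The hyperbolic secant -/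

/-- The hyperbolic secant. -/
noncomputable def sech (z : ℝ) : ℝ := (Real.cosh z)⁻¹

theorem sech_pos (z : ℝ) : 0 < sech z := inv_pos.2 (Real.cosh_pos z)

theorem sech_le_one (z : ℝ) : sech z ≤ 1 := inv_le_one_of_one_le₀ (Real.one_le_cosh z)

theorem sech_zero : sech 0 = 1 := by simp [sech]

theorem sech_neg (z : ℝ) : sech (-z) = sech z := by simp [sech]

theorem sech_abs (z : ℝ) : sech |z| = sech z := by simp [sech]

theorem cosh_mul_sech (z : ℝ) : Real.cosh z * sech z = 1 :=
  mul_inv_cancel₀ (Real.cosh_pos z).ne'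

theorem tanh_eq_sinh_mul_sech (z : ℝ) : Real.tanh z = Real.sinh z * sech z := by
  rw [Real.tanh_eq_sinh_div_cosh, sech, div_eq_mul_inv]

theorem tanh_sq (z : ℝ) : Real.tanh z ^ 2 = 1 - sech z ^ 2 := by
  have h1 := cosh_mul_sech z
  have h2 := Real.cosh_sq z
  rw [tanh_eq_sinh_mul_sech]
  linear_combination (Real.cosh z * sech z + 1) * h1 - sech z ^ 2 * h2

theorem hasDerivAt_sech (z : ℝ) : HasDerivAt sech (-(sech z * Real.tanh z)) z := by
  convert! (Real.hasDerivAt_cosh z).inv (Real.cosh_pos z).ne' using 1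
  rw [tanh_eq_sinh_mul_sech, sech]
  field_simp

theorem hasDerivAt_tanh (z : ℝ) : HasDerivAt Real.tanh (sech z ^ 2) z := by
  have h := (Real.hasDerivAt_sinh z).mul (hasDerivAt_sech z)
  have h1 : Real.tanh = Real.sinh * sech := funext tanh_eq_sinh_mul_sech
  rw [h1]
  convert! h using 1
  have h1 := cosh_mul_sech z
  have h2 := Real.cosh_sq z
  rw [tanh_eq_sinh_mul_sech]
  linear_combination (Real.cosh z * sech z) * h1 - sech z ^ 2 * h2

theorem hasDerivAt_sech_pow (n : ℕ) (z : ℝ) :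
    HasDerivAt (fun z => sech z ^ n) (-(n * sech z ^ n * Real.tanh z)) z := by
  rcases n with _ | n
  · simpa using hasDerivAt_const z (1 : ℝ)
  · convert! (hasDerivAt_sech z).pow (n + 1) using 1
    push_cast
    ring

theorem continuous_sech : Continuous sech :=
  continuous_iff_continuousAt.2 fun z => (hasDerivAt_sech z).continuousAt

theorem continuous_tanh : Continuous Real.tanh :=
  continuous_iff_continuousAt.2 fun z => (hasDerivAt_tanh z).continuousAt

theorem abs_tanh_le_one (z : ℝ) : |Real.tanh z| ≤ 1 := by
  rw [← sq_le_one_iff_abs_le_one, tanh_sq]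
  nlinarith [sech_pos z]

theorem cosh_le_exp {z : ℝ} (hz : 0 ≤ z) : Real.cosh z ≤ Real.exp z := by
  rw [Real.cosh_eq]
  have : Real.exp (-z) ≤ Real.exp z := Real.exp_le_exp.2 (by linarith)
  linarith

theorem sinh_le_cosh (z : ℝ) : Real.sinh z ≤ Real.cosh z := by
  rw [Real.cosh_eq, Real.sinh_eq]
  linarith [Real.exp_pos (-z)]

theorem le_cosh {z : ℝ} (hz : 0 ≤ z) : z ≤ Real.cosh z :=
  (Real.self_le_sinh_iff.2 hz).trans (sinh_le_cosh z)

theorem exp_neg_le_sech {z : ℝ} (hz : 0 ≤ z) : Real.exp (-z) ≤ sech z := by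
  rw [Real.exp_neg]
  exact inv_anti₀ (Real.cosh_pos z) (cosh_le_exp hz)

theorem sech_le_two_mul_exp (z : ℝ) : sech z ≤ 2 * Real.exp (-z) := by
  rw [Real.exp_neg, sech, inv_le_comm₀ (Real.cosh_pos z) (by positivity), mul_inv, inv_inv,
    Real.cosh_eq]
  linarith [Real.exp_pos (-z)]

theorem mul_sech_le_one {z : ℝ} (hz : 0 ≤ z) : z * sech z ≤ 1 := by
  rw [sech, ← div_eq_mul_inv, div_le_one (Real.cosh_pos z)]
  exact le_cosh hz

theorem integrableOn_of_le_exp {f : ℝ → ℝ} {a K k : ℝ} (hk : 0 < k)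
    (hf : AEStronglyMeasurable f) (h : ∀ z, a < z → |f z| ≤ K * Real.exp (-k * z)) :
    IntegrableOn f (Set.Ioi a) := by
  refine ((exp_neg_integrableOn_Ioi a hk).const_mul K).mono' hf.restrict ?_
  exact (ae_restrict_mem measurableSet_Ioi).mono fun z hz => h z hz

theorem integrableOn_of_le_sech {f : ℝ → ℝ} (hf : Continuous f) {K : ℝ}
    (h : ∀ z, 0 ≤ z → |f z| ≤ K * sech z) : IntegrableOn f (Set.Ioi 0) := by
  have hK : 0 ≤ K := by
    have := (abs_nonneg _).trans (h 0 le_rfl)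
    rwa [sech_zero, mul_one] at this
  refine integrableOn_of_le_exp (K := 2 * K) one_pos hf.aestronglyMeasurable fun z hz => ?_
  have h1 := mul_le_mul_of_nonneg_left (sech_le_two_mul_exp z) hK
  calc |f z| ≤ K * (2 * Real.exp (-z)) := (h z hz.le).trans h1
    _ = _ := by rw [neg_one_mul]; ring

theorem tendsto_sech_atTop : Tendsto sech atTop (𝓝 0) := by
  refine squeeze_zero (fun z => (sech_pos z).le) sech_le_two_mul_exp ?_
  have := (Real.tendsto_exp_neg_atTop_nhds_zero).const_mul 2
  simpa using this

theorem tendsto_zero_of_le_sech {f : ℝ → ℝ} {K : ℝ} (h : ∀ z, 0 ≤ z → |f z| ≤ K * sech z) :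
    Tendsto f atTop (𝓝 0) := by
  refine squeeze_zero_norm' (a := fun z => K * sech z) ?_ ?_
  · filter_upwards [eventually_ge_atTop 0] with z hz using h z hz
  · simpa using tendsto_sech_atTop.const_mul K

/-! ### Moments of powers of the hyperbolic secant -/

/-- `∫₀^∞ sech^n`. -/
noncomputable def sechMoment (n : ℕ) : ℝ := ∫ z in Set.Ioi 0, sech z ^ n

theorem sech_pow_le {n m : ℕ} (h : m ≤ n) (z : ℝ) : sech z ^ n ≤ sech z ^ m :=
  pow_le_pow_of_le_one (sech_pos z).le (sech_le_one z) h

theorem sech_pow_le_sech {n : ℕ} (hn : 1 ≤ n) (z : ℝ) : sech z ^ n ≤ sech z :=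
  (sech_pow_le hn z).trans_eq (pow_one _)

theorem integrableOn_sech_pow {n : ℕ} (hn : 1 ≤ n) :
    IntegrableOn (fun z => sech z ^ n) (Set.Ioi 0) :=
  integrableOn_of_le_sech (continuous_sech.pow n) (K := 1) fun z _ => by
    rw [abs_of_pos (pow_pos (sech_pos z) n), one_mul]
    exact sech_pow_le_sech hn z

theorem integral_Ioi_eq_neg {F f : ℝ → ℝ} {a : ℝ} (hF : ∀ z, a ≤ z → HasDerivAt F (f z) z)
    (hf : IntegrableOn f (Set.Ioi a)) (h0 : Tendsto F atTop (𝓝 0)) :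
    ∫ z in Set.Ioi a, f z = -F a := by
  rw [integral_Ioi_of_hasDerivAt_of_tendsto' (fun z hz => hF z hz) hf h0, zero_sub]

theorem sechMoment_two : sechMoment 2 = 1 := by
  have h0 : Tendsto (fun z => Real.tanh z - 1) atTop (𝓝 0) := by
    refine tendsto_zero_of_le_sech (K := 1) fun z hz => ?_
    rw [one_mul, tanh_eq_sinh_mul_sech, abs_le]
    have h1 := cosh_mul_sech z
    have h2 : Real.cosh z - Real.sinh z = Real.exp (-z) := Real.cosh_sub_sinh z
    have h3 : Real.sinh z * sech z - 1 = -(Real.exp (-z) * sech z) := by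
      rw [← h2]; linear_combination h1
    have h4 : Real.exp (-z) ≤ 1 := Real.exp_le_one_iff.2 (by linarith)
    have h5 : 0 < Real.exp (-z) := Real.exp_pos _
    have h6 := sech_pos z
    rw [h3]
    constructor <;> nlinarith
  have := integral_Ioi_eq_neg (F := fun z => Real.tanh z - 1) (a := 0)
    (fun z _ => (hasDerivAt_tanh z).sub_const 1) (integrableOn_sech_pow (by norm_num)) h0
  rw [sechMoment, this]
  simp

/-- Integrate the derivative of sech^n · tanh over the half-line; both boundary terms vanish. -/
theorem sechMoment_add_two {n : ℕ} (hn : 1 ≤ n) :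
    (n + 1) * sechMoment (n + 2) = n * sechMoment n := by
  have hd : ∀ z, (0 : ℝ) ≤ z → HasDerivAt (fun z => sech z ^ n * Real.tanh z)
      ((n + 1) * sech z ^ (n + 2) - n * sech z ^ n) z := fun z _ => by
    convert! (hasDerivAt_sech_pow n z).mul (hasDerivAt_tanh z) using 1
    have := tanh_sq z
    linear_combination n * sech z ^ n * this
  have h1 := (integrableOn_sech_pow (n := n + 2) (by omega)).const_mul ((n : ℝ) + 1)
  have h2 := (integrableOn_sech_pow hn).const_mul (n : ℝ)
  have h := integral_Ioi_eq_neg hd (h1.sub h2) (tendsto_zero_of_le_sech (K := 1) fun z hz => by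
    rw [abs_mul, abs_of_pos (pow_pos (sech_pos z) n), one_mul]
    exact (mul_le_of_le_one_right (pow_pos (sech_pos z) n).le (abs_tanh_le_one z)).trans
      (sech_pow_le_sech hn z))
  rw [integral_sub h1 h2, integral_const_mul, integral_const_mul] at h
  simp only [Real.tanh_zero, mul_zero, neg_zero] at h
  exact sub_eq_zero.1 h

theorem sechMoment_four : sechMoment 4 = 2 / 3 := by
  have := sechMoment_add_two (n := 2) (by norm_num)
  norm_num [sechMoment_two] at this
  linarith

theorem sechMoment_six : sechMoment 6 = 8 / 15 := by
  have := sechMoment_add_two (n := 4) (by norm_num)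
  norm_num [sechMoment_four] at this
  linarith

theorem sechMoment_eight : sechMoment 8 = 16 / 35 := by
  have := sechMoment_add_two (n := 6) (by norm_num)
  norm_num [sechMoment_six] at this
  linarith

theorem sechMoment_ten : sechMoment 10 = 128 / 315 := by
  have := sechMoment_add_two (n := 8) (by norm_num)
  norm_num [sechMoment_eight] at this
  linarith

theorem abs_mul_sech_pow_mul_tanh_le {n : ℕ} (hn : 2 ≤ n) {z : ℝ} (hz : 0 ≤ z) :
    |z * sech z ^ n * Real.tanh z| ≤ 1 * sech z := by
  obtain ⟨k, rfl⟩ := Nat.exists_eq_add_of_le hn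
  have h1 := mul_sech_le_one hz
  have h2 := sech_pow_le_sech (n := 1 + k) (by omega) z
  have h3 := abs_tanh_le_one z
  have h4 := sech_pos z
  have h5 : z * sech z ^ (2 + k) = (z * sech z) * sech z ^ (1 + k) := by ring
  rw [h5, abs_mul, abs_of_nonneg (by positivity)]
  calc z * sech z * sech z ^ (1 + k) * |Real.tanh z|
      ≤ 1 * sech z * 1 := by gcongr
    _ = _ := mul_one _

theorem integrableOn_mul_sech_pow_mul_tanh {n : ℕ} (hn : 2 ≤ n) :
    IntegrableOn (fun z => z * sech z ^ n * Real.tanh z) (Set.Ioi 0) :=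
  integrableOn_of_le_sech ((continuous_id.mul (continuous_sech.pow n)).mul continuous_tanh)
    fun _ hz => abs_mul_sech_pow_mul_tanh_le hn hz

/-- Integrate the derivative of z · sech^n over the half-line; both boundary terms vanish. -/
theorem integral_mul_sech_pow_mul_tanh {n : ℕ} (hn : 2 ≤ n) :
    n * ∫ z in Set.Ioi 0, z * sech z ^ n * Real.tanh z = sechMoment n := by
  have hd : ∀ z, (0 : ℝ) ≤ z → HasDerivAt (fun z => z * sech z ^ n)
      (sech z ^ n - n * (z * sech z ^ n * Real.tanh z)) z := fun z _ => by
    convert! (hasDerivAt_id z).mul (hasDerivAt_sech_pow n z) using 1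
    simp only [id]
    ring
  have h1 := integrableOn_sech_pow (n := n) (by omega)
  have h2 := (integrableOn_mul_sech_pow_mul_tanh hn).const_mul (n : ℝ)
  have h := integral_Ioi_eq_neg hd (h1.sub h2) (tendsto_zero_of_le_sech (K := 1) fun z hz => by
    obtain ⟨k, rfl⟩ := Nat.exists_eq_add_of_le hn
    have h1 := mul_sech_le_one hz
    have h2 := sech_pow_le_sech (n := 1 + k) (by omega) z
    have h4 := sech_pos z
    rw [show z * sech z ^ (2 + k) = (z * sech z) * sech z ^ (1 + k) by ring,
      abs_of_nonneg (by positivity)]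
    gcongr)
  rw [integral_sub h1 h2, integral_const_mul] at h
  simp only [zero_mul, neg_zero] at h
  exact (sub_eq_zero.1 h).symm

/-! ### Even and odd reflections -/

theorem hasDerivAt_of_Iic_of_Ici {f : ℝ → ℝ} {f' a : ℝ} (h1 : HasDerivWithinAt f f' (Set.Iic a) a)
    (h2 : HasDerivWithinAt f f' (Set.Ici a) a) : HasDerivAt f f' a := by
  have := h1.union h2
  rwa [Set.Iic_union_Ici, hasDerivWithinAt_univ] at this

/-- The odd reflection of a function on the half-line. -/
noncomputable def oddReflect (p : ℝ → ℝ) (z : ℝ) : ℝ := if 0 ≤ z then p z else -p (-z)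

theorem oddReflect_of_nonneg {p : ℝ → ℝ} {z : ℝ} (h : 0 ≤ z) : oddReflect p z = p z := if_pos h

theorem oddReflect_of_nonpos {p : ℝ → ℝ} (h0 : p 0 = 0) {z : ℝ} (h : z ≤ 0) :
    oddReflect p z = -p (-z) := by
  rcases h.lt_or_eq with h | rfl
  · exact if_neg (not_le.2 h)
  · rw [oddReflect_of_nonneg le_rfl, neg_zero, h0, neg_zero]

/-- The one-sided slopes at 0 are ± p'(0), so the even reflection is differentiable there because
p'(0) = 0. This Neumann condition is what every mode has to satisfy. -/
theorem hasDerivAt_comp_abs {p p' : ℝ → ℝ} (h : ∀ r, HasDerivAt p (p' r) r) (h0 : p' 0 = 0)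
    (z : ℝ) : HasDerivAt (fun z => p |z|) (oddReflect p' z) z := by
  have hneg : ∀ z, HasDerivAt (fun z => p (-z)) (-p' (-z)) z := fun z => by
    convert! (h (-z)).comp z (hasDerivAt_neg z) using 1
    ring
  rcases lt_trichotomy z 0 with hz | rfl | hz
  · rw [oddReflect_of_nonpos h0 hz.le]
    refine (hneg z).congr_of_eventuallyEq ?_
    filter_upwards [Iio_mem_nhds hz] with y hy
    rw [abs_of_neg hy]
  · rw [oddReflect_of_nonneg le_rfl]
    refine hasDerivAt_of_Iic_of_Ici ?_ ?_
    · have := (hneg 0).hasDerivWithinAt (s := Set.Iic 0)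
      rw [neg_zero, h0, neg_zero] at this
      rw [h0]
      exact this.congr (fun y hy => by rw [abs_of_nonpos hy]) (by simp)
    · exact (h 0).hasDerivWithinAt.congr (fun y hy => by rw [abs_of_nonneg hy]) (by simp)
  · rw [oddReflect_of_nonneg hz.le]
    refine (h z).congr_of_eventuallyEq ?_
    filter_upwards [Ioi_mem_nhds hz] with y hy
    rw [abs_of_pos hy]

theorem hasDerivAt_oddReflect {p p' : ℝ → ℝ} (h : ∀ r, HasDerivAt p (p' r) r) (h0 : p 0 = 0)
    (z : ℝ) : HasDerivAt (oddReflect p) (p' |z|) z := by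
  have hneg : ∀ z, HasDerivAt (fun z => -p (-z)) (p' (-z)) z := fun z => by
    convert! ((h (-z)).comp z (hasDerivAt_neg z)).neg using 1
    ring
  rcases lt_trichotomy z 0 with hz | rfl | hz
  · rw [abs_of_neg hz]
    refine (hneg z).congr_of_eventuallyEq ?_
    filter_upwards [Iio_mem_nhds hz] with y hy
    rw [oddReflect_of_nonpos h0 (le_of_lt hy)]
  · rw [abs_zero]
    refine hasDerivAt_of_Iic_of_Ici ?_ ?_
    · have := (hneg 0).hasDerivWithinAt (s := Set.Iic 0)
      rw [neg_zero] at this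
      exact this.congr (fun y hy => oddReflect_of_nonpos h0 hy) (oddReflect_of_nonpos h0 le_rfl)
    · exact (h 0).hasDerivWithinAt.congr (fun y hy => oddReflect_of_nonneg hy)
        (oddReflect_of_nonneg le_rfl)
  · rw [abs_of_pos hz]
    refine (h z).congr_of_eventuallyEq ?_
    filter_upwards [Ioi_mem_nhds hz] with y hy
    rw [oddReflect_of_nonneg (le_of_lt hy)]

theorem continuous_oddReflect {p : ℝ → ℝ} (h : Continuous p) (h0 : p 0 = 0) :
    Continuous (oddReflect p) := by
  unfold oddReflect
  refine Continuous.if_le h (by fun_prop) continuous_const continuous_id fun z hz => ?_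
  rw [← hz, neg_zero, h0, neg_zero]

/-! ### Green operators on the half-line -/

/-- The space of bounded continuous real functions. -/
def BddFun (X : Type*) [TopologicalSpace X] : Type _ := BoundedContinuousFunction X ℝ

namespace BddFun

variable {X : Type*} [TopologicalSpace X]

noncomputable instance instNormedAddCommGroup : NormedAddCommGroup (BddFun X) :=
  inferInstanceAs (NormedAddCommGroup (BoundedContinuousFunction X ℝ))

noncomputable instance instNormedSpace : NormedSpace ℝ (BddFun X) :=
  inferInstanceAs (NormedSpace ℝ (BoundedContinuousFunction X ℝ))

instance instCompleteSpace : CompleteSpace (BddFun X) :=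
  inferInstanceAs (CompleteSpace (BoundedContinuousFunction X ℝ))

instance instFunLike : FunLike (BddFun X) X ℝ :=
  inferInstanceAs (FunLike (BoundedContinuousFunction X ℝ) X ℝ)

/-- An element of `BddFun X`, from a continuous function and a bound. -/
def ofBound (f : X → ℝ) (hf : Continuous f) (K : ℝ) (h : ∀ z, |f z| ≤ K) : BddFun X :=
  BoundedContinuousFunction.ofNormedAddCommGroup f hf K h

theorem ofBound_apply (f : X → ℝ) (hf : Continuous f) (K : ℝ) (h : ∀ z, |f z| ≤ K) (z : X) :
    ofBound f hf K h z = f z := rfl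

theorem norm_ofBound_le (f : X → ℝ) (hf : Continuous f) {K : ℝ} (hK : 0 ≤ K)
    (h : ∀ z, |f z| ≤ K) : ‖ofBound f hf K h‖ ≤ K :=
  BoundedContinuousFunction.norm_ofNormedAddCommGroup_le hf hK h

@[ext]
theorem ext {g h : BddFun X} (H : ∀ z, g z = h z) : g = h := BoundedContinuousFunction.ext H

theorem continuous (g : BddFun X) : Continuous g := BoundedContinuousFunction.continuous g

theorem norm_coe_le_norm (g : BddFun X) (z : X) : ‖g z‖ ≤ ‖g‖ :=
  BoundedContinuousFunction.norm_coe_le_norm g z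

theorem norm_le {g : BddFun X} {K : ℝ} (hK : 0 ≤ K) : ‖g‖ ≤ K ↔ ∀ z, ‖g z‖ ≤ K :=
  BoundedContinuousFunction.norm_le hK

theorem add_apply (g h : BddFun X) (z : X) : (g + h) z = g z + h z := rfl

theorem sub_apply (g h : BddFun X) (z : X) : (g - h) z = g z - h z := rfl

theorem zero_apply (z : X) : (0 : BddFun X) z = 0 := rfl

theorem smul_apply (c : ℝ) (g : BddFun X) (z : X) : (c • g) z = c • g z := rfl

/-- Evaluation at a point. -/
noncomputable def eval (z : X) : BddFun X →L[ℝ] ℝ :=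
  LinearMap.mkContinuous
    { toFun := fun g => g z
      map_add' := fun _ _ => rfl
      map_smul' := fun _ _ => rfl } 1 fun g => by
    rw [one_mul]; exact g.norm_coe_le_norm z

end BddFun

/-- Bounded continuous functions `g`, standing for the profiles `sech · g`. -/
abbrev Profile : Type := BddFun ℝ

/-- A pair of solutions of `y'' = V y` on the half-line, `d` decaying and `e` growing at the
exponential rate `κ > 1`, with constant Wronskian `W`. -/
structure GreenPair where
  (d d' e e' V : ℝ → ℝ)
  (W κ A B : ℝ)
  hd : ∀ x, HasDerivAt d (d' x) x
  hd' : ∀ x, HasDerivAt d' (V x * d x) x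
  he : ∀ x, HasDerivAt e (e' x) x
  he' : ∀ x, HasDerivAt e' (V x * e x) x
  wronskian : ∀ x, d x * e' x - e x * d' x = W
  W_pos : 0 < W
  one_lt : 1 < κ
  d_le : ∀ x, 0 ≤ x → |d x| ≤ A * Real.exp (-κ * x)
  d'_le : ∀ x, 0 ≤ x → |d' x| ≤ A * Real.exp (-κ * x)
  e_le : ∀ x, 0 ≤ x → |e x| ≤ B * Real.exp (κ * x)
  e'_le : ∀ x, 0 ≤ x → |e' x| ≤ B * Real.exp (κ * x)

namespace GreenPair

variable (P : GreenPair)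

theorem A_nonneg : 0 ≤ P.A := by
  simpa using (abs_nonneg _).trans (P.d_le 0 le_rfl)

theorem B_nonneg : 0 ≤ P.B := by
  simpa using (abs_nonneg _).trans (P.e_le 0 le_rfl)

theorem continuous_d : Continuous P.d :=
  continuous_iff_continuousAt.2 fun x => (P.hd x).continuousAt

theorem continuous_e : Continuous P.e :=
  continuous_iff_continuousAt.2 fun x => (P.he x).continuousAt

/-- `∫_r^∞ d · sech · g`. -/
noncomputable def tail (g : Profile) (r : ℝ) : ℝ :=
  -- A difference of integrals rather than an integral over (r, ∞): in this form it is
  -- differentiable at every real r. The two agree for r ≥ 0 by `tail_eq`.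
  (∫ x in Set.Ioi 0, P.d x * (sech x * g x)) - ∫ x in (0 : ℝ)..r, P.d x * (sech x * g x)

/-- `∫_0^r e · sech · g`. -/
noncomputable def head (g : Profile) (r : ℝ) : ℝ := ∫ x in (0 : ℝ)..r, P.e x * (sech x * g x)

/-- The solution of `-q'' + V q = sech · g` by variation of constants. -/
noncomputable def sol (g : Profile) (r : ℝ) : ℝ := (P.e r * P.tail g r + P.d r * P.head g r) / P.W

/-- The derivative of `GreenPair.sol`. -/
noncomputable def sol' (g : Profile) (r : ℝ) : ℝ :=
  (P.e' r * P.tail g r + P.d' r * P.head g r) / P.W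

theorem continuous_tail_integrand (g : Profile) :
    Continuous fun x => P.d x * (sech x * g x) :=
  P.continuous_d.mul (continuous_sech.mul g.continuous)

theorem continuous_head_integrand (g : Profile) :
    Continuous fun x => P.e x * (sech x * g x) :=
  P.continuous_e.mul (continuous_sech.mul g.continuous)

theorem hasDerivAt_tail (g : Profile) (r : ℝ) :
    HasDerivAt (P.tail g) (-(P.d r * (sech r * g r))) r :=
  (((P.continuous_tail_integrand g).integral_hasStrictDerivAt 0 r).hasDerivAt).const_sub _

theorem hasDerivAt_head (g : Profile) (r : ℝ) :
    HasDerivAt (P.head g) (P.e r * (sech r * g r)) r :=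
  ((P.continuous_head_integrand g).integral_hasStrictDerivAt 0 r).hasDerivAt

theorem hasDerivAt_sol (g : Profile) (r : ℝ) : HasDerivAt (P.sol g) (P.sol' g r) r := by
  convert! (((P.he r).mul (P.hasDerivAt_tail g r)).add
    ((P.hd r).mul (P.hasDerivAt_head g r))).div_const P.W using 1
  rw [sol']
  ring

/-- The terms in which the integrals are differentiated combine to the Wronskian times the source,
and the Wronskian cancels against `W`. -/
theorem hasDerivAt_sol' (g : Profile) (r : ℝ) :
    HasDerivAt (P.sol' g) (P.V r * P.sol g r - sech r * g r) r := by
  convert! (((P.he' r).mul (P.hasDerivAt_tail g r)).add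
    ((P.hd' r).mul (P.hasDerivAt_head g r))).div_const P.W using 1
  have h := P.wronskian r
  have hW := P.W_pos.ne'
  rw [sol]
  field_simp
  linear_combination (sech r * g r) * h

theorem abs_sech_mul_le (g : Profile) (x : ℝ) : |sech x * g x| ≤ ‖g‖ * (2 * Real.exp (-x)) := by
  rw [abs_mul, abs_of_pos (sech_pos x), mul_comm]
  exact mul_le_mul (g.norm_coe_le_norm x) (sech_le_two_mul_exp x) (sech_pos x).le (norm_nonneg g)

theorem tail_integrand_le (g : Profile) {x : ℝ} (hx : 0 ≤ x) :
    |P.d x * (sech x * g x)| ≤ 2 * P.A * ‖g‖ * Real.exp (-(P.κ + 1) * x) := by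
  rw [abs_mul]
  refine (mul_le_mul (P.d_le x hx) (abs_sech_mul_le g x) (abs_nonneg _)
    (mul_nonneg P.A_nonneg (Real.exp_pos _).le)).trans_eq ?_
  rw [show -(P.κ + 1) * x = -P.κ * x + -x by ring, Real.exp_add]
  ring

theorem head_integrand_le (g : Profile) {x : ℝ} (hx : 0 ≤ x) :
    |P.e x * (sech x * g x)| ≤ 2 * P.B * ‖g‖ * Real.exp ((P.κ - 1) * x) := by
  rw [abs_mul]
  refine (mul_le_mul (P.e_le x hx) (abs_sech_mul_le g x) (abs_nonneg _)
    (mul_nonneg P.B_nonneg (Real.exp_pos _).le)).trans_eq ?_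
  rw [show (P.κ - 1) * x = P.κ * x + -x by ring, Real.exp_add]
  ring

theorem integrableOn_tail (g : Profile) {r : ℝ} (hr : 0 ≤ r) :
    IntegrableOn (fun x => P.d x * (sech x * g x)) (Set.Ioi r) :=
  integrableOn_of_le_exp (by linarith [P.one_lt])
    (P.continuous_tail_integrand g).aestronglyMeasurable
    fun x hx => P.tail_integrand_le g (hr.trans hx.le)

theorem tail_eq (g : Profile) {r : ℝ} (hr : 0 ≤ r) :
    P.tail g r = ∫ x in Set.Ioi r, P.d x * (sech x * g x) := by
  rw [tail, sub_eq_iff_eq_add, add_comm]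
  exact (intervalIntegral.integral_interval_add_Ioi (P.integrableOn_tail g le_rfl)
    (P.integrableOn_tail g hr)).symm

theorem abs_tail_le (g : Profile) {r : ℝ} (hr : 0 ≤ r) :
    |P.tail g r| ≤ 2 * P.A * ‖g‖ / (P.κ + 1) * Real.exp (-(P.κ + 1) * r) := by
  have hk : 0 < P.κ + 1 := by linarith [P.one_lt]
  rw [P.tail_eq g hr, ← Real.norm_eq_abs]
  have h1 : IntegrableOn (fun x => 2 * P.A * ‖g‖ * Real.exp (-(P.κ + 1) * x)) (Set.Ioi r) :=
    (exp_neg_integrableOn_Ioi r hk).const_mul _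
  refine (norm_integral_le_of_norm_le h1 ?_).trans_eq ?_
  · exact (ae_restrict_mem measurableSet_Ioi).mono fun x hx =>
      P.tail_integrand_le g (hr.trans (le_of_lt hx))
  · rw [integral_const_mul, integral_exp_mul_Ioi (by linarith)]
    field_simp

theorem abs_head_le (g : Profile) {r : ℝ} (hr : 0 ≤ r) :
    |P.head g r| ≤ 2 * P.B * ‖g‖ / (P.κ - 1) * Real.exp ((P.κ - 1) * r) := by
  have hk : 0 < P.κ - 1 := by linarith [P.one_lt]
  have hd : ∀ x ∈ Set.uIcc 0 r, HasDerivAt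
      (fun x => 2 * P.B * ‖g‖ / (P.κ - 1) * Real.exp ((P.κ - 1) * x))
      (2 * P.B * ‖g‖ * Real.exp ((P.κ - 1) * x)) x := fun x _ => by
    convert! (((hasDerivAt_id x).const_mul (P.κ - 1)).exp).const_mul
      (2 * P.B * ‖g‖ / (P.κ - 1)) using 1
    simp only [id]
    field_simp
  have hi : IntervalIntegrable (fun x => 2 * P.B * ‖g‖ * Real.exp ((P.κ - 1) * x)) volume 0 r :=
    Continuous.intervalIntegrable (by fun_prop) _ _
  have h1 := intervalIntegral.integral_eq_sub_of_hasDerivAt hd hi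
  have h2 := intervalIntegral.norm_integral_le_of_norm_le (f := fun x => P.e x * (sech x * g x)) hr
    (ae_of_all _ fun x hx => P.head_integrand_le g hx.1.le) hi
  rw [h1] at h2
  refine h2.trans (sub_le_self _ ?_)
  have := P.B_nonneg
  positivity

/-- The norm bound of the Green operator. -/
noncomputable def bound : ℝ := 4 * P.A * P.B * P.κ / ((P.κ ^ 2 - 1) * P.W)

theorem bound_nonneg : 0 ≤ P.bound := by
  have h1 := P.A_nonneg
  have h2 := P.B_nonneg
  have h3 := P.one_lt
  have h4 := P.W_pos
  have h5 : 0 < P.κ ^ 2 - 1 := by nlinarith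
  unfold bound
  positivity

/-- A source of size e^{-x} makes `tail` of size e^{-(κ+1)r} and, as κ > 1, `head` of size
e^{(κ-1)r}. Multiplied by solutions of size e^{κr} and e^{-κr}, both give e^{-r}, so the weight sech
is preserved. The constant is the sum 1/(κ+1) + 1/(κ-1) = 2κ/(κ²-1). -/
theorem combination_le (g : Profile) {r x y : ℝ} (hr : 0 ≤ r)
    (hx : |x| ≤ P.B * Real.exp (P.κ * r)) (hy : |y| ≤ P.A * Real.exp (-P.κ * r)) :
    |(x * P.tail g r + y * P.head g r) / P.W| ≤ P.bound * ‖g‖ * sech r := by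
  have hA := P.A_nonneg
  have hB := P.B_nonneg
  have hk := P.one_lt
  have hW := P.W_pos
  have hk1 : 0 < P.κ - 1 := by linarith
  have hk2 : 0 < P.κ + 1 := by linarith
  have hk3 : P.κ ^ 2 - 1 = (P.κ - 1) * (P.κ + 1) := by ring
  have h1 : |x * P.tail g r| ≤ 2 * P.A * P.B * ‖g‖ / (P.κ + 1) * Real.exp (-r) := by
    rw [abs_mul]
    refine (mul_le_mul hx (P.abs_tail_le g hr) (abs_nonneg _) (by positivity)).trans_eq ?_
    rw [show -r = P.κ * r + -(P.κ + 1) * r by ring, Real.exp_add]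
    ring
  have h2 : |y * P.head g r| ≤ 2 * P.A * P.B * ‖g‖ / (P.κ - 1) * Real.exp (-r) := by
    rw [abs_mul]
    refine (mul_le_mul hy (P.abs_head_le g hr) (abs_nonneg _) (by positivity)).trans_eq ?_
    rw [show -r = -P.κ * r + (P.κ - 1) * r by ring, Real.exp_add]
    ring
  rw [abs_div, abs_of_pos hW]
  calc |x * P.tail g r + y * P.head g r| / P.W
      ≤ (2 * P.A * P.B * ‖g‖ / (P.κ + 1) * Real.exp (-r)
        + 2 * P.A * P.B * ‖g‖ / (P.κ - 1) * Real.exp (-r)) / P.W := by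
        gcongr
        exact (abs_add_le _ _).trans (add_le_add h1 h2)
    _ = P.bound * ‖g‖ * Real.exp (-r) := by
        rw [bound, hk3]
        field_simp
        ring
    _ ≤ P.bound * ‖g‖ * sech r := by
        have := P.bound_nonneg
        gcongr
        exact exp_neg_le_sech hr

theorem abs_sol_le (g : Profile) {r : ℝ} (hr : 0 ≤ r) :
    |P.sol g r| ≤ P.bound * ‖g‖ * sech r :=
  P.combination_le g hr (P.e_le r hr) (P.d_le r hr)

theorem abs_sol'_le (g : Profile) {r : ℝ} (hr : 0 ≤ r) :
    |P.sol' g r| ≤ P.bound * ‖g‖ * sech r :=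
  P.combination_le g hr (P.e'_le r hr) (P.d'_le r hr)

theorem tail_add (g h : Profile) (r : ℝ) : P.tail (g + h) r = P.tail g r + P.tail h r := by
  have h1 : ∀ x, P.d x * (sech x * (g + h) x)
      = P.d x * (sech x * g x) + P.d x * (sech x * h x) := fun x => by
    rw [BddFun.add_apply]; ring
  simp only [tail, h1]
  rw [integral_add (P.integrableOn_tail g le_rfl) (P.integrableOn_tail h le_rfl),
    intervalIntegral.integral_add ((P.continuous_tail_integrand g).intervalIntegrable _ _)
      ((P.continuous_tail_integrand h).intervalIntegrable _ _)]
  ring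

theorem tail_smul (c : ℝ) (g : Profile) (r : ℝ) : P.tail (c • g) r = c * P.tail g r := by
  have h1 : ∀ x, P.d x * (sech x * (c • g) x) = c * (P.d x * (sech x * g x)) := fun x => by
    rw [BddFun.smul_apply, smul_eq_mul]; ring
  simp only [tail, h1]
  rw [integral_const_mul, intervalIntegral.integral_const_mul]
  ring

theorem head_add (g h : Profile) (r : ℝ) : P.head (g + h) r = P.head g r + P.head h r := by
  have h1 : ∀ x, P.e x * (sech x * (g + h) x)
      = P.e x * (sech x * g x) + P.e x * (sech x * h x) := fun x => by
    rw [BddFun.add_apply]; ring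
  simp only [head, h1]
  rw [intervalIntegral.integral_add ((P.continuous_head_integrand g).intervalIntegrable _ _)
      ((P.continuous_head_integrand h).intervalIntegrable _ _)]

theorem head_smul (c : ℝ) (g : Profile) (r : ℝ) : P.head (c • g) r = c * P.head g r := by
  have h1 : ∀ x, P.e x * (sech x * (c • g) x) = c * (P.e x * (sech x * g x)) := fun x => by
    rw [BddFun.smul_apply, smul_eq_mul]; ring
  simp only [head, h1]
  rw [intervalIntegral.integral_const_mul]

theorem sol_add (g h : Profile) (r : ℝ) : P.sol (g + h) r = P.sol g r + P.sol h r := by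
  simp only [sol, tail_add, head_add]; ring

theorem sol_smul (c : ℝ) (g : Profile) (r : ℝ) : P.sol (c • g) r = c * P.sol g r := by
  simp only [sol, tail_smul, head_smul]; ring

theorem sol'_add (g h : Profile) (r : ℝ) : P.sol' (g + h) r = P.sol' g r + P.sol' h r := by
  simp only [sol', tail_add, head_add]; ring

theorem sol'_smul (c : ℝ) (g : Profile) (r : ℝ) : P.sol' (c • g) r = c * P.sol' g r := by
  simp only [sol', tail_smul, head_smul]; ring

theorem continuous_sol (g : Profile) : Continuous (P.sol g) :=
  continuous_iff_continuousAt.2 fun r => (P.hasDerivAt_sol g r).continuousAt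

theorem continuous_sol' (g : Profile) : Continuous (P.sol' g) :=
  continuous_iff_continuousAt.2 fun r => (P.hasDerivAt_sol' g r).continuousAt

end GreenPair

/-- The operator on profiles given by a linear family of functions on the half-line that are
bounded by multiples of `sech`, reflected evenly. -/
noncomputable def evenOp (S : Profile → ℝ → ℝ) (K : ℝ) (hc : ∀ g, Continuous (S g))
    (hadd : ∀ g h r, S (g + h) r = S g r + S h r) (hsmul : ∀ (c : ℝ) g r, S (c • g) r = c * S g r)
    (hK : ∀ g r, 0 ≤ r → |S g r| ≤ K * ‖g‖ * sech r) : Profile →L[ℝ] Profile :=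
  have hb : ∀ g z, |Real.cosh z * S g (|z|)| ≤ K * ‖g‖ := fun g z => by
    rw [abs_mul, abs_of_pos (Real.cosh_pos z)]
    calc Real.cosh z * |S g (|z|)| ≤ Real.cosh z * (K * ‖g‖ * sech |z|) := by
          exact mul_le_mul_of_nonneg_left (hK g _ (abs_nonneg z)) (Real.cosh_pos z).le
      _ = K * ‖g‖ * (Real.cosh z * sech z) := by rw [sech_abs]; ring
      _ = K * ‖g‖ := by rw [cosh_mul_sech, mul_one]
  LinearMap.mkContinuous
    { toFun := fun g => BddFun.ofBound
        (fun z => Real.cosh z * S g (|z|))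
        (Real.continuous_cosh.mul ((hc g).comp continuous_abs)) (K * ‖g‖) (hb g)
      map_add' := fun g h => by
        ext z
        simp only [BddFun.ofBound_apply, hadd,
          BddFun.add_apply]
        ring
      map_smul' := fun c g => by
        ext z
        simp only [BddFun.ofBound_apply, hsmul,
          BddFun.smul_apply, RingHom.id_apply, smul_eq_mul]
        ring }
    K fun g => by
      exact BddFun.norm_ofBound_le _ _ ((abs_nonneg _).trans (hb g 0)) (hb g)

theorem evenOp_apply {S : Profile → ℝ → ℝ} {K : ℝ} {hc : ∀ g, Continuous (S g)}
    {hadd : ∀ g h r, S (g + h) r = S g r + S h r} {hsmul : ∀ (c : ℝ) g r, S (c • g) r = c * S g r}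
    {hK : ∀ g r, 0 ≤ r → |S g r| ≤ K * ‖g‖ * sech r} (g : Profile) (z : ℝ) :
    evenOp S K hc hadd hsmul hK g z = Real.cosh z * S g (|z|) := rfl

theorem norm_evenOp_le {S : Profile → ℝ → ℝ} {K : ℝ} {hc : ∀ g, Continuous (S g)}
    {hadd : ∀ g h r, S (g + h) r = S g r + S h r} {hsmul : ∀ (c : ℝ) g r, S (c • g) r = c * S g r}
    {hK : ∀ g r, 0 ≤ r → |S g r| ≤ K * ‖g‖ * sech r} (h0 : 0 ≤ K) :
    ‖evenOp S K hc hadd hsmul hK‖ ≤ K := by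
  unfold evenOp
  exact LinearMap.mkContinuous_norm_le _ h0 _

/-- The odd reflection of `g - g(0)` on the half-line. -/
noncomputable def oddOp : Profile →L[ℝ] Profile :=
  have hb : ∀ (g : Profile) z, |oddReflect (fun r => g r - g 0) z| ≤ 2 * ‖g‖ := fun g z => by
    have h1 : ∀ r, |g r - g 0| ≤ 2 * ‖g‖ := fun r => by
      refine (abs_sub _ _).trans ?_
      have := g.norm_coe_le_norm r
      have := g.norm_coe_le_norm 0
      simp only [Real.norm_eq_abs] at *
      linarith
    rw [oddReflect]
    split_ifs
    · exact h1 _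
    · rw [abs_neg]; exact h1 _
  LinearMap.mkContinuous
    { toFun := fun g => BddFun.ofBound
        (oddReflect (fun r => g r - g 0))
        (continuous_oddReflect (g.continuous.sub continuous_const) (sub_self _)) (2 * ‖g‖) (hb g)
      map_add' := fun g h => by
        ext z
        simp only [BddFun.ofBound_apply, oddReflect,
          BddFun.add_apply]
        split_ifs <;> ring
      map_smul' := fun c g => by
        ext z
        simp only [BddFun.ofBound_apply, oddReflect,
          BddFun.smul_apply, RingHom.id_apply, smul_eq_mul]
        split_ifs <;> ring }
    2 fun g =>
      BddFun.norm_ofBound_le _ _ ((abs_nonneg _).trans (hb g 0)) (hb g)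

theorem oddOp_apply (g : Profile) (z : ℝ) : oddOp g z = oddReflect (fun r => g r - g 0) z := rfl

theorem norm_oddOp_le : ‖oddOp‖ ≤ 2 := by
  unfold oddOp
  exact LinearMap.mkContinuous_norm_le _ zero_le_two _

namespace GreenPair

variable (P : GreenPair)

/-- The Green operator: `sech · (op g)` solves `-q'' + V q = sech · g`. -/
noncomputable def op : Profile →L[ℝ] Profile :=
  evenOp P.sol P.bound P.continuous_sol P.sol_add P.sol_smul fun g _ hr => P.abs_sol_le g hr

/-- The derivative of the solution given by the Green operator. -/
noncomputable def op' : Profile →L[ℝ] Profile :=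
  oddOp.comp (evenOp P.sol' P.bound P.continuous_sol' P.sol'_add P.sol'_smul
    fun g _ hr => P.abs_sol'_le g hr)

theorem norm_op_le : ‖P.op‖ ≤ P.bound := norm_evenOp_le P.bound_nonneg

theorem norm_op'_le : ‖P.op'‖ ≤ 2 * P.bound :=
  (ContinuousLinearMap.opNorm_comp_le _ _).trans
    (mul_le_mul norm_oddOp_le (norm_evenOp_le P.bound_nonneg) (norm_nonneg _) zero_le_two)

theorem op_apply (g : Profile) (z : ℝ) : P.op g z = Real.cosh z * P.sol g |z| := rfl

theorem sech_mul_op (g : Profile) (z : ℝ) : sech z * P.op g z = P.sol g |z| := by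
  rw [op_apply, ← mul_assoc, mul_comm (sech z), cosh_mul_sech, one_mul]

theorem op_neg (g : Profile) (z : ℝ) : P.op g (-z) = P.op g z := by
  rw [op_apply, op_apply, abs_neg, Real.cosh_neg]

/-- Subtracting the value at 0 in `oddOp` only makes `op'` a bounded operator into continuous
functions for every argument. When `sol' g 0 = 0` nothing is subtracted, and `op'` is the true
derivative. -/
theorem sech_mul_op' {g : Profile} (h : P.sol' g 0 = 0) (z : ℝ) :
    sech z * P.op' g z = oddReflect (P.sol' g) z := by
  rw [op', ContinuousLinearMap.comp_apply, oddOp_apply]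
  simp only [evenOp_apply, abs_zero, h, mul_zero, sub_zero, oddReflect]
  have h1 := cosh_mul_sech z
  split_ifs with hz
  · rw [abs_of_nonneg hz]; linear_combination P.sol' g z * h1
  · rw [abs_neg, abs_of_neg (not_le.1 hz), Real.cosh_neg]
    linear_combination -P.sol' g (-z) * h1

theorem hasDerivAt_op {g : Profile} (h : P.sol' g 0 = 0) (z : ℝ) :
    HasDerivAt (fun z => sech z * P.op g z) (sech z * P.op' g z) z := by
  simp only [sech_mul_op, P.sech_mul_op' h]
  exact hasDerivAt_comp_abs (P.hasDerivAt_sol g) h z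

theorem hasDerivAt_op' {g : Profile} (h : P.sol' g 0 = 0) (z : ℝ) :
    HasDerivAt (fun z => sech z * P.op' g z)
      (P.V |z| * (sech z * P.op g z) - sech z * g |z|) z := by
  simp only [sech_mul_op, P.sech_mul_op' h]
  simpa only [sech_abs] using hasDerivAt_oddReflect (P.hasDerivAt_sol' g) h z

/-- Green's identity on the half-line. -/
theorem integral_mul_eq {g : Profile} (h : P.sol' g 0 = 0) {p p' p'' : ℝ → ℝ}
    (hp : ∀ x, HasDerivAt p (p' x) x) (hp' : ∀ x, HasDerivAt p' (p'' x) x) (h0 : p' 0 = 0)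
    {K : ℝ} (hpK : ∀ x, 0 ≤ x → |p x| ≤ K) (hpK' : ∀ x, 0 ≤ x → |p' x| ≤ K)
    (hc : Continuous fun x => -p'' x + P.V x * p x)
    (hq : ∀ x, 0 ≤ x → |-p'' x + P.V x * p x| ≤ K) :
    ∫ x in Set.Ioi 0, (-p'' x + P.V x * p x) * P.sol g x
      = ∫ x in Set.Ioi 0, p x * (sech x * g x) := by
  have hcp : Continuous p := continuous_iff_continuousAt.2 fun x => (hp x).continuousAt
  have hKn : 0 ≤ K := (abs_nonneg _).trans (hpK 0 le_rfl)
  have hbn := P.bound_nonneg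
  have hi1 : IntegrableOn (fun x => (-p'' x + P.V x * p x) * P.sol g x) (Set.Ioi 0) := by
    refine integrableOn_of_le_sech (hc.mul (P.continuous_sol g)) (K := K * (P.bound * ‖g‖))
      fun x hx => ?_
    rw [abs_mul, mul_assoc]
    exact mul_le_mul (hq x hx) (P.abs_sol_le g hx) (abs_nonneg _) hKn
  have hi2 : IntegrableOn (fun x => p x * (sech x * g x)) (Set.Ioi 0) := by
    refine integrableOn_of_le_sech (hcp.mul (continuous_sech.mul g.continuous)) (K := K * ‖g‖)
      fun x hx => ?_
    rw [abs_mul, abs_mul, abs_of_pos (sech_pos x), mul_assoc, mul_comm ‖g‖]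
    have h1 := hpK x hx
    have h2 := g.norm_coe_le_norm x
    have h3 := (sech_pos x).le
    rw [Real.norm_eq_abs] at h2
    gcongr
  have hd : ∀ x, (0 : ℝ) ≤ x → HasDerivAt (fun x => p' x * P.sol g x - p x * P.sol' g x)
      (p x * (sech x * g x) - (-p'' x + P.V x * p x) * P.sol g x) x := fun x _ => by
    convert! ((hp' x).mul (P.hasDerivAt_sol g x)).sub ((hp x).mul (P.hasDerivAt_sol' g x)) using 1
    ring
  have hlim : Tendsto (fun x => p' x * P.sol g x - p x * P.sol' g x) atTop (𝓝 0) := by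
    refine tendsto_zero_of_le_sech (K := K * (P.bound * ‖g‖) + K * (P.bound * ‖g‖)) fun x hx => ?_
    rw [add_mul]
    refine (abs_sub _ _).trans (add_le_add ?_ ?_) <;> rw [abs_mul, mul_assoc]
    · exact mul_le_mul (hpK' x hx) (P.abs_sol_le g hx) (abs_nonneg _) hKn
    · exact mul_le_mul (hpK x hx) (P.abs_sol'_le g hx) (abs_nonneg _) hKn
  have := integral_Ioi_eq_neg hd (hi2.sub hi1) hlim
  rw [integral_sub hi2 hi1, h0, h, zero_mul, mul_zero, sub_zero, neg_zero] at this
  exact (sub_eq_zero.1 this).symm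

end GreenPair

/-! ### The Green operators of the transverse modes -/

theorem sech_pow_le_exp {n : ℕ} (x : ℝ) : sech x ^ n ≤ 2 ^ n * Real.exp (-(n : ℝ) * x) := by
  calc sech x ^ n ≤ (2 * Real.exp (-x)) ^ n :=
        pow_le_pow_left₀ (sech_pos x).le (sech_le_two_mul_exp x) n
    _ = _ := by rw [mul_pow, ← Real.exp_nat_mul]; ring_nf

theorem one_le_exp_mul {k x : ℝ} (hk : 0 ≤ k) (hx : 0 ≤ x) : 1 ≤ Real.exp (k * x) :=
  Real.one_le_exp (mul_nonneg hk hx)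

theorem sech_pow_le_one (n : ℕ) (x : ℝ) : sech x ^ n ≤ 1 :=
  pow_le_one₀ (sech_pos x).le (sech_le_one x)

theorem abs_sech_pow_mul_tanh_le (n : ℕ) (x : ℝ) : |sech x ^ n * Real.tanh x| ≤ 1 := by
  rw [abs_mul, abs_of_pos (pow_pos (sech_pos x) n)]
  exact mul_le_one₀ (sech_pow_le_one n x) (abs_nonneg _) (abs_tanh_le_one x)

theorem mul_sech_pow_le_one {n : ℕ} (hn : 1 ≤ n) {x : ℝ} (hx : 0 ≤ x) : x * sech x ^ n ≤ 1 :=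
  (mul_le_mul_of_nonneg_left (sech_pow_le_sech hn x) hx).trans (mul_sech_le_one hx)

/-- The Green pair of `-∂² + κ²`. -/
noncomputable def greenFree (κ : ℝ) (hκ : 2 ≤ κ) : GreenPair where
  d x := Real.exp (-κ * x)
  d' x := -κ * Real.exp (-κ * x)
  -- The even growing solution: e'(0) = 0 makes the Neumann condition at 0 automatic.
  e x := Real.cosh (κ * x)
  e' x := κ * Real.sinh (κ * x)
  V _ := κ ^ 2
  W := κ
  κ := κ
  A := κ
  B := κ
  hd x := by
    convert! ((hasDerivAt_id x).const_mul (-κ)).exp using 1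
    simp only [id]; ring
  hd' x := by
    convert! (((hasDerivAt_id x).const_mul (-κ)).exp).const_mul (-κ) using 1
    simp only [id]; ring
  he x := by
    convert! ((hasDerivAt_id x).const_mul κ).cosh using 1
    simp only [id]; ring
  he' x := by
    convert! (((hasDerivAt_id x).const_mul κ).sinh).const_mul κ using 1
    simp only [id]; ring
  wronskian x := by
    have h1 : Real.exp (-κ * x) * Real.exp (κ * x) = 1 := by
      rw [← Real.exp_add, neg_mul, neg_add_cancel, Real.exp_zero]
    have h2 := Real.cosh_add_sinh (κ * x)
    linear_combination κ * Real.exp (-κ * x) * h2 + κ * h1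
  W_pos := by linarith
  one_lt := by linarith
  d_le x _ := by
    rw [abs_of_pos (Real.exp_pos _)]
    nlinarith [Real.exp_pos (-κ * x)]
  d'_le x _ := by
    rw [abs_mul, abs_of_pos (Real.exp_pos _), abs_neg, abs_of_nonneg (by linarith)]
  e_le x hx := by
    have h1 := cosh_le_exp (z := κ * x) (by positivity)
    rw [abs_of_pos (Real.cosh_pos _)]
    nlinarith [Real.exp_pos (κ * x)]
  e'_le x hx := by
    have h0 : 0 ≤ κ * x := by positivity
    have h1 := cosh_le_exp h0
    have h2 := sinh_le_cosh (κ * x)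
    rw [abs_mul, abs_of_nonneg (Real.sinh_nonneg_iff.2 h0), abs_of_nonneg (by linarith)]
    nlinarith

/-- The Green pair of `-∂² + 4 - 12 sech²` for even functions. -/
noncomputable def greenEven : GreenPair where
  d x := sech x ^ 2 * Real.tanh x
  d' x := 3 * sech x ^ 4 - 2 * sech x ^ 2
  -- The even solution, so again e'(0) = 0. The decaying solution `d` is the translation mode, a
  -- multiple of the derivative of sech²; it is odd and hence no obstruction among even functions.
  e x := 15 * (x * (sech x ^ 2 * Real.tanh x)) - 15 * sech x ^ 2 + 5 + 2 * Real.cosh x ^ 2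
  e' x := 45 * (sech x ^ 2 * Real.tanh x) + 15 * (x * (3 * sech x ^ 4 - 2 * sech x ^ 2))
    + 4 * (Real.cosh x * Real.sinh x)
  V x := 4 - 12 * sech x ^ 2
  W := 8
  κ := 2
  -- |3 sech⁴ - 2 sech²| ≤ 3 sech² and sech² ≤ 4e^{-2x} give 12. The three terms of `e'` are bounded
  -- by 45, 45 and 4 times e^{2x}, which gives 94.
  A := 12
  B := 94
  hd x := by
    convert! (hasDerivAt_sech_pow 2 x).mul (hasDerivAt_tanh x) using 1
    have := tanh_sq x
    push_cast
    linear_combination 2 * sech x ^ 2 * this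
  hd' x := by
    convert! ((hasDerivAt_sech_pow 4 x).const_mul 3).sub
      ((hasDerivAt_sech_pow 2 x).const_mul 2) using 1
    push_cast
    ring
  he x := by
    have h1 := (hasDerivAt_sech_pow 2 x).mul (hasDerivAt_tanh x)
    have h2 := (((hasDerivAt_id x).mul h1).const_mul 15).sub
      ((hasDerivAt_sech_pow 2 x).const_mul 15)
    convert! (h2.add_const 5).add (((Real.hasDerivAt_cosh x).pow 2).const_mul 2) using 1
    have := tanh_sq x
    push_cast
    simp only [id, Pi.mul_apply]
    linear_combination 30 * x * sech x ^ 2 * this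
  he' x := by
    have h1 := (hasDerivAt_sech_pow 2 x).mul (hasDerivAt_tanh x)
    have h2 := ((hasDerivAt_sech_pow 4 x).const_mul 3).sub
      ((hasDerivAt_sech_pow 2 x).const_mul 2)
    convert! ((h1.const_mul 45).add (((hasDerivAt_id x).mul h2).const_mul 15)).add
      (((Real.hasDerivAt_cosh x).mul (Real.hasDerivAt_sinh x)).const_mul 4) using 1
    have h3 := tanh_sq x
    have h4 := cosh_mul_sech x
    have h5 := Real.cosh_sq x
    push_cast
    simp only [id, Pi.sub_apply]
    linear_combination 90 * sech x ^ 2 * h3 - 24 * (Real.cosh x * sech x + 1) * h4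
      + 4 * h5
  wronskian x := by
    have h3 := tanh_sq x
    have h4 := cosh_mul_sech x
    rw [tanh_eq_sinh_mul_sech] at *
    have h5 := Real.cosh_sq x
    grind
  W_pos := by norm_num
  one_lt := by norm_num
  d_le x hx := by
    have h := sech_pow_le_exp (n := 2) x
    rw [abs_mul, abs_of_pos (pow_pos (sech_pos x) 2)]
    have h1 := mul_le_of_le_one_right (pow_pos (sech_pos x) 2).le (abs_tanh_le_one x)
    push_cast at h
    nlinarith [Real.exp_pos (-2 * x)]
  d'_le x hx := by
    have h := sech_pow_le_exp (n := 2) x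
    have h1 := sech_pow_le (show 2 ≤ 4 by norm_num) x
    have h2 := pow_pos (sech_pos x) 2
    have h3 := pow_pos (sech_pos x) 4
    push_cast at h
    have := Real.exp_pos (-2 * x)
    rw [abs_le]
    constructor <;> linarith
  e_le x hx := by
    have h1 := abs_le.1 (abs_mul_sech_pow_mul_tanh_le le_rfl hx)
    have h2 := sech_pow_le_one 2 x
    have h3 := pow_pos (sech_pos x) 2
    have h4 := one_le_exp_mul zero_le_two hx
    have h5 : Real.cosh x ^ 2 ≤ Real.exp (2 * x) :=
      (pow_le_pow_left₀ (Real.cosh_pos x).le (cosh_le_exp hx) 2).trans_eq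
        (by rw [← Real.exp_nat_mul]; norm_num)
    have h6 := sech_le_one x
    have h7 := pow_pos (Real.cosh_pos x) 2
    rw [mul_assoc] at h1
    rw [abs_le]
    constructor <;> linarith
  e'_le x hx := by
    have h1 := abs_le.1 (abs_sech_pow_mul_tanh_le 2 x)
    have h2 := mul_sech_pow_le_one (n := 2) (by norm_num) hx
    have h3 := mul_sech_pow_le_one (n := 4) (by norm_num) hx
    have h2' := mul_nonneg hx (pow_pos (sech_pos x) 2).le
    have h3' := mul_nonneg hx (pow_pos (sech_pos x) 4).le
    have h4 := one_le_exp_mul zero_le_two hx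
    have h5 : Real.cosh x ^ 2 ≤ Real.exp (2 * x) :=
      (pow_le_pow_left₀ (Real.cosh_pos x).le (cosh_le_exp hx) 2).trans_eq
        (by rw [← Real.exp_nat_mul]; norm_num)
    have h6 : Real.cosh x * Real.sinh x ≤ Real.cosh x ^ 2 := by
      rw [sq]; exact mul_le_mul_of_nonneg_left (sinh_le_cosh x) (Real.cosh_pos x).le
    have h7 := mul_nonneg (Real.cosh_pos x).le (Real.sinh_nonneg_iff.2 hx)
    rw [abs_le]
    constructor <;> nlinarith

/-- `∫_0^x cosh^6`. -/
noncomputable def coshInt (x : ℝ) : ℝ := ∫ t in (0 : ℝ)..x, Real.cosh t ^ 6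

theorem hasDerivAt_coshInt (x : ℝ) : HasDerivAt coshInt (Real.cosh x ^ 6) x :=
  ((Real.continuous_cosh.pow 6).integral_hasStrictDerivAt 0 x).hasDerivAt

theorem coshInt_nonneg {x : ℝ} (hx : 0 ≤ x) : 0 ≤ coshInt x :=
  intervalIntegral.integral_nonneg hx fun t _ => pow_nonneg (Real.cosh_pos t).le 6

theorem coshInt_le {x : ℝ} (hx : 0 ≤ x) : coshInt x ≤ Real.exp (6 * x) / 6 := by
  have hd : ∀ t ∈ Set.uIcc 0 x, HasDerivAt (fun t => Real.exp (6 * t) / 6) (Real.exp (6 * t)) t :=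
    fun t _ => by
      convert! (((hasDerivAt_id t).const_mul 6).exp).div_const 6 using 1
      simp only [id]; ring
  have h1 := intervalIntegral.integral_eq_sub_of_hasDerivAt hd
    (Continuous.intervalIntegrable (by fun_prop) _ _)
  have h2 : coshInt x ≤ ∫ t in (0 : ℝ)..x, Real.exp (6 * t) := by
    refine intervalIntegral.integral_mono_on hx
      ((Real.continuous_cosh.pow 6).intervalIntegrable _ _)
      (Continuous.intervalIntegrable (by fun_prop) _ _) fun t ht => ?_
    refine (pow_le_pow_left₀ (Real.cosh_pos t).le (cosh_le_exp ht.1) 6).trans_eq ?_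
    rw [← Real.exp_nat_mul]
    norm_num
  rw [h1] at h2
  exact h2.trans (sub_le_self _ (by positivity))

/-- The Green pair of `-∂² + 9 - 12 sech²`, whose decaying solution is the ground state. -/
noncomputable def greenGround : GreenPair where
  d x := sech x ^ 3
  d' x := -(3 * (sech x ^ 3 * Real.tanh x))
  -- Reduction of order, e = d ∫ d⁻². Here e is odd with e'(0) = 1, so the Neumann condition is not
  -- automatic: an even solution requires a condition on the source.
  e x := sech x ^ 3 * coshInt x
  e' x := -(3 * (sech x ^ 3 * Real.tanh x)) * coshInt x + Real.cosh x ^ 3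
  V x := 9 - 12 * sech x ^ 2
  W := 1
  κ := 3
  -- |d'| ≤ 3 sech³ ≤ 3 · 8 e^{-3x}. In `e'` the first term is at most 3 · 8 e^{-3x} · e^{6x}/6 =
  -- 4e^{3x} and the second at most e^{3x}, whence 5.
  A := 24
  B := 5
  hd x := by
    convert! hasDerivAt_sech_pow 3 x using 1
    push_cast; ring
  hd' x := by
    convert! (((hasDerivAt_sech_pow 3 x).mul (hasDerivAt_tanh x)).const_mul 3).neg using 1
    have := tanh_sq x
    push_cast
    linear_combination (-9) * sech x ^ 3 * this
  he x := by
    convert! (hasDerivAt_sech_pow 3 x).mul (hasDerivAt_coshInt x) using 1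
    have h4 : Real.cosh x ^ 3 * sech x ^ 3 = 1 := by rw [← mul_pow, cosh_mul_sech, one_pow]
    push_cast
    linear_combination (-Real.cosh x ^ 3) * h4
  he' x := by
    have h1 := (((hasDerivAt_sech_pow 3 x).mul (hasDerivAt_tanh x)).const_mul 3).neg
    convert! (h1.mul (hasDerivAt_coshInt x)).add ((Real.hasDerivAt_cosh x).pow 3) using 1
    have h3 := tanh_sq x
    have h4 : Real.cosh x ^ 3 * sech x ^ 3 = 1 := by rw [← mul_pow, cosh_mul_sech, one_pow]
    have h5 : Real.cosh x * Real.tanh x = Real.sinh x := by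
      rw [tanh_eq_sinh_mul_sech]; linear_combination Real.sinh x * cosh_mul_sech x
    push_cast
    simp only [Pi.mul_apply, Pi.neg_apply]
    linear_combination (-9) * sech x ^ 3 * coshInt x * h3 + 3 * Real.cosh x ^ 3 * Real.tanh x * h4
      + 3 * Real.cosh x ^ 2 * h5
  wronskian x := by
    have h4 : Real.cosh x ^ 3 * sech x ^ 3 = 1 := by rw [← mul_pow, cosh_mul_sech, one_pow]
    linear_combination h4
  W_pos := one_pos
  one_lt := by norm_num
  d_le x hx := by
    have h := sech_pow_le_exp (n := 3) x
    rw [abs_of_pos (pow_pos (sech_pos x) 3)]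
    push_cast at h
    linarith [Real.exp_pos (-3 * x)]
  d'_le x hx := by
    have h := sech_pow_le_exp (n := 3) x
    have h1 := mul_le_of_le_one_right (pow_pos (sech_pos x) 3).le (abs_tanh_le_one x)
    rw [abs_neg, abs_mul, abs_mul, abs_of_pos (pow_pos (sech_pos x) 3), abs_of_pos (three_pos)]
    push_cast at h
    linarith [Real.exp_pos (-3 * x)]
  e_le x hx := by
    have h := sech_pow_le_exp (n := 3) x
    push_cast at h
    have h1 := coshInt_le hx
    have h2 := coshInt_nonneg hx
    rw [abs_mul, abs_of_pos (pow_pos (sech_pos x) 3), abs_of_nonneg h2]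
    calc sech x ^ 3 * coshInt x ≤ (2 ^ 3 * Real.exp (-3 * x)) * (Real.exp (6 * x) / 6) := by gcongr
      _ = 4 / 3 * Real.exp (3 * x) := by
        rw [show (3 : ℝ) * x = -3 * x + 6 * x by ring, Real.exp_add]; ring
      _ ≤ _ := by linarith [Real.exp_pos (3 * x)]
  e'_le x hx := by
    have h := sech_pow_le_exp (n := 3) x
    push_cast at h
    have h1 := coshInt_le hx
    have h2 := coshInt_nonneg hx
    have h3 := mul_le_of_le_one_right (pow_pos (sech_pos x) 3).le (abs_tanh_le_one x)
    have h5 : Real.cosh x ^ 3 ≤ Real.exp (3 * x) :=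
      (pow_le_pow_left₀ (Real.cosh_pos x).le (cosh_le_exp hx) 3).trans_eq
        (by rw [← Real.exp_nat_mul]; norm_num)
    refine (abs_add_le _ _).trans ?_
    rw [abs_mul, abs_neg, abs_mul, abs_mul, abs_of_pos (pow_pos (sech_pos x) 3),
      abs_of_pos (three_pos), abs_of_nonneg h2, abs_of_pos (pow_pos (Real.cosh_pos x) 3)]
    have h6 : 3 * (sech x ^ 3 * |Real.tanh x|) * coshInt x
        ≤ 3 * (2 ^ 3 * Real.exp (-3 * x)) * (Real.exp (6 * x) / 6) :=
      mul_le_mul (mul_le_mul_of_nonneg_left (h3.trans h) zero_le_three) h1 h2 (by positivity)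
    have h7 : 3 * (2 ^ 3 * Real.exp (-3 * x)) * (Real.exp (6 * x) / 6) = 4 * Real.exp (3 * x) := by
      rw [show (3 : ℝ) * x = -3 * x + 6 * x by ring, Real.exp_add]; ring
    linarith

/-- The profile function `sech ^ n` as a bounded continuous function. -/
noncomputable def sechPow (n : ℕ) : Profile :=
  BddFun.ofBound (fun z => sech z ^ n) (continuous_sech.pow n) 1
    fun z => by
      rw [abs_of_pos (pow_pos (sech_pos z) n)]
      exact sech_pow_le_one n z

theorem sechPow_apply (n : ℕ) (z : ℝ) : sechPow n z = sech z ^ n := rfl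

theorem norm_sechPow_le (n : ℕ) : ‖sechPow n‖ ≤ 1 :=
  BddFun.norm_ofBound_le _ _ zero_le_one _

/-- The pairing `∫₀^∞ sech³ · (sech g)` with the ground state. -/
noncomputable def groundPairing : Profile →L[ℝ] ℝ :=
  LinearMap.mkContinuous
    { toFun := fun g => greenGround.tail g 0
      map_add' := fun g h => greenGround.tail_add g h 0
      map_smul' := fun c g => greenGround.tail_smul c g 0 }
    (2 * greenGround.A / (greenGround.κ + 1)) fun g => by
      have := greenGround.abs_tail_le g le_rfl
      rw [mul_zero, Real.exp_zero, mul_one] at this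
      refine this.trans_eq ?_
      ring

theorem groundPairing_eq_tail (g : Profile) : groundPairing g = greenGround.tail g 0 := rfl

theorem groundPairing_apply (g : Profile) :
    groundPairing g = ∫ x in Set.Ioi 0, sech x ^ 3 * (sech x * g x) := by
  rw [groundPairing_eq_tail, greenGround.tail_eq g le_rfl]
  rfl

theorem groundPairing_sechPow (n : ℕ) : groundPairing (sechPow n) = sechMoment (n + 4) := by
  rw [groundPairing_apply, sechMoment]
  congr 1
  ext x
  rw [sechPow_apply]
  ring

/-- The projection onto the profiles orthogonal to the ground state. -/
noncomputable def groundProj : Profile →L[ℝ] Profile :=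
  -- 15/8 is the reciprocal of `groundPairing (sechPow 2)`, that is of `sechMoment 6`.
  ContinuousLinearMap.id ℝ Profile - (15 / 8 : ℝ) • groundPairing.smulRight (sechPow 2)

theorem groundProj_of_eq_zero {g : Profile} (h : groundPairing g = 0) : groundProj g = g := by
  simp [groundProj, h]

/-- The decay rate `√(4 + 5m²)` of the mode `m`. -/
noncomputable def modeRate (m : ℕ) : ℝ := Real.sqrt (4 + 5 * m ^ 2)

theorem modeRate_sq (m : ℕ) : modeRate m ^ 2 = 4 + 5 * m ^ 2 := Real.sq_sqrt (by positivity)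

theorem two_le_modeRate (m : ℕ) : 2 ≤ modeRate m := by
  refine Real.le_sqrt_of_sq_le ?_
  have : (0 : ℝ) ≤ m ^ 2 := by positivity
  linarith

/-- The Green pair of the mode `m ≥ 2`, of the free operator `-∂² + 4 + 5m²`. -/
noncomputable def modeGreen (m : ℕ) : GreenPair := greenFree (modeRate m) (two_le_modeRate m)

/-- The solution operators of the modes: `-∂² + 4 - 12 sech²` for `m = 0`,
`-∂² + 9 - 12 sech²` for `m = 1`, and `-∂² + 4 + 5m²` for `m ≥ 2`. -/
noncomputable def modeOp : ℕ → Profile →L[ℝ] Profile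
  | 0 => greenEven.op
  | 1 => greenGround.op.comp groundProj
  | m + 2 => (modeGreen (m + 2)).op

/-- The derivatives of the solutions given by `modeOp`. -/
noncomputable def modeOp' : ℕ → Profile →L[ℝ] Profile
  | 0 => greenEven.op'
  | 1 => greenGround.op'.comp groundProj
  | m + 2 => (modeGreen (m + 2)).op'

/-- A common norm bound of the operators `modeOp m` and `modeOp' m`. -/
noncomputable def modeBound : ℝ :=
  2 * greenEven.bound + 2 * greenGround.bound * ‖groundProj‖ + 16

theorem bound_greenFree_le (κ : ℝ) (hκ : 2 ≤ κ) : (greenFree κ hκ).bound ≤ 8 := by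
  change 4 * κ * κ * κ / ((κ ^ 2 - 1) * κ) ≤ 8
  have h1 : 0 < κ ^ 2 - 1 := by nlinarith
  rw [div_le_iff₀ (by positivity)]
  nlinarith [mul_pos h1 (show 0 < κ by linarith)]

theorem norm_modeOp_le (m : ℕ) : ‖modeOp m‖ ≤ modeBound := by
  have h0 := greenEven.bound_nonneg
  have h1 := mul_nonneg greenGround.bound_nonneg (norm_nonneg groundProj)
  unfold modeBound
  match m with
  | 0 => exact (greenEven.norm_op_le).trans (by linarith)
  | 1 =>
    refine (ContinuousLinearMap.opNorm_comp_le _ _).trans ?_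
    have := mul_le_mul_of_nonneg_right greenGround.norm_op_le (norm_nonneg groundProj)
    linarith
  | m + 2 =>
    exact ((modeGreen (m + 2)).norm_op_le).trans (by
      have : (modeGreen (m + 2)).bound ≤ 8 := bound_greenFree_le _ _
      linarith)

theorem norm_modeOp'_le (m : ℕ) : ‖modeOp' m‖ ≤ modeBound := by
  have h0 := greenEven.bound_nonneg
  have h1 := mul_nonneg greenGround.bound_nonneg (norm_nonneg groundProj)
  unfold modeBound
  match m with
  | 0 => exact (greenEven.norm_op'_le).trans (by linarith)
  | 1 =>
    refine (ContinuousLinearMap.opNorm_comp_le _ _).trans ?_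
    have := mul_le_mul_of_nonneg_right greenGround.norm_op'_le (norm_nonneg groundProj)
    linarith
  | m + 2 =>
    exact ((modeGreen (m + 2)).norm_op'_le).trans (by
      have : (modeGreen (m + 2)).bound ≤ 8 := bound_greenFree_le _ _
      linarith)

theorem modeOp_neg (m : ℕ) (g : Profile) (z : ℝ) : modeOp m g (-z) = modeOp m g z := by
  match m with
  | 0 => exact greenEven.op_neg g z
  | 1 => exact greenGround.op_neg _ z
  | m + 2 => exact (modeGreen (m + 2)).op_neg g z

theorem greenEven_sol'_zero (g : Profile) : greenEven.sol' g 0 = 0 := by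
  simp [GreenPair.sol', greenEven, GreenPair.head]

theorem modeGreen_sol'_zero (m : ℕ) (g : Profile) : (modeGreen m).sol' g 0 = 0 := by
  simp [GreenPair.sol', modeGreen, greenFree, GreenPair.head]

/-- At r = 0 the head vanishes and e'(0) = W = 1, so the slope of the solution equals its tail at 0,
which is the pairing with sech³. The Fredholm condition and the Neumann condition coincide. -/
theorem greenGround_sol'_zero {g : Profile} (h : groundPairing g = 0) :
    greenGround.sol' g 0 = 0 := by
  rw [GreenPair.sol', ← groundPairing_eq_tail, h]
  simp [GreenPair.head]

theorem hasDerivAt_modeOp (m : ℕ) {g : Profile} (h : m = 1 → groundPairing g = 0) (z : ℝ) :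
    HasDerivAt (fun z => sech z * modeOp m g z) (sech z * modeOp' m g z) z := by
  match m, h with
  | 0, _ => exact greenEven.hasDerivAt_op (greenEven_sol'_zero g) z
  | 1, h =>
    simp only [modeOp, modeOp', ContinuousLinearMap.comp_apply, groundProj_of_eq_zero (h rfl)]
    exact greenGround.hasDerivAt_op (greenGround_sol'_zero (h rfl)) z
  | m + 2, _ => exact (modeGreen (m + 2)).hasDerivAt_op (modeGreen_sol'_zero _ g) z

/-- The part of the potential that `modeOp` inverts. -/
noncomputable def modePotential (m : ℕ) (z : ℝ) : ℝ := if m < 2 then 12 * sech z ^ 2 else 0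

theorem hasDerivAt_modeOp' (m : ℕ) {g : Profile} (h : m = 1 → groundPairing g = 0) (z : ℝ) :
    HasDerivAt (fun z => sech z * modeOp' m g z)
      ((4 + 5 * m ^ 2 - modePotential m z) * (sech z * modeOp m g z) - sech z * g |z|) z := by
  match m, h with
  | 0, _ =>
    convert! greenEven.hasDerivAt_op' (greenEven_sol'_zero g) z using 1
    simp [modePotential, greenEven, modeOp, sech_abs]
  | 1, h =>
    simp only [modeOp, modeOp', ContinuousLinearMap.comp_apply, groundProj_of_eq_zero (h rfl)]
    convert! greenGround.hasDerivAt_op' (greenGround_sol'_zero (h rfl)) z using 1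
    simp [modePotential, greenGround, sech_abs]
    norm_num
  | m + 2, _ =>
    convert! (modeGreen (m + 2)).hasDerivAt_op' (modeGreen_sol'_zero _ g) z using 1
    have : (modeGreen (m + 2)).V |z| = 4 + 5 * ((m + 2 : ℕ) : ℝ) ^ 2 := modeRate_sq (m + 2)
    rw [this]
    simp [modePotential, modeOp]

/-- A comparison argument. The Green kernel is positive, and sech itself solves -q'' + κ²q = sech ·
G with G = κ² - 1 + 2 sech² ≥ κ² - 1. A source bounded by ‖g‖ is dominated by ‖g‖/(κ² - 1) times G,
so its solution is dominated by the same multiple of sech. `GreenPair.bound` does not decay in κ and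
would not suffice for the Neumann series. -/
theorem norm_op_greenFree_le (κ : ℝ) (hκ : 2 ≤ κ) : ‖(greenFree κ hκ).op‖ ≤ 1 / (κ ^ 2 - 1) := by
  set P := greenFree κ hκ with hP
  have hk : 0 < κ ^ 2 - 1 := by nlinarith
  have hκ0 : 0 < κ := by linarith
  let G : Profile := (κ ^ 2 - 1) • sechPow 0 + (2 : ℝ) • sechPow 2
  have hG : ∀ x, G x = (κ ^ 2 - 1) + 2 * sech x ^ 2 := fun x => by
    simp [G, BddFun.add_apply, BddFun.smul_apply, sechPow_apply]
  have hs' : ∀ x, HasDerivAt (fun x => -(sech x * Real.tanh x)) (sech x - 2 * sech x ^ 3) x :=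
    fun x => by
      convert! ((hasDerivAt_sech x).mul (hasDerivAt_tanh x)).neg using 1
      have := tanh_sq x
      linear_combination (-sech x) * this
  -- The tail and the head of the comparison source are explicit because d · sech · G and e · sech ·
  -- G are, up to sign, derivatives of the Wronskian of `d` or `e` with sech.
  have ht : ∀ r, 0 ≤ r → P.tail G r = P.d r * (sech r * (κ - Real.tanh r)) := fun r hr => by
    have hd : ∀ x, r ≤ x → HasDerivAt (fun x => -(P.d x * (sech x * (κ - Real.tanh x))))
        (P.d x * (sech x * G x)) x := fun x _ => by
      convert! ((P.hd x).mul (((hasDerivAt_sech x).const_mul κ).add (hs' x))).neg using 1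
      · funext y
        simp only [Pi.neg_apply, Pi.mul_apply, Pi.add_apply]
        ring
      · simp only [hG, Pi.add_apply]
        change _ = -((-κ * P.d x) * _ + _)
        ring
    have hlim : Tendsto (fun x => -(P.d x * (sech x * (κ - Real.tanh x)))) atTop (𝓝 0) := by
      refine tendsto_zero_of_le_sech (K := κ + 1) fun x hx => ?_
      have h1 : |P.d x| ≤ 1 := by
        change |Real.exp (-κ * x)| ≤ 1
        rw [abs_of_pos (Real.exp_pos _), Real.exp_le_one_iff]
        nlinarith
      have h2 : |κ - Real.tanh x| ≤ κ + 1 := by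
        refine (abs_sub _ _).trans ?_
        rw [abs_of_pos hκ0]
        linarith [abs_tanh_le_one x]
      rw [abs_neg, abs_mul, abs_mul, abs_of_pos (sech_pos x)]
      calc |P.d x| * (sech x * |κ - Real.tanh x|) ≤ 1 * (sech x * (κ + 1)) := by
            have := (sech_pos x).le
            gcongr
        _ = _ := by ring
    rw [P.tail_eq G hr, integral_Ioi_eq_neg hd (P.integrableOn_tail G hr) hlim, neg_neg]
  have hh : ∀ r, P.head G r = sech r * (κ * Real.sinh (κ * r) + P.e r * Real.tanh r) := fun r => by
    have hd : ∀ x ∈ Set.uIcc 0 r, HasDerivAt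
        (fun x => sech x * (P.e' x + P.e x * Real.tanh x))
        (P.e x * (sech x * G x)) x := fun x _ => by
      convert! ((hasDerivAt_sech x).mul (P.he' x)).sub ((P.he x).mul (hs' x)) using 1
      · funext y
        simp only [Pi.sub_apply, Pi.mul_apply]
        ring
      · rw [hG]
        change _ = _ + sech x * (κ ^ 2 * P.e x) - _
        ring
    rw [GreenPair.head, intervalIntegral.integral_eq_sub_of_hasDerivAt hd
      ((P.continuous_head_integrand G).intervalIntegrable _ _)]
    have h0 : P.e' 0 = 0 := by simp [hP, greenFree]
    simp only [h0, Real.tanh_zero, mul_zero, add_zero, sub_zero]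
    rfl
  have hd0 : ∀ x, 0 ≤ P.d x := fun x => (Real.exp_pos _).le
  have he0 : ∀ x, 0 ≤ P.e x := fun x => (Real.cosh_pos _).le
  have hpt : ∀ (g : Profile) x, ‖sech x * g x‖ ≤ ‖g‖ / (κ ^ 2 - 1) * (sech x * G x) := fun g x => by
    rw [norm_mul, Real.norm_eq_abs, abs_of_pos (sech_pos x), hG]
    have h1 := g.norm_coe_le_norm x
    have h2 := sech_pos x
    calc sech x * ‖g x‖ ≤ sech x * (‖g‖ / (κ ^ 2 - 1) * (κ ^ 2 - 1)) := by
          rw [div_mul_cancel₀ _ hk.ne']; gcongr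
      _ ≤ sech x * (‖g‖ / (κ ^ 2 - 1) * (κ ^ 2 - 1 + 2 * sech x ^ 2)) := by
          gcongr
          linarith [pow_pos h2 2]
      _ = _ := by ring
  have htail : ∀ (g : Profile) r, 0 ≤ r → |P.tail g r| ≤ ‖g‖ / (κ ^ 2 - 1) * P.tail G r :=
    fun g r hr => by
      rw [P.tail_eq g hr, P.tail_eq G hr, ← integral_const_mul, ← Real.norm_eq_abs]
      refine norm_integral_le_of_norm_le ((P.integrableOn_tail G hr).const_mul _)
        (ae_of_all _ fun x => ?_)
      rw [norm_mul, Real.norm_eq_abs, abs_of_nonneg (hd0 x)]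
      exact (mul_le_mul_of_nonneg_left (hpt g x) (hd0 x)).trans_eq (by ring)
  have hhead : ∀ (g : Profile) r, 0 ≤ r → |P.head g r| ≤ ‖g‖ / (κ ^ 2 - 1) * P.head G r :=
    fun g r hr => by
      rw [GreenPair.head, GreenPair.head, ← intervalIntegral.integral_const_mul, ← Real.norm_eq_abs]
      refine intervalIntegral.norm_integral_le_of_norm_le hr (ae_of_all _ fun x _ => ?_)
        ((continuous_const.mul (P.continuous_head_integrand G)).intervalIntegrable _ _)
      rw [norm_mul, Real.norm_eq_abs, abs_of_nonneg (he0 x)]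
      exact (mul_le_mul_of_nonneg_left (hpt g x) (he0 x)).trans_eq (by ring)
  have hsol : ∀ (g : Profile) r, 0 ≤ r → |P.sol g r| ≤ ‖g‖ / (κ ^ 2 - 1) * sech r :=
    fun g r hr => by
      have h1 : Real.exp (-κ * r) * Real.exp (κ * r) = 1 := by
        rw [← Real.exp_add, neg_mul, neg_add_cancel, Real.exp_zero]
      have h2 := Real.cosh_add_sinh (κ * r)
      have h3 : P.e r * P.tail G r + P.d r * P.head G r = κ * sech r := by
        rw [ht r hr, hh r]
        change Real.cosh (κ * r) * (Real.exp (-κ * r) * _) +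
          Real.exp (-κ * r) * (_ * (_ + Real.cosh (κ * r) * _)) = _
        linear_combination Real.exp (-κ * r) * sech r * κ * h2 + κ * sech r * h1
      have hW : P.W = κ := rfl
      rw [GreenPair.sol, abs_div, hW, abs_of_pos hκ0, div_le_iff₀ hκ0]
      calc |P.e r * P.tail g r + P.d r * P.head g r|
          ≤ P.e r * |P.tail g r| + P.d r * |P.head g r| := by
            refine (abs_add_le _ _).trans_eq ?_
            rw [abs_mul, abs_mul, abs_of_nonneg (he0 r), abs_of_nonneg (hd0 r)]
        _ ≤ P.e r * (‖g‖ / (κ ^ 2 - 1) * P.tail G r) + P.d r * (‖g‖ / (κ ^ 2 - 1) * P.head G r) :=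
            add_le_add (mul_le_mul_of_nonneg_left (htail g r hr) (he0 r))
              (mul_le_mul_of_nonneg_left (hhead g r hr) (hd0 r))
        _ = ‖g‖ / (κ ^ 2 - 1) * (P.e r * P.tail G r + P.d r * P.head G r) := by ring
        _ = _ := by rw [h3]; ring
  refine ContinuousLinearMap.opNorm_le_bound _ (by positivity) fun g => ?_
  refine (BddFun.norm_le (by positivity)).2 fun z => ?_
  rw [GreenPair.op_apply, norm_mul, Real.norm_eq_abs, abs_of_pos (Real.cosh_pos z)]
  calc Real.cosh z * ‖P.sol g |z|‖ ≤ Real.cosh z * (‖g‖ / (κ ^ 2 - 1) * sech z) := by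
        rw [← sech_abs z]
        exact mul_le_mul_of_nonneg_left (hsol g _ (abs_nonneg z)) (Real.cosh_pos z).le
    _ = 1 / (κ ^ 2 - 1) * ‖g‖ * (Real.cosh z * sech z) := by ring
    _ = _ := by rw [cosh_mul_sech, mul_one]

/-- Here κ² - 1 = 3 + 5m², which is at least 23 for m ≥ 2. -/
theorem norm_modeOp_le_of_two_le {m : ℕ} (hm : 2 ≤ m) : ‖modeOp m‖ ≤ 1 / 23 := by
  obtain ⟨k, rfl⟩ := Nat.exists_eq_add_of_le' hm
  refine (norm_op_greenFree_le (modeRate (k + 2)) (two_le_modeRate _)).trans ?_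
  rw [modeRate_sq]
  push_cast
  have : (0 : ℝ) ≤ k := by positivity
  exact one_div_le_one_div_of_le (by norm_num) (by nlinarith)

/-- The function (sech⁴ - 2 sech²)/8 is mapped to sech⁶ by -∂² + 4 - 12 sech². Since this operator
is symmetric, its inverse can be moved onto sech⁶, and pairings with `modeOp 0` become integrals of
the source against an explicit function. -/
theorem integral_sech_six_mul_modeOp (g : Profile) :
    ∫ x in Set.Ioi 0, sech x ^ 6 * (sech x * modeOp 0 g x)
      = ∫ x in Set.Ioi 0, (sech x ^ 4 - 2 * sech x ^ 2) / 8 * (sech x * g x) := by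
  have hp : ∀ x, HasDerivAt (fun x => (sech x ^ 4 - 2 * sech x ^ 2) / 8)
      ((sech x ^ 2 * Real.tanh x - sech x ^ 4 * Real.tanh x) / 2) x := fun x => by
    convert! ((hasDerivAt_sech_pow 4 x).sub
      ((hasDerivAt_sech_pow 2 x).const_mul 2)).div_const 8 using 1
    push_cast; ring
  have hp' : ∀ x, HasDerivAt (fun x => (sech x ^ 2 * Real.tanh x - sech x ^ 4 * Real.tanh x) / 2)
      ((3 * sech x ^ 4 - 2 * sech x ^ 2 - (5 * sech x ^ 6 - 4 * sech x ^ 4)) / 2) x := fun x => by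
    convert! (((hasDerivAt_sech_pow 2 x).mul (hasDerivAt_tanh x)).sub
      ((hasDerivAt_sech_pow 4 x).mul (hasDerivAt_tanh x))).div_const 2 using 1
    have := tanh_sq x
    push_cast
    linear_combination (sech x ^ 2 - 2 * sech x ^ 4) * this
  have he : ∀ x, -((3 * sech x ^ 4 - 2 * sech x ^ 2 - (5 * sech x ^ 6 - 4 * sech x ^ 4)) / 2)
      + greenEven.V x * ((sech x ^ 4 - 2 * sech x ^ 2) / 8) = sech x ^ 6 := fun x => by
    change _ + (4 - 12 * sech x ^ 2) * _ = _
    ring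
  have h6 := integral_congr_ae (ae_of_all (volume.restrict (Set.Ioi (0 : ℝ))) fun x =>
    congrArg (· * greenEven.sol g x) (he x))
  have hc : Continuous fun x => -((3 * sech x ^ 4 - 2 * sech x ^ 2
      - (5 * sech x ^ 6 - 4 * sech x ^ 4)) / 2)
      + greenEven.V x * ((sech x ^ 4 - 2 * sech x ^ 2) / 8) := by
    simp only [he]; exact continuous_sech.pow 6
  rw [← greenEven.integral_mul_eq (greenEven_sol'_zero g) hp hp' (by simp) (K := 1)
    (fun x _ => ?_) (fun x _ => ?_) hc (fun x _ => ?_), h6]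
  · refine setIntegral_congr_fun measurableSet_Ioi fun x hx => ?_
    have := greenEven.sech_mul_op g x
    rw [abs_of_pos hx] at this
    simp only [modeOp, this]
  · have h1 := sech_pow_le_one 2 x
    have h2 := sech_pow_le_one 4 x
    have h3 := pow_pos (sech_pos x) 2
    have h4 := pow_pos (sech_pos x) 4
    rw [abs_le]; constructor <;> linarith
  · have h1 := abs_le.1 (abs_sech_pow_mul_tanh_le 2 x)
    have h2 := abs_le.1 (abs_sech_pow_mul_tanh_le 4 x)
    rw [abs_le]; constructor <;> linarith
  · rw [he, abs_of_pos (pow_pos (sech_pos x) 6)]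
    exact sech_pow_le_one 6 x

/-- The same device for sech². Its preimage is a multiple of the derivative of the soliton family in
c, which comes from the scaling σ² sech²(σx). -/
theorem integral_sech_two_mul_modeOp (g : Profile) :
    ∫ x in Set.Ioi 0, sech x ^ 2 * (sech x * modeOp 0 g x)
      = ∫ x in Set.Ioi 0, (x * sech x ^ 2 * Real.tanh x - sech x ^ 2) / 4 * (sech x * g x) := by
  have hp : ∀ x, HasDerivAt (fun x => (x * sech x ^ 2 * Real.tanh x - sech x ^ 2) / 4)
      ((3 * (sech x ^ 2 * Real.tanh x) - 2 * (x * sech x ^ 2) + 3 * (x * sech x ^ 4)) / 4) x :=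
    fun x => by
      convert! ((((hasDerivAt_id x).mul (hasDerivAt_sech_pow 2 x)).mul (hasDerivAt_tanh x)).sub
        (hasDerivAt_sech_pow 2 x)).div_const 4 using 1
      have := tanh_sq x
      simp only [id, Pi.mul_apply]
      push_cast
      linear_combination (x * sech x ^ 2 / 2) * this
  have hp' : ∀ x, HasDerivAt
      (fun x => (3 * (sech x ^ 2 * Real.tanh x) - 2 * (x * sech x ^ 2) + 3 * (x * sech x ^ 4)) / 4)
      ((12 * sech x ^ 4 - 8 * sech x ^ 2 + 4 * (x * sech x ^ 2 * Real.tanh x)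
        - 12 * (x * sech x ^ 4 * Real.tanh x)) / 4) x := fun x => by
    convert! (((((hasDerivAt_sech_pow 2 x).mul (hasDerivAt_tanh x)).const_mul 3).sub
      (((hasDerivAt_id x).mul (hasDerivAt_sech_pow 2 x)).const_mul 2)).add
      (((hasDerivAt_id x).mul (hasDerivAt_sech_pow 4 x)).const_mul 3)).div_const 4 using 1
    have := tanh_sq x
    simp only [id]
    push_cast
    linear_combination (3 * sech x ^ 2 / 2) * this
  have he : ∀ x, -((12 * sech x ^ 4 - 8 * sech x ^ 2 + 4 * (x * sech x ^ 2 * Real.tanh x)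
        - 12 * (x * sech x ^ 4 * Real.tanh x)) / 4)
      + greenEven.V x * ((x * sech x ^ 2 * Real.tanh x - sech x ^ 2) / 4) = sech x ^ 2 :=
    fun x => by
      change _ + (4 - 12 * sech x ^ 2) * _ = _
      ring
  have h6 := integral_congr_ae (ae_of_all (volume.restrict (Set.Ioi (0 : ℝ))) fun x =>
    congrArg (· * greenEven.sol g x) (he x))
  have hc : Continuous fun x => -((12 * sech x ^ 4 - 8 * sech x ^ 2
        + 4 * (x * sech x ^ 2 * Real.tanh x) - 12 * (x * sech x ^ 4 * Real.tanh x)) / 4)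
      + greenEven.V x * ((x * sech x ^ 2 * Real.tanh x - sech x ^ 2) / 4) := by
    simp only [he]; exact continuous_sech.pow 2
  rw [← greenEven.integral_mul_eq (greenEven_sol'_zero g) hp hp' (by simp) (K := 3)
    (fun x hx => ?_) (fun x hx => ?_) hc (fun x _ => ?_), h6]
  · refine setIntegral_congr_fun measurableSet_Ioi fun x hx => ?_
    have := greenEven.sech_mul_op g x
    rw [abs_of_pos hx] at this
    simp only [modeOp, this]
  · have h1 := abs_le.1 (abs_mul_sech_pow_mul_tanh_le (n := 2) le_rfl hx)
    have h2 := sech_pow_le_one 2 x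
    have h3 := pow_pos (sech_pos x) 2
    have h4 := sech_le_one x
    rw [abs_le]; constructor <;> linarith
  · have h1 := abs_le.1 (abs_sech_pow_mul_tanh_le 2 x)
    have h2 := mul_sech_pow_le_one (n := 2) (by norm_num) hx
    have h3 := mul_sech_pow_le_one (n := 4) (by norm_num) hx
    have h2' := mul_nonneg hx (pow_pos (sech_pos x) 2).le
    have h3' := mul_nonneg hx (pow_pos (sech_pos x) 4).le
    rw [abs_le]; constructor <;> linarith
  · rw [he, abs_of_pos (pow_pos (sech_pos x) 2)]
    linarith [sech_pow_le_one 2 x]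

/-! ### The system of mode equations -/

/-- Summable sequences of profiles. -/
abbrev ModeSeq : Type := SeqL1 Profile

theorem abs_sech_mul_mul_le (g h : Profile) (z : ℝ) : |sech z * g z * h z| ≤ ‖g‖ * ‖h‖ := by
  rw [abs_mul, abs_mul, abs_of_pos (sech_pos z)]
  have h1 := g.norm_coe_le_norm z
  have h2 := h.norm_coe_le_norm z
  have h3 := sech_le_one z
  have h4 := (sech_pos z).le
  rw [Real.norm_eq_abs] at h1 h2
  calc sech z * |g z| * |h z| ≤ 1 * ‖g‖ * ‖h‖ := by gcongr
    _ = _ := by ring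

/-- The product of profiles: `(sech g)(sech h) = sech · (profileMul g h)`. -/
noncomputable def profileMul : Profile →L[ℝ] Profile →L[ℝ] Profile :=
  LinearMap.mkContinuous₂
    (LinearMap.mk₂ ℝ (fun g h => BddFun.ofBound (fun z => sech z * g z * h z)
        ((continuous_sech.mul g.continuous).mul h.continuous) (‖g‖ * ‖h‖) (abs_sech_mul_mul_le g h))
      (fun g g' h => by
        ext z
        simp only [BddFun.ofBound_apply, BddFun.add_apply]
        ring)
      (fun c g h => by
        ext z
        simp only [BddFun.ofBound_apply, BddFun.smul_apply, smul_eq_mul]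
        ring)
      (fun g h h' => by
        ext z
        simp only [BddFun.ofBound_apply, BddFun.add_apply]
        ring)
      (fun c g h => by
        ext z
        simp only [BddFun.ofBound_apply, BddFun.smul_apply, smul_eq_mul]
        ring))
    1 fun g h => by
      rw [one_mul]
      exact BddFun.norm_ofBound_le _ _ (by positivity) (abs_sech_mul_mul_le g h)

theorem profileMul_apply (g h : Profile) (z : ℝ) : profileMul g h z = sech z * g z * h z := rfl

theorem profileMul_comm (g h : Profile) : profileMul g h = profileMul h g := by
  ext z
  rw [profileMul_apply, profileMul_apply]
  ring

theorem norm_profileMul_apply_le (g h : Profile) : ‖profileMul g h‖ ≤ ‖g‖ * ‖h‖ :=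
  BddFun.norm_ofBound_le _ _ (by positivity) (abs_sech_mul_mul_le g h)

theorem norm_profileMul_le (g : Profile) : ‖profileMul g‖ ≤ ‖g‖ :=
  ContinuousLinearMap.opNorm_le_bound _ (norm_nonneg _) (norm_profileMul_apply_le g)

theorem profileMul_sechPow (i j : ℕ) :
    profileMul (sechPow i) (sechPow j) = sechPow (i + j + 1) := by
  ext z
  rw [profileMul_apply, sechPow_apply, sechPow_apply, sechPow_apply]
  ring

/-- The product of profiles, placed in mode `k`. -/
noncomputable def singleMul (k : ℕ) : Profile →L[ℝ] Profile →L[ℝ] ModeSeq :=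
  (ContinuousLinearMap.compL ℝ Profile Profile ModeSeq (SeqL1.single k)).comp profileMul

theorem singleMul_apply (k : ℕ) (g h : Profile) :
    singleMul k g h = SeqL1.single k (profileMul g h) := rfl

open Classical in
/-- The bilinear operator that multiplies mode `i` with mode `j` into mode `σ i j`, for the pairs
`(i, j)` in `S`. -/
noncomputable def modeConv (S : Set (ℕ × ℕ)) (σ : ℕ → ℕ → ℕ) :
    ModeSeq →L[ℝ] ModeSeq →L[ℝ] ModeSeq :=
  SeqL1.lift₂ (fun i j => if (i, j) ∈ S then singleMul (σ i j) else 0) 1 fun i j => by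
    split_ifs
    · refine ContinuousLinearMap.opNorm_le_bound₂ _ zero_le_one fun g h => ?_
      rw [singleMul_apply, SeqL1.norm_single, one_mul]
      exact norm_profileMul_apply_le g h
    · exact (norm_zero (E := Profile →L[ℝ] Profile →L[ℝ] ModeSeq)).trans_le zero_le_one

theorem modeConv_single_of_mem {S : Set (ℕ × ℕ)} {σ : ℕ → ℕ → ℕ} {i j : ℕ} (h : (i, j) ∈ S)
    (x y : Profile) : modeConv S σ (SeqL1.single i x) (SeqL1.single j y)
      = SeqL1.single (σ i j) (profileMul x y) := by
  rw [modeConv, SeqL1.lift₂_single, if_pos h, singleMul_apply]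

theorem modeConv_single_of_notMem {S : Set (ℕ × ℕ)} {σ : ℕ → ℕ → ℕ} {i j : ℕ} (h : (i, j) ∉ S)
    (x y : Profile) : modeConv S σ (SeqL1.single i x) (SeqL1.single j y) = 0 := by
  rw [modeConv, SeqL1.lift₂_single, if_neg h]
  rfl

/-- Products in which one of the modes is `0`. -/
noncomputable def convLow : ModeSeq →L[ℝ] ModeSeq →L[ℝ] ModeSeq :=
  modeConv {p | p.1 = 0 ∨ p.2 = 0} fun i j => i + j

/-- Products of positive modes into the sum of the modes. -/
noncomputable def convSum : ModeSeq →L[ℝ] ModeSeq →L[ℝ] ModeSeq :=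
  modeConv {p | 1 ≤ p.1 ∧ 1 ≤ p.2} fun i j => i + j

/-- Products of positive modes into the difference of the modes. -/
noncomputable def convDiff : ModeSeq →L[ℝ] ModeSeq →L[ℝ] ModeSeq :=
  modeConv {p | 1 ≤ p.1 ∧ p.1 < p.2} fun i j => j - i

/-- Products of equal positive modes into mode `0`. -/
noncomputable def convDiag : ModeSeq →L[ℝ] ModeSeq →L[ℝ] ModeSeq :=
  modeConv {p | 1 ≤ p.1 ∧ p.1 = p.2} fun _ _ => 0

/-- The projection onto the mode `n`. -/
noncomputable def modeProj (n : ℕ) : ModeSeq →L[ℝ] ModeSeq :=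
  (SeqL1.single n).comp (SeqL1.coord n)

theorem modeProj_apply (n : ℕ) (u : ModeSeq) : modeProj n u = SeqL1.single n (u n) := rfl

theorem modeProj_single_self (n : ℕ) (x : Profile) :
    modeProj n (SeqL1.single n x) = SeqL1.single n x := by
  rw [modeProj_apply, SeqL1.single_apply_self]

theorem modeProj_single_ne {n i : ℕ} (h : n ≠ i) (x : Profile) :
    modeProj n (SeqL1.single i x) = 0 := by
  rw [modeProj_apply, SeqL1.single_apply_ne h, map_zero]

theorem norm_modeProj_le (n : ℕ) : ‖modeProj n‖ ≤ 1 :=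
  ContinuousLinearMap.opNorm_le_bound _ zero_le_one fun u => by
    rw [modeProj_apply, SeqL1.norm_single, one_mul]
    exact SeqL1.norm_apply_le u n

/-! ### Damping in t and the fixed point form of the mode system. -/

/-- The coefficients of `t ↦ diag (t ^ n)`. -/
noncomputable def dampCoeff (n : ℕ) : ℝ →L[ℝ] ModeSeq →L[ℝ] ModeSeq :=
  (ContinuousLinearMap.id ℝ ℝ).smulRight (modeProj n)

theorem norm_dampCoeff_le (n : ℕ) : ‖dampCoeff n‖ ≤ 1 * 4 ^ n := by
  refine ContinuousLinearMap.opNorm_le_bound _ (by positivity) fun t => ?_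
  rw [dampCoeff, ContinuousLinearMap.smulRight_apply, norm_smul, mul_comm]
  have h1 := norm_modeProj_le n
  have h2 : (1 : ℝ) ≤ 4 ^ n := one_le_pow₀ (by norm_num)
  calc ‖modeProj n‖ * ‖(ContinuousLinearMap.id ℝ ℝ) t‖ ≤ (1 * 4 ^ n) * ‖t‖ := by
        rw [ContinuousLinearMap.id_apply]
        gcongr
        linarith

/-- The diagonal operator with entries `t ^ n`, for `|t| < 1/4`. -/
noncomputable def damp : ℝ → ModeSeq →L[ℝ] ModeSeq := opSum dampCoeff

theorem damp_single {t : ℝ} (ht : |t| < 1 / 4) (i : ℕ) (x : Profile) :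
    damp t (SeqL1.single i x) = t ^ i • SeqL1.single i x := by
  have h := (hasSum_opSum norm_dampCoeff_le (w := t) ht).mapL
    (ContinuousLinearMap.apply ℝ ModeSeq (SeqL1.single i x : ModeSeq))
  have e : ∀ j, ContinuousLinearMap.apply ℝ ModeSeq (SeqL1.single i x : ModeSeq) (dampCoeff j (t ^ j))
      = t ^ j • modeProj j (SeqL1.single i x) := fun j => rfl
  simp only [e] at h
  have h2 := hasSum_single (f := fun j => t ^ j • modeProj j (SeqL1.single i x)) i fun j hj => by
    simp only [modeProj_single_ne hj, smul_zero]
  simp only [modeProj_single_self] at h2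
  exact h.unique h2

theorem contDiffAt_damp {t : ℝ} (ht : |t| < 1 / 4) {n : ℕ∞ω} : ContDiffAt ℝ n damp t :=
  contDiffAt_opSum norm_dampCoeff_le ht

/-- The entry of mode 0 is 0⁰ = 1, so mode 0 survives at t = 0. This is harmless, as `convDiff` and
`convDiag` only read positive modes. -/
theorem damp_zero : damp 0 = modeProj 0 := by
  rw [damp, opSum_zero]
  simp [dampCoeff]

theorem hasDerivAt_damp_zero : HasDerivAt damp (modeProj 1) 0 := by
  have := (hasFDerivAt_opSum_zero norm_dampCoeff_le).hasDerivAt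
  have e : dampCoeff 1 1 = modeProj 1 := one_smul ℝ (modeProj 1)
  rw [e] at this
  exact this

/-- The quadratic term of the mode system, in polarized form. -/
noncomputable def modeBilin (ε t : ℝ) (u v : ModeSeq) : ModeSeq :=
  -- A product of modes i and j has amplitude ε_i ε_j and is divided by the amplitude of the target
  -- mode. For i, j ≥ 1 this leaves ε/2 for the sum and for the difference, and ε²/2 for mode 0.
  -- Products into the difference carry t to the power of the smaller index, which is why `damp t`
  -- acts on the first argument and both orders are added.
  convLow u v + (ε / 2) • convSum u v
    + (ε / 2) • (convDiff (damp t u) v + convDiff (damp t v) u)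
    + (ε ^ 2 / 2) • convDiag (damp t u) v

/-- The solution operators of all modes. -/
noncomputable def solOp : ModeSeq →L[ℝ] ModeSeq := SeqL1.diag modeOp modeBound norm_modeOp_le

/-- The derivatives of the solutions given by `solOp`. -/
noncomputable def solOp' : ModeSeq →L[ℝ] ModeSeq := SeqL1.diag modeOp' modeBound norm_modeOp'_le

theorem solOp_apply (f : ModeSeq) (m : ℕ) : solOp f m = modeOp m (f m) :=
  SeqL1.diag_apply _ _ _ f m

theorem solOp'_apply (f : ModeSeq) (m : ℕ) : solOp' f m = modeOp' m (f m) :=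
  SeqL1.diag_apply _ _ _ f m

theorem solOp_single (i : ℕ) (x : Profile) :
    solOp (SeqL1.single i x) = SeqL1.single i (modeOp i x) :=
  SeqL1.diag_single _ _ _ i x

/-- The line soliton `6 sech²`, in mode `0`. -/
noncomputable def solitonSeq : ModeSeq := SeqL1.single 0 ((6 : ℝ) • sechPow 1)

/-- The bifurcating direction `sech³`, in mode `1`. -/
noncomputable def groundSeq : ModeSeq := SeqL1.single 1 (sechPow 2)

/-- The base point of the branch. -/
noncomputable def baseSeq : ModeSeq := solitonSeq + groundSeq

/-- The projection onto the modes `0` and `1`. -/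
noncomputable def lowProj : ModeSeq →L[ℝ] ModeSeq := modeProj 0 + modeProj 1

/-- The fixed point map of the mode system. -/
noncomputable def modeRhs (ε t : ℝ) (f : ModeSeq) (γ : ℝ) : ModeSeq :=
  -- The source left for `modeOp`: quadratic term minus γu, minus the source already balanced by
  -- `baseSeq`, minus the potential 12 sech², which the inverses of the modes 0 and 1 contain
  -- already.
  modeBilin ε t (baseSeq + solOp f) (baseSeq + solOp f) - γ • (baseSeq + solOp f)
    - convLow baseSeq baseSeq - (2 : ℝ) • convLow solitonSeq (solOp (lowProj f))

/-- The mode system, with the solvability condition of the mode `1`. -/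
noncomputable def modeSystem (v : (ℝ × ℝ) × ModeSeq × ℝ) : ModeSeq × ℝ :=
  (v.2.1 - modeRhs v.1.1 v.1.2 v.2.1 v.2.2, groundPairing (SeqL1.coord 1 v.2.1))

/-- At t = 0 only products into the sum of the indices remain, so higher modes no longer act on
lower ones. -/
theorem modeBilin_zero (ε : ℝ) (u v : ModeSeq) :
    modeBilin ε 0 u v = convLow u v + (ε / 2) • convSum u v := by
  have h2 : ∀ v w : ModeSeq, convDiff (modeProj 0 v) w = 0 := fun v w => by
    have : convDiff.comp (modeProj 0) = 0 := SeqL1.clm_ext₂ fun i j x y => by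
      rw [ContinuousLinearMap.comp_apply]
      rcases eq_or_ne 0 i with rfl | hi
      · rw [modeProj_single_self, convDiff, modeConv_single_of_notMem (by simp)]
        simp
      · simp [modeProj_single_ne hi]
    exact congr($this v w)
  have h3 : ∀ v w : ModeSeq, convDiag (modeProj 0 v) w = 0 := fun v w => by
    have : convDiag.comp (modeProj 0) = 0 := SeqL1.clm_ext₂ fun i j x y => by
      rw [ContinuousLinearMap.comp_apply]
      rcases eq_or_ne 0 i with rfl | hi
      · rw [modeProj_single_self, convDiag, modeConv_single_of_notMem (by simp)]
        simp
      · simp [modeProj_single_ne hi]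
    exact congr($this v w)
  rw [modeBilin, damp_zero, h2, h2, h3]
  simp

theorem contDiffAt_bilin {D X Y Z : Type*} [NormedAddCommGroup D] [NormedSpace ℝ D]
    [NormedAddCommGroup X] [NormedSpace ℝ X] [NormedAddCommGroup Y] [NormedSpace ℝ Y]
    [NormedAddCommGroup Z] [NormedSpace ℝ Z] (B : X →L[ℝ] Y →L[ℝ] Z) {p : D → X} {q : D → Y}
    {x : D} {n : ℕ∞ω} (hp : ContDiffAt ℝ n p x) (hq : ContDiffAt ℝ n q x) :
    ContDiffAt ℝ n (fun v => B (p v) (q v)) x :=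
  ContDiffAt.clm_apply (f := fun v => B (p v)) (B.contDiff.contDiffAt.comp x hp) hq

theorem contDiffAt_clm {D X Y : Type*} [NormedAddCommGroup D] [NormedSpace ℝ D]
    [NormedAddCommGroup X] [NormedSpace ℝ X] [NormedAddCommGroup Y] [NormedSpace ℝ Y]
    (B : X →L[ℝ] Y) {p : D → X} {x : D} {n : ℕ∞ω} (hp : ContDiffAt ℝ n p x) :
    ContDiffAt ℝ n (fun v => B (p v)) x :=
  B.contDiff.contDiffAt.comp x hp

theorem contDiffAt_modeBilin {D : Type*} [NormedAddCommGroup D] [NormedSpace ℝ D]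
    {e s : D → ℝ} {u : D → ModeSeq} {x : D} {n : ℕ∞ω} (hs0 : |s x| < 1 / 4)
    (he : ContDiffAt ℝ n e x) (hs : ContDiffAt ℝ n s x) (hu : ContDiffAt ℝ n u x) :
    ContDiffAt ℝ n (fun v => modeBilin (e v) (s v) (u v) (u v)) x := by
  have hd : ContDiffAt ℝ n (fun v => damp (s v)) x := (contDiffAt_damp hs0).comp x hs
  have hdu : ContDiffAt ℝ n (fun v => damp (s v) (u v)) x := hd.clm_apply hu
  have h1 := contDiffAt_bilin convLow hu hu
  have h2 := contDiffAt_bilin convSum hu hu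
  have h3 := contDiffAt_bilin convDiff hdu hu
  have h4 := contDiffAt_bilin convDiag hdu hu
  have he1 : ContDiffAt ℝ n (fun v => e v / 2) x := he.div_const 2
  have he2 : ContDiffAt ℝ n (fun v => e v ^ 2 / 2) x := (he.pow 2).div_const 2
  exact ((h1.add (he1.smul h2)).add (he1.smul (h3.add h3))).add (he2.smul h4)

theorem contDiffAt_modeRhs {D : Type*} [NormedAddCommGroup D] [NormedSpace ℝ D]
    {e s γ : D → ℝ} {f : D → ModeSeq} {x : D} {n : ℕ∞ω} (hs0 : |s x| < 1 / 4)
    (he : ContDiffAt ℝ n e x) (hs : ContDiffAt ℝ n s x) (hf : ContDiffAt ℝ n f x)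
    (hγ : ContDiffAt ℝ n γ x) :
    ContDiffAt ℝ n (fun v => modeRhs (e v) (s v) (f v) (γ v)) x := by
  have hu : ContDiffAt ℝ n (fun v => baseSeq + solOp (f v)) x :=
    contDiffAt_const.add (contDiffAt_clm solOp hf)
  have hb := contDiffAt_modeBilin hs0 he hs hu
  have hg : ContDiffAt ℝ n (fun v => γ v • (baseSeq + solOp (f v))) x := hγ.smul hu
  have hl : ContDiffAt ℝ n (fun v => (2 : ℝ) • convLow solitonSeq (solOp (lowProj (f v)))) x :=
    contDiffAt_clm ((2 : ℝ) • (convLow solitonSeq).comp (solOp.comp lowProj)) hf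
  unfold modeRhs
  exact ((hb.sub hg).sub contDiffAt_const).sub hl

theorem contDiffAt_modeSystem {ε t : ℝ} (ht : |t| < 1 / 4) (y : ModeSeq × ℝ) {n : ℕ∞ω} :
    ContDiffAt ℝ n modeSystem ((ε, t), y) := by
  have h1 : ContDiffAt ℝ n (fun v : (ℝ × ℝ) × ModeSeq × ℝ => v.1) ((ε, t), y) := contDiffAt_fst
  have h2 : ContDiffAt ℝ n (fun v : (ℝ × ℝ) × ModeSeq × ℝ => v.2) ((ε, t), y) := contDiffAt_snd
  have hf : ContDiffAt ℝ n (fun v : (ℝ × ℝ) × ModeSeq × ℝ => v.2.1) ((ε, t), y) := h2.fst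
  have hr : ContDiffAt ℝ n (fun v : (ℝ × ℝ) × ModeSeq × ℝ => modeRhs v.1.1 v.1.2 v.2.1 v.2.2)
      ((ε, t), y) :=
    contDiffAt_modeRhs (s := fun v : (ℝ × ℝ) × ModeSeq × ℝ => v.1.2) ht h1.fst h1.snd hf h2.snd
  have hl : ContDiffAt ℝ n
      (fun v : (ℝ × ℝ) × ModeSeq × ℝ => groundPairing (SeqL1.coord 1 v.2.1)) ((ε, t), y) :=
    contDiffAt_clm (groundPairing.comp (SeqL1.coord 1)) hf
  have hs : ContDiffAt ℝ n (fun v : (ℝ × ℝ) × ModeSeq × ℝ =>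
      v.2.1 - modeRhs v.1.1 v.1.2 v.2.1 v.2.2) ((ε, t), y) := hf.sub hr
  unfold modeSystem
  exact hs.prodMk hl

/-! ### The linearization at the base point and its invertibility. -/

/-- The part of the linearization that acts on the modes `m ≥ 2`. -/
noncomputable def highPotential (m : ℕ) : Profile →L[ℝ] Profile :=
  if m < 2 then 0 else (12 : ℝ) • (profileMul (sechPow 1)).comp (modeOp m)

theorem norm_highPotential_le (m : ℕ) : ‖highPotential m‖ ≤ 12 / 23 := by
  rw [highPotential]
  split_ifs with h
  · rw [norm_zero]; norm_num
  · rw [norm_smul]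
    have h1 := (ContinuousLinearMap.opNorm_comp_le (profileMul (sechPow 1)) (modeOp m)).trans
      (mul_le_mul ((norm_profileMul_le _).trans (norm_sechPow_le 1))
        (norm_modeOp_le_of_two_le (not_lt.1 h)) (norm_nonneg _) zero_le_one)
    norm_num at h1 ⊢
    linarith

/-- The diagonal part of the linearization. -/
noncomputable def linDiag : ModeSeq →L[ℝ] ModeSeq :=
  SeqL1.diag highPotential (12 / 23) norm_highPotential_le

/-- The coupling of the mode `0` into the mode `1` in the linearization. -/
noncomputable def linCoupling : ModeSeq →L[ℝ] ModeSeq :=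
  (SeqL1.single 1).comp ((2 : ℝ) • (profileMul (sechPow 2)).comp ((modeOp 0).comp (SeqL1.coord 0)))

/-- The linear effect of a source, mode by mode. Multiplication by the soliton cancels against the
absorbed potential in the modes 0 and 1, and survives as `highPotential` for m ≥ 2. Multiplication
by the mode 1 part of `baseSeq` carries the response of mode 0 into mode 1; its product with
positive modes is not part of `convLow`. -/
theorem convLow_base (f : ModeSeq) :
    convLow baseSeq (solOp f) + convLow (solOp f) baseSeq
      - (2 : ℝ) • convLow solitonSeq (solOp (lowProj f)) = linDiag f + linCoupling f := by
  suffices h : (convLow baseSeq).comp solOp + (convLow.flip baseSeq).comp solOp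
      - (2 : ℝ) • (convLow solitonSeq).comp (solOp.comp lowProj) = linDiag + linCoupling from
    congr($h f)
  refine SeqL1.clm_ext fun i x => ?_
  simp only [sub_apply, add_apply, smul_apply, ContinuousLinearMap.comp_apply,
    ContinuousLinearMap.flip_apply, solOp_single, baseSeq, solitonSeq, groundSeq, map_add,
    lowProj, linDiag, SeqL1.diag_single, linCoupling, SeqL1.coord_apply]
  have e1 : ∀ (j : ℕ) (g h : Profile), convLow (SeqL1.single 0 g) (SeqL1.single j h)
      = SeqL1.single j (profileMul g h) := fun j g h => by
    rw [convLow, modeConv_single_of_mem (by simp), zero_add]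
  have e2 : ∀ (j : ℕ) (g h : Profile), convLow (SeqL1.single j g) (SeqL1.single 0 h)
      = SeqL1.single j (profileMul g h) := fun j g h => by
    rw [convLow, modeConv_single_of_mem (by simp), add_zero]
  have e3 : ∀ (j : ℕ) (g h : Profile), j ≠ 0 → convLow (SeqL1.single 1 g) (SeqL1.single j h) = 0 :=
    fun j g h hj => by rw [convLow, modeConv_single_of_notMem (by simpa using hj)]
  have e4 : ∀ (j : ℕ) (g h : Profile), j ≠ 0 → convLow (SeqL1.single j g) (SeqL1.single 1 h) = 0 :=
    fun j g h hj => by rw [convLow, modeConv_single_of_notMem (by simpa using hj)]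
  have c1 := profileMul_comm (modeOp i x) ((6 : ℝ) • sechPow 1)
  have c2 := profileMul_comm (modeOp i x) (sechPow 2)
  match i with
  | 0 =>
    simp only [e1, e2, c1, c2, modeProj_single_self, modeProj_single_ne (one_ne_zero), solOp_single,
      map_zero, add_zero, SeqL1.single_apply_self, highPotential]
    simp only [show (0 : ℕ) < 2 by norm_num, if_true, map_zero, zero_apply, smul_apply, zero_add,
      map_smul]
    module
  | 1 =>
    simp only [e1, e2, e3 1 _ _ one_ne_zero, c1, modeProj_single_self,
      modeProj_single_ne (zero_ne_one), solOp_single,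
      map_zero, add_zero, zero_add, SeqL1.single_apply_ne (zero_ne_one), highPotential]
    simp only [show (1 : ℕ) < 2 by norm_num, if_true, map_zero, zero_apply, smul_apply, zero_add,
      map_smul, smul_zero]
    module
  | k + 2 =>
    have h0 : 0 ≠ k + 2 := by omega
    have h1 : 1 ≠ k + 2 := by omega
    simp only [e1, e2, e3 (k + 2) _ _ h0.symm, e4 (k + 2) _ _ h0.symm, c1, modeProj_single_ne h0,
      modeProj_single_ne h1, map_zero, add_zero, SeqL1.single_apply_ne h0, highPotential]
    simp only [show ¬ (k + 2 < 2) by omega, if_false, map_zero, smul_apply, smul_zero, sub_zero,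
      ContinuousLinearMap.comp_apply, map_smul, add_zero]
    module

/-- The linearization of the mode system at the base point. -/
noncomputable def modeLin : (ModeSeq × ℝ) →L[ℝ] ModeSeq × ℝ :=
  ((ContinuousLinearMap.id ℝ ModeSeq - linDiag - linCoupling).comp
      (ContinuousLinearMap.fst ℝ ModeSeq ℝ)
    + (ContinuousLinearMap.snd ℝ ModeSeq ℝ).smulRight baseSeq).prod
    ((groundPairing.comp (SeqL1.coord 1)).comp (ContinuousLinearMap.fst ℝ ModeSeq ℝ))

theorem modeLin_apply (f : ModeSeq) (γ : ℝ) :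
    modeLin (f, γ) = (f - linDiag f - linCoupling f + γ • baseSeq, groundPairing (f 1)) := rfl

theorem modeSystem_zero_zero (f : ModeSeq) (γ : ℝ) :
    modeSystem ((0, 0), (f, γ))
      = modeLin (f, γ) + (γ • solOp f - convLow (solOp f) (solOp f), 0) := by
  rw [modeLin_apply, modeSystem, modeRhs, modeBilin_zero, Prod.mk_add_mk]
  refine Prod.ext ?_ (add_zero _).symm
  have := convLow_base f
  simp only [map_add, add_apply, smul_add, zero_div, zero_smul, add_zero] at this ⊢
  rw [← sub_eq_zero] at this ⊢
  rw [← neg_eq_zero, ← this]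
  abel

theorem hasFDerivAt_modeSystem_snd :
    HasFDerivAt (fun y => modeSystem ((0, 0), y)) modeLin 0 := by
  have h : (fun y => modeSystem ((0, 0), y)) = fun y : ModeSeq × ℝ =>
      modeLin y + (y.2 • solOp y.1 - convLow (solOp y.1) (solOp y.1), 0) := by
    funext y
    exact modeSystem_zero_zero y.1 y.2
  rw [h]
  have h1 : HasFDerivAt (fun y : ModeSeq × ℝ => solOp y.1)
      (solOp.comp (ContinuousLinearMap.fst ℝ ModeSeq ℝ)) 0 :=
    (solOp.comp (ContinuousLinearMap.fst ℝ ModeSeq ℝ)).hasFDerivAt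
  have h2 := convLow.hasFDerivAt_of_bilinear h1 h1
  have h3 := (hasFDerivAt_snd (𝕜 := ℝ) (p := (0 : ModeSeq × ℝ))).smul h1
  have h4 := (modeLin.hasFDerivAt (x := 0)).add ((h3.sub h2).prodMk (hasFDerivAt_const (0 : ℝ) _))
  convert! h4 using 1
  ext y <;> simp

/-- The transversality condition: as the speed varies along the line solitons, the ground state
eigenvalue of mode 1 passes through zero at nonzero rate. The value is 12(1/8 · 8/15 - 1/4 · 2/3) +
8/15. -/
theorem groundPairing_nondegenerate :
    2 * groundPairing (profileMul (sechPow 2) (modeOp 0 ((6 : ℝ) • sechPow 1)))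
      + groundPairing (sechPow 2) = -2 / 3 := by
  have h1 : groundPairing (profileMul (sechPow 2) (modeOp 0 (sechPow 1)))
      = ∫ x in Set.Ioi 0, sech x ^ 6 * (sech x * modeOp 0 (sechPow 1) x) := by
    rw [groundPairing_apply]
    congr 1
    ext x
    rw [profileMul_apply, sechPow_apply]
    ring
  have h2 : ∀ x, (sech x ^ 4 - 2 * sech x ^ 2) / 8 * (sech x * sechPow 1 x)
      = 1 / 8 * sech x ^ 6 - 1 / 4 * sech x ^ 4 := fun x => by
    rw [sechPow_apply]; ring
  have i1 := (integrableOn_sech_pow (n := 6) (by norm_num)).const_mul (1 / 8)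
  have i2 := (integrableOn_sech_pow (n := 4) (by norm_num)).const_mul (1 / 4)
  rw [map_smul, map_smul, map_smul, h1, integral_sech_six_mul_modeOp, groundPairing_sechPow]
  simp only [h2]
  rw [integral_sub i1 i2, integral_const_mul, integral_const_mul]
  change 2 * ((6 : ℝ) * (1 / 8 * sechMoment 6 - 1 / 4 * sechMoment 4)) + sechMoment 6 = _
  rw [sechMoment_six, sechMoment_four]
  norm_num

theorem baseSeq_zero : baseSeq 0 = (6 : ℝ) • sechPow 1 := by
  change solitonSeq 0 + groundSeq 0 = _
  rw [solitonSeq, groundSeq, SeqL1.single_apply_self, SeqL1.single_apply_ne zero_ne_one, add_zero]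

theorem baseSeq_one : baseSeq 1 = sechPow 2 := by
  change solitonSeq 1 + groundSeq 1 = _
  rw [solitonSeq, groundSeq, SeqL1.single_apply_self, SeqL1.single_apply_ne one_ne_zero, zero_add]

theorem baseSeq_of_two_le {m : ℕ} (h : 2 ≤ m) : baseSeq m = 0 := by
  change solitonSeq m + groundSeq m = _
  rw [solitonSeq, groundSeq, SeqL1.single_apply_ne (by omega), SeqL1.single_apply_ne (by omega),
    zero_add]

theorem linDiag_apply (f : ModeSeq) (m : ℕ) : linDiag f m = highPotential m (f m) :=
  SeqL1.diag_apply _ _ _ f m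

theorem linDiag_of_lt {m : ℕ} (h : m < 2) (f : ModeSeq) : linDiag f m = 0 := by
  rw [linDiag_apply, highPotential, if_pos h]; rfl

theorem linCoupling_apply (f : ModeSeq) : linCoupling f
    = SeqL1.single 1 ((2 : ℝ) • profileMul (sechPow 2) (modeOp 0 (f 0))) := rfl

/-- A Neumann series: the potential contributes 12 and the free inverses 1/23, and 12/23 < 1. -/
theorem isUnit_one_sub_linDiag : IsUnit (1 - linDiag) :=
  isUnit_one_sub_of_norm_lt_one (x := linDiag)
    ((SeqL1.norm_diag_le highPotential (12 / 23) norm_highPotential_le).trans_lt (by norm_num))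

/-- The system is triangular. The row of mode 0 gives the source of mode 0 in terms of γ. Pairing
the row of mode 1 with the ground state and inserting this leaves a scalar equation for γ with
coefficient -2/3 up to sign. The remaining equation is solved by inverting `1 - linDiag`. -/
theorem bijective_modeLin : Function.Bijective modeLin := by
  obtain ⟨T, hT⟩ := isUnit_one_sub_linDiag
  have hT1 : ∀ f : ModeSeq, (↑T⁻¹ : ModeSeq →L[ℝ] ModeSeq) (f - linDiag f) = f := fun f => by
    have := congr($(T.inv_mul) f)
    rw [hT] at this
    simpa using this
  have hT2 : ∀ f : ModeSeq, (↑T⁻¹ : ModeSeq →L[ℝ] ModeSeq) f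
      - linDiag ((↑T⁻¹ : ModeSeq →L[ℝ] ModeSeq) f) = f := fun f => by
    have := congr($(T.mul_inv) f)
    rw [hT] at this
    simpa using this
  have hnd := groundPairing_nondegenerate
  constructor
  · rw [injective_iff_map_eq_zero]
    rintro ⟨f, γ⟩ h
    rw [modeLin_apply, Prod.mk_eq_zero] at h
    obtain ⟨h1, h2⟩ := h
    have h3 : f 0 + γ • (6 : ℝ) • sechPow 1 = 0 := by
      have h := congr($h1 0)
      change f 0 - linDiag f 0 - linCoupling f 0 + γ • baseSeq 0 = 0 at h
      rw [linDiag_of_lt (by norm_num), linCoupling_apply, SeqL1.single_apply_ne zero_ne_one,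
        baseSeq_zero] at h
      simpa using h
    have h4 : f 1 - (2 : ℝ) • profileMul (sechPow 2) (modeOp 0 (f 0)) + γ • sechPow 2 = 0 := by
      have h := congr($h1 1)
      change f 1 - linDiag f 1 - linCoupling f 1 + γ • baseSeq 1 = 0 at h
      rw [linDiag_of_lt (by norm_num), linCoupling_apply, SeqL1.single_apply_self,
        baseSeq_one] at h
      simpa using h
    have h5 : f 0 = -(γ • (6 : ℝ) • sechPow 1) := eq_neg_of_add_eq_zero_left h3
    have h6 := congrArg groundPairing h4
    simp only [h5, map_neg, map_add, map_sub, h2, map_smul, map_zero, smul_eq_mul] at h6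
    simp only [map_smul, smul_eq_mul] at hnd
    have h7 : γ = 0 := by
      have : γ * (-2 / 3) = 0 := by rw [← hnd]; linear_combination h6
      simpa using this
    subst h7
    have h8 : f 0 = 0 := by rw [h5, zero_smul, neg_zero]
    rw [linCoupling_apply, h8, map_zero, map_zero, smul_zero, map_zero, sub_zero, zero_smul,
      add_zero] at h1
    rw [Prod.mk_eq_zero]
    exact ⟨by rw [← hT1 f, h1, map_zero], rfl⟩
  · rintro ⟨h, l⟩
    let γ : ℝ := (groundPairing (h 1)
      + 2 * groundPairing (profileMul (sechPow 2) (modeOp 0 (h 0))) - l) / (-2 / 3)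
    let k : Profile := h 0 - γ • (6 : ℝ) • sechPow 1
    let r : ModeSeq := h + SeqL1.single 1 ((2 : ℝ) • profileMul (sechPow 2) (modeOp 0 k))
      - γ • baseSeq
    let f : ModeSeq := (↑T⁻¹ : ModeSeq →L[ℝ] ModeSeq) r
    have hf : f - linDiag f = r := hT2 r
    have f0 : f 0 = k := by
      have h' := congr($hf 0)
      change f 0 - linDiag f 0 = h 0 + (SeqL1.single 1 _ : ModeSeq) 0 - γ • baseSeq 0 at h'
      rw [linDiag_of_lt (by norm_num), SeqL1.single_apply_ne zero_ne_one, baseSeq_zero] at h'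
      simpa using h'
    have f1 : f 1 = h 1 + (2 : ℝ) • profileMul (sechPow 2) (modeOp 0 k) - γ • sechPow 2 := by
      have h' := congr($hf 1)
      change f 1 - linDiag f 1 = h 1 + (SeqL1.single 1 _ : ModeSeq) 1 - γ • baseSeq 1 at h'
      rw [linDiag_of_lt (by norm_num), SeqL1.single_apply_self, baseSeq_one] at h'
      simpa using h'
    refine ⟨(f, γ), ?_⟩
    rw [modeLin_apply, hf, linCoupling_apply, f0]
    refine Prod.ext ?_ ?_
    · change h + _ - γ • baseSeq - _ + γ • baseSeq = h
      abel
    · change groundPairing (f 1) = l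
      have hγ : γ * (-2 / 3) = groundPairing (h 1)
          + 2 * groundPairing (profileMul (sechPow 2) (modeOp 0 (h 0))) - l := by
        simp only [γ]; ring
      rw [f1]
      simp only [k, map_add, map_sub, map_smul, smul_eq_mul] at hnd ⊢
      linear_combination -γ * hnd - hγ

theorem isInvertible_modeLin : modeLin.IsInvertible := by
  refine ⟨ContinuousLinearEquiv.ofBijective modeLin
    (LinearMap.ker_eq_bot.2 bijective_modeLin.1) (LinearMap.range_eq_top.2 bijective_modeLin.2), ?_⟩
  exact ContinuousLinearMap.ext fun _ => rfl

theorem fderiv_modeSystem_comp_inr :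
    fderiv ℝ modeSystem ((0, 0), 0) ∘L .inr ℝ (ℝ × ℝ) (ModeSeq × ℝ) = modeLin := by
  have h1 : HasFDerivAt modeSystem (fderiv ℝ modeSystem ((0, 0), 0)) ((0, 0), 0) :=
    ((contDiffAt_modeSystem (n := 1) (by norm_num) 0).differentiableAt (by simp)).hasFDerivAt
  have h2 : HasFDerivAt (fun y : ModeSeq × ℝ => (((0, 0), y) : (ℝ × ℝ) × ModeSeq × ℝ))
      (.inr ℝ (ℝ × ℝ) (ModeSeq × ℝ)) 0 :=
    (hasFDerivAt_const _ _).prodMk (hasFDerivAt_id _)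
  exact (h1.comp (0 : ModeSeq × ℝ) h2).unique hasFDerivAt_modeSystem_snd

theorem modeSystem_base : modeSystem ((0, 0), 0) = 0 := by
  refine (modeSystem_zero_zero 0 0).trans ?_
  rw [map_zero solOp, map_zero, zero_smul, sub_zero]
  exact (congrArg (· + 0) (map_zero modeLin)).trans (add_zero 0)

/-- The local branch of solutions of the mode system, as a function of both parameters. -/
theorem exists_branch : ∃ S : ℝ × ℝ → ModeSeq × ℝ, ContDiffAt ℝ 2 S (0, 0) ∧ S (0, 0) = 0 ∧
    (∀ᶠ p in 𝓝 (0, 0), modeSystem (p, S p) = 0) ∧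
    ∀ᶠ v in 𝓝 (((0, 0), 0) : (ℝ × ℝ) × ModeSeq × ℝ), modeSystem v = 0 → S v.1 = v.2 := by
  have cd : ContDiffAt ℝ 2 modeSystem ((0, 0), 0) := contDiffAt_modeSystem (by norm_num) 0
  have hi : (fderiv ℝ modeSystem ((0, 0), 0) ∘L
      .inr ℝ (ℝ × ℝ) (ModeSeq × ℝ)).IsInvertible := by
    rw [fderiv_modeSystem_comp_inr]; exact isInvertible_modeLin
  refine ⟨cd.implicitFunction two_ne_zero hi, cd.contDiffAt_implicitFunction two_ne_zero hi,
    cd.implicitFunction_apply_self two_ne_zero hi, ?_, ?_⟩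
  · filter_upwards [cd.eventually_apply_implicitFunction two_ne_zero hi] with p hp
    rw [hp, modeSystem_base]
  · filter_upwards [cd.eventually_apply_eq_iff_implicitFunction two_ne_zero hi] with v hv h0
    exact hv.1 (h0.trans modeSystem_base.symm)

/-! ### The branch at a fixed amplitude scale -/

theorem coord_modeConv {S : Set (ℕ × ℕ)} {σ : ℕ → ℕ → ℕ} (k : ℕ) (s : Finset (ℕ × ℕ))
    (h : ∀ i j, (i, j) ∈ s ↔ (i, j) ∈ S ∧ σ i j = k) (u v : ModeSeq) :
    modeConv S σ u v k = ∑ p ∈ s, profileMul (u p.1) (v p.2) := by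
  classical
  let β : ℕ × ℕ → ModeSeq →L[ℝ] ModeSeq →L[ℝ] Profile := fun p =>
    ((profileMul.comp (SeqL1.coord p.1)).flip.comp (SeqL1.coord p.2)).flip
  have hβ : ∀ p u v, β p u v = profileMul (u p.1) (v p.2) := fun p u v => rfl
  have key : (ContinuousLinearMap.compL ℝ ModeSeq ModeSeq Profile (SeqL1.coord k)).comp
      (modeConv S σ) = ∑ p ∈ s, β p := by
    refine SeqL1.clm_ext₂ fun i j x y => ?_
    rw [sum_apply, sum_apply]
    simp only [hβ]
    have hz : ∀ p ∈ s, p ≠ (i, j) → profileMul ((SeqL1.single i x : ModeSeq) p.1)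
        ((SeqL1.single j y : ModeSeq) p.2) = 0 := fun p _ hp => by
      by_cases h1 : p.1 = i
      · have h2 : p.2 ≠ j := fun h2 => hp (Prod.ext h1 h2)
        rw [SeqL1.single_apply_ne h2, map_zero]
      · rw [SeqL1.single_apply_ne h1, map_zero]; rfl
    change (modeConv S σ (SeqL1.single i x) (SeqL1.single j y)) k = _
    by_cases hS : (i, j) ∈ S
    · rw [modeConv_single_of_mem hS]
      by_cases hk : σ i j = k
      · rw [Finset.sum_eq_single_of_mem (i, j) ((h i j).2 ⟨hS, hk⟩) hz, hk,
          SeqL1.single_apply_self, SeqL1.single_apply_self, SeqL1.single_apply_self]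
      · rw [SeqL1.single_apply_ne (Ne.symm hk), Finset.sum_eq_zero]
        exact fun p hp => hz p hp fun e => hk ((h i j).1 (e ▸ hp)).2
    · rw [modeConv_single_of_notMem hS, Finset.sum_eq_zero]
      · rfl
      · exact fun p hp => hz p hp fun e => hS ((h i j).1 (e ▸ hp)).1
  have := congr($key u v)
  rw [sum_apply, sum_apply] at this
  exact this

/-- The differences j - i = k and the diagonal have infinitely many pairs, so `coord_modeConv` does
not apply to them directly. It does after restriction to one row, and only such rows occur since the
damping and its derivative at t = 0 are `modeProj 0` and `modeProj 1`. -/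
theorem modeConv_modeProj {S : Set (ℕ × ℕ)} {σ : ℕ → ℕ → ℕ} (n : ℕ) (u v : ModeSeq) :
    modeConv S σ (modeProj n u) v = modeConv {p | p ∈ S ∧ p.1 = n} σ u v := by
  suffices h : (modeConv S σ).comp (modeProj n) = modeConv {p | p ∈ S ∧ p.1 = n} σ from
    congr($h u v)
  refine SeqL1.clm_ext₂ fun i j x y => ?_
  rw [ContinuousLinearMap.comp_apply]
  by_cases hi : n = i
  · subst hi
    rw [modeProj_single_self]
    by_cases hS : (n, j) ∈ S
    · rw [modeConv_single_of_mem hS, modeConv_single_of_mem (S := {p | p ∈ S ∧ p.1 = n}) ⟨hS, rfl⟩]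
    · rw [modeConv_single_of_notMem hS, modeConv_single_of_notMem fun h => hS h.1]
  · rw [modeProj_single_ne hi, map_zero, modeConv_single_of_notMem fun h : _ ∧ _ => hi h.2.symm]
    rfl

theorem convLow_apply_zero (u v : ModeSeq) : convLow u v 0 = profileMul (u 0) (v 0) := by
  rw [convLow, coord_modeConv 0 {(0, 0)} fun i j => by simp; omega, Finset.sum_singleton]

theorem convLow_apply_pos {m : ℕ} (hm : m ≠ 0) (u v : ModeSeq) :
    convLow u v m = profileMul (u 0) (v m) + profileMul (u m) (v 0) := by
  rw [convLow, coord_modeConv m {(0, m), (m, 0)} fun i j => by simp; omega, Finset.sum_pair]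
  simp [hm.symm]

theorem convSum_apply_of_lt {m : ℕ} (hm : m < 2) (u v : ModeSeq) : convSum u v m = 0 := by
  rw [convSum, coord_modeConv m ∅ fun i j => by simp; omega, Finset.sum_empty]

theorem convSum_apply_two (u v : ModeSeq) : convSum u v 2 = profileMul (u 1) (v 1) := by
  rw [convSum, coord_modeConv 2 {(1, 1)} fun i j => by simp; omega, Finset.sum_singleton]

theorem convDiff_apply_zero (u v : ModeSeq) : convDiff u v 0 = 0 := by
  rw [convDiff, coord_modeConv 0 ∅ fun i j => by simp; omega, Finset.sum_empty]

theorem convDiff_modeProj_apply_one (u v : ModeSeq) :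
    convDiff (modeProj 1 u) v 1 = profileMul (u 1) (v 2) := by
  rw [convDiff, modeConv_modeProj, coord_modeConv 1 {(1, 2)} fun i j => by simp; omega,
    Finset.sum_singleton]

theorem convDiag_apply_one (u v : ModeSeq) : convDiag u v 1 = 0 := by
  rw [convDiag, coord_modeConv 1 ∅ fun i j => by simp, Finset.sum_empty]

theorem convDiag_modeProj_apply_zero (u v : ModeSeq) :
    convDiag (modeProj 1 u) v 0 = profileMul (u 1) (v 1) := by
  rw [convDiag, modeConv_modeProj, coord_modeConv 0 {(1, 1)} fun i j => by simp; omega,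
    Finset.sum_singleton]

theorem modeConv_empty {S : Set (ℕ × ℕ)} {σ : ℕ → ℕ → ℕ} (h : ∀ i j, (i, j) ∉ S) (u v : ModeSeq) :
    modeConv S σ u v = 0 := by
  suffices hs : modeConv S σ = 0 from congr($hs u v)
  exact SeqL1.clm_ext₂ fun i j x y => modeConv_single_of_notMem (h i j) x y

theorem convDiff_modeProj_zero (u v : ModeSeq) : convDiff (modeProj 0 u) v = 0 := by
  rw [convDiff, modeConv_modeProj, modeConv_empty fun i j => by simp; omega]

theorem convDiag_modeProj_zero (u v : ModeSeq) : convDiag (modeProj 0 u) v = 0 := by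
  rw [convDiag, modeConv_modeProj, modeConv_empty fun i j => by simp; omega]

theorem lowProj_single_of_lt {i : ℕ} (h : i < 2) (x : Profile) :
    lowProj (SeqL1.single i x) = SeqL1.single i x := by
  rw [lowProj, add_apply]
  interval_cases i
  · rw [modeProj_single_self, modeProj_single_ne one_ne_zero, add_zero]
  · rw [modeProj_single_self, modeProj_single_ne zero_ne_one, zero_add]

theorem lowProj_single_of_le {i : ℕ} (h : 2 ≤ i) (x : Profile) :
    lowProj (SeqL1.single i x) = 0 := by
  rw [lowProj, add_apply, modeProj_single_ne (by omega), modeProj_single_ne (by omega), add_zero]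

theorem lowProj_lowProj (u : ModeSeq) : lowProj (lowProj u) = lowProj u := by
  suffices h : lowProj.comp lowProj = lowProj from congr($h u)
  refine SeqL1.clm_ext fun i x => ?_
  rw [ContinuousLinearMap.comp_apply]
  rcases lt_or_ge i 2 with h | h
  · rw [lowProj_single_of_lt h, lowProj_single_of_lt h]
  · rw [lowProj_single_of_le h, map_zero]

theorem lowProj_solOp (u : ModeSeq) : lowProj (solOp u) = solOp (lowProj u) := by
  suffices h : lowProj.comp solOp = solOp.comp lowProj from congr($h u)
  refine SeqL1.clm_ext fun i x => ?_
  rw [ContinuousLinearMap.comp_apply, ContinuousLinearMap.comp_apply, solOp_single]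
  rcases lt_or_ge i 2 with h | h
  · rw [lowProj_single_of_lt h, lowProj_single_of_lt h, solOp_single]
  · rw [lowProj_single_of_le h, lowProj_single_of_le h, map_zero]

theorem lowProj_solitonSeq : lowProj solitonSeq = solitonSeq := lowProj_single_of_lt two_pos _

theorem lowProj_baseSeq : lowProj baseSeq = baseSeq := by
  rw [baseSeq, map_add, lowProj_solitonSeq, groundSeq, lowProj_single_of_lt one_lt_two]

theorem lowProj_convLow (u v : ModeSeq) :
    lowProj (convLow u v) = convLow (lowProj u) (lowProj v) := by
  suffices h : (ContinuousLinearMap.compL ℝ ModeSeq ModeSeq ModeSeq lowProj).comp convLow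
      = ((convLow.comp lowProj).flip.comp lowProj).flip from congr($h u v)
  refine SeqL1.clm_ext₂ fun i j x y => ?_
  change lowProj (convLow (SeqL1.single i x) (SeqL1.single j y))
    = convLow (lowProj (SeqL1.single i x)) (lowProj (SeqL1.single j y))
  rcases lt_or_ge i 2 with hi | hi <;> rcases lt_or_ge j 2 with hj | hj
  · rw [lowProj_single_of_lt hi, lowProj_single_of_lt hj]
    by_cases h : i = 0 ∨ j = 0
    · rw [convLow, modeConv_single_of_mem (by simpa using h), lowProj_single_of_lt (by omega)]
    · rw [convLow, modeConv_single_of_notMem (by simpa using h), map_zero]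
  · rw [lowProj_single_of_le hj, map_zero]
    by_cases h : i = 0 ∨ j = 0
    · rw [convLow, modeConv_single_of_mem (by simpa using h), lowProj_single_of_le (by omega)]
    · rw [convLow, modeConv_single_of_notMem (by simpa using h), map_zero]
  all_goals
    rw [lowProj_single_of_le hi, map_zero, zero_apply]
    by_cases h : i = 0 ∨ j = 0
    · rw [convLow, modeConv_single_of_mem (by simpa using h), lowProj_single_of_le (by omega)]
    · rw [convLow, modeConv_single_of_notMem (by simpa using h), map_zero]

theorem lowProj_apply_of_lt {i : ℕ} (h : i < 2) (u : ModeSeq) : lowProj u i = u i := by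
  suffices hs : (SeqL1.coord i).comp lowProj = SeqL1.coord i from congr($hs u)
  refine SeqL1.clm_ext fun j x => ?_
  rw [ContinuousLinearMap.comp_apply]
  rcases lt_or_ge j 2 with hj | hj
  · rw [lowProj_single_of_lt hj]
  · rw [lowProj_single_of_le hj, map_zero, SeqL1.coord_apply, SeqL1.single_apply_ne (by omega)]

theorem lowProj_convSum (u v : ModeSeq) : lowProj (convSum u v) = 0 := by
  rw [lowProj, add_apply, modeProj_apply, modeProj_apply, convSum_apply_of_lt two_pos,
    convSum_apply_of_lt one_lt_two, map_zero, map_zero, add_zero]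

/-- At t = 0 the modes 0 and 1 satisfy a closed system that does not involve ε, because products of
positive modes land in modes at least 2. -/
theorem lowProj_modeRhs_zero (ε : ℝ) (f : ModeSeq) (γ : ℝ) :
    lowProj (modeRhs ε 0 f γ) = modeRhs 0 0 (lowProj f) γ := by
  have h : ∀ g : ModeSeq, lowProj (baseSeq + solOp g) = baseSeq + solOp (lowProj g) := fun g => by
    rw [map_add, lowProj_baseSeq, lowProj_solOp]
  rw [modeRhs, modeRhs, modeBilin_zero, modeBilin_zero]
  simp only [map_sub, map_add lowProj (convLow _ _), map_smul, lowProj_convLow, lowProj_convSum, h,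
    lowProj_baseSeq, lowProj_solOp, lowProj_lowProj, lowProj_solitonSeq, smul_zero, zero_div,
    zero_smul]

/-- If `(f, γ)` solves the system at `t = 0`, its low modes solve it at `(0, 0)`. -/
theorem modeSystem_lowProj {ε γ : ℝ} {f : ModeSeq} (h : modeSystem ((ε, 0), (f, γ)) = 0) :
    modeSystem ((0, 0), (lowProj f, γ)) = 0 := by
  rw [modeSystem, Prod.mk_eq_zero] at h ⊢
  refine ⟨?_, ?_⟩
  · change lowProj f - modeRhs 0 0 (lowProj f) γ = 0
    rw [← lowProj_modeRhs_zero ε, ← map_sub]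
    exact (congrArg lowProj h.1).trans (map_zero _)
  · change groundPairing (lowProj f 1) = 0
    rw [lowProj_apply_of_lt one_lt_two]
    exact h.2

/-- The branch of solutions of the mode system at some amplitude scale `ε > 0`. -/
theorem exists_modeBranch : ∃ (ε τ : ℝ) (f : ℝ → ModeSeq) (γ : ℝ → ℝ), 0 < ε ∧ 0 < τ ∧ τ ≤ 1 / 8 ∧
    (∀ t, |t| < τ → ContDiffAt ℝ 2 f t ∧ ContDiffAt ℝ 2 γ t ∧ |γ t| < 1 ∧
      modeSystem ((ε, t), (f t, γ t)) = 0) ∧ lowProj (f 0) = 0 ∧ γ 0 = 0 := by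
  obtain ⟨S, hS, hS0, hsol, huniq⟩ := exists_branch
  have hcont : ContinuousAt S (0, 0) := hS.continuousAt
  -- The projected solutions must enter the neighbourhood in which local uniqueness holds.
  have hlim : Tendsto (fun p => (((0, 0), (lowProj (S p).1, (S p).2)) : (ℝ × ℝ) × ModeSeq × ℝ))
      (𝓝 (0, 0)) (𝓝 ((0, 0), 0)) := by
    have h1 : ContinuousAt (fun p => (((0, 0), (lowProj (S p).1, (S p).2)) :
        (ℝ × ℝ) × ModeSeq × ℝ)) (0, 0) :=
      continuousAt_const.prodMk
        ((lowProj.continuous.continuousAt.comp hcont.fst).prodMk hcont.snd)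
    have h2 := h1.tendsto
    rw [hS0] at h2
    simpa only [Prod.fst_zero, Prod.snd_zero, map_zero, Prod.mk_zero_zero] using h2
  have hγ : ∀ᶠ p in 𝓝 (0, 0), |(S p).2| < 1 := by
    have h1 : Tendsto (fun p => |(S p).2|) (𝓝 (0, 0)) (𝓝 |(S (0, 0)).2|) :=
      hcont.snd.abs.tendsto
    rw [hS0] at h1
    refine h1.eventually_lt_const ?_
    simp
  have hev := (hlim.eventually huniq).and (hsol.and ((hS.eventually (by simp)).and hγ))
  obtain ⟨r, hr, hball⟩ := Metric.eventually_nhds_iff.1 hev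
  have hP : ∀ t, |t| < min r (1 / 8) → dist ((r / 2, t) : ℝ × ℝ) (0, 0) < r := fun t ht => by
    rw [Prod.dist_eq, max_lt_iff]
    simp only [Real.dist_eq, sub_zero]
    rw [abs_of_pos (half_pos hr)]
    exact ⟨half_lt_self hr, ht.trans_le (min_le_left _ _)⟩
  refine ⟨r / 2, min r (1 / 8), fun t => (S (r / 2, t)).1, fun t => (S (r / 2, t)).2,
    half_pos hr, lt_min hr (by norm_num), min_le_right _ _, fun t ht => ?_, ?_⟩
  · obtain ⟨-, h2, h3, h4⟩ := hball (hP t ht)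
    have h5 : ContDiffAt ℝ 2 (fun t => S (r / 2, t)) t :=
      h3.comp t (contDiffAt_const.prodMk contDiffAt_id)
    exact ⟨h5.fst, h5.snd, h4, h2⟩
  · obtain ⟨h1, h2, -, -⟩ := hball (hP 0 (by rw [abs_zero]; exact lt_min hr (by norm_num)))
    -- The low modes at (ε, 0) solve the system at (0, 0), whose only nearby solution is zero.
    have h3 := h1 (modeSystem_lowProj h2)
    rw [hS0] at h3
    exact ⟨congrArg Prod.fst h3.symm, congrArg Prod.snd h3.symm⟩

/-! ### The derivative of the branch -/

theorem hasDerivAt_bilin {X Y Z : Type*} [NormedAddCommGroup X] [NormedSpace ℝ X]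
    [NormedAddCommGroup Y] [NormedSpace ℝ Y] [NormedAddCommGroup Z] [NormedSpace ℝ Z]
    (B : X →L[ℝ] Y →L[ℝ] Z) {p : ℝ → X} {q : ℝ → Y} {p' : X} {q' : Y} {t : ℝ}
    (hp : HasDerivAt p p' t) (hq : HasDerivAt q q' t) :
    HasDerivAt (fun s => B (p s) (q s)) (B p' (q t) + B (p t) q') t :=
  HasDerivAt.clm_apply (B.hasFDerivAt.comp_hasDerivAt t hp) hq

theorem hasDerivAt_clm {X Y : Type*} [NormedAddCommGroup X] [NormedSpace ℝ X]
    [NormedAddCommGroup Y] [NormedSpace ℝ Y] (B : X →L[ℝ] Y) {p : ℝ → X} {p' : X} {t : ℝ}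
    (hp : HasDerivAt p p' t) : HasDerivAt (fun s => B (p s)) (B p') t :=
  B.hasFDerivAt.comp_hasDerivAt t hp

/-- The derivative of the damping at t = 0 is the projection to mode 1, so to first order in t only
mode 1 feeds lower modes: through its products with higher modes and through its square. -/
theorem hasDerivAt_modeBilin_zero (ε : ℝ) {u : ℝ → ModeSeq} {u' : ModeSeq}
    (hu : HasDerivAt u u' 0) :
    HasDerivAt (fun t => modeBilin ε t (u t) (u t))
      (convLow u' (u 0) + convLow (u 0) u' + (ε / 2) • (convSum u' (u 0) + convSum (u 0) u')
        + ε • convDiff (modeProj 1 (u 0)) (u 0)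
        + (ε ^ 2 / 2) • convDiag (modeProj 1 (u 0)) (u 0)) 0 := by
  have hd : HasDerivAt (fun t => damp t (u t)) (modeProj 1 (u 0) + damp 0 u') 0 :=
    hasDerivAt_damp_zero.clm_apply hu
  have h1 := hasDerivAt_bilin convLow hu hu
  have h2 := (hasDerivAt_bilin convSum hu hu).const_smul (ε / 2)
  have h3 := hasDerivAt_bilin convDiff hd hu
  have h4 := (h3.add h3).const_smul (ε / 2)
  have h5 := (hasDerivAt_bilin convDiag hd hu).const_smul (ε ^ 2 / 2)
  have e1 : ∀ v : ModeSeq, convDiff (modeProj 1 (u 0) + modeProj 0 u') v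
      = convDiff (modeProj 1 (u 0)) v := fun v => by
    rw [map_add, add_apply, convDiff_modeProj_zero, add_zero]
  have e2 : ∀ v : ModeSeq, convDiag (modeProj 1 (u 0) + modeProj 0 u') v
      = convDiag (modeProj 1 (u 0)) v := fun v => by
    rw [map_add, add_apply, convDiag_modeProj_zero, add_zero]
  simp only [damp_zero, e1, e2, convDiff_modeProj_zero, convDiag_modeProj_zero, add_zero]
    at h3 h4 h5
  have e3 : ε • convDiff (modeProj 1 (u 0)) (u 0)
      = (ε / 2) • (convDiff (modeProj 1 (u 0)) (u 0) + convDiff (modeProj 1 (u 0)) (u 0)) := by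
    module
  rw [e3]
  exact ((h1.add h2).add h4).add h5

theorem hasDerivAt_modeRhs_zero (ε : ℝ) {f : ℝ → ModeSeq} {f' : ModeSeq} {γ : ℝ → ℝ} {γ' : ℝ}
    (hf : HasDerivAt f f' 0) (hγ : HasDerivAt γ γ' 0) {u : ModeSeq}
    (hu : baseSeq + solOp (f 0) = u) (hγ0 : γ 0 = 0) :
    HasDerivAt (fun t => modeRhs ε t (f t) (γ t))
      (convLow (solOp f') u + convLow u (solOp f')
        + (ε / 2) • (convSum (solOp f') u + convSum u (solOp f'))
        + ε • convDiff (modeProj 1 u) u + (ε ^ 2 / 2) • convDiag (modeProj 1 u) u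
        - γ' • u - (2 : ℝ) • convLow solitonSeq (solOp (lowProj f'))) 0 := by
  have h1 : HasDerivAt (fun t => baseSeq + solOp (f t)) (solOp f') 0 :=
    (hasDerivAt_clm solOp hf).const_add _
  have h2 := hasDerivAt_modeBilin_zero ε h1
  have h3 := hγ.smul h1
  have h4 := (hasDerivAt_clm ((convLow solitonSeq).comp (solOp.comp lowProj)) hf).const_smul (2 : ℝ)
  simp only [hu] at h2 h3
  rw [hγ0, zero_smul, zero_add] at h3
  exact ((h2.sub h3).sub_const (convLow baseSeq baseSeq)).sub h4

/-- The pairing `∫₀^∞ sech² · (sech g)`. -/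
noncomputable def solitonPairing : Profile →L[ℝ] ℝ :=
  have hb : ∀ (g : Profile) z, |sech z ^ 2 * (sech z * g z)| ≤ ‖g‖ * sech z ^ 2 := fun g z => by
    have h1 := g.norm_coe_le_norm z
    have h2 := sech_pos z
    have h3 := sech_le_one z
    rw [Real.norm_eq_abs] at h1
    rw [abs_mul, abs_mul, abs_of_pos h2, abs_of_pos (pow_pos h2 2)]
    calc sech z ^ 2 * (sech z * |g z|) ≤ sech z ^ 2 * (1 * ‖g‖) := by gcongr
      _ = _ := by ring
  have hi : ∀ g : Profile, IntegrableOn (fun z => sech z ^ 2 * (sech z * g z)) (Set.Ioi 0) :=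
    fun g => ((integrableOn_sech_pow (n := 2) (by norm_num)).const_mul ‖g‖).mono'
      ((continuous_sech.pow 2).mul (continuous_sech.mul g.continuous)).aestronglyMeasurable.restrict
      (ae_of_all _ (hb g))
  LinearMap.mkContinuous
    { toFun := fun g => ∫ z in Set.Ioi 0, sech z ^ 2 * (sech z * g z)
      map_add' := fun g h => by
        rw [← integral_add (hi g) (hi h)]
        simp only [BddFun.add_apply]
        congr 1
        ext z
        ring
      map_smul' := fun c g => by
        rw [RingHom.id_apply, smul_eq_mul, ← integral_const_mul]
        simp only [BddFun.smul_apply, smul_eq_mul]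
        congr 1
        ext z
        ring }
    1 fun g => by
      refine (norm_integral_le_of_norm_le
        ((integrableOn_sech_pow (n := 2) (by norm_num)).const_mul ‖g‖) (ae_of_all _ (hb g))).trans_eq ?_
      rw [integral_const_mul]
      change ‖g‖ * sechMoment 2 = _
      rw [sechMoment_two]
      ring

theorem solitonPairing_apply (g : Profile) :
    solitonPairing g = ∫ z in Set.Ioi 0, sech z ^ 2 * (sech z * g z) := rfl

theorem integral_sub_add_sub {μ : Measure ℝ} {a b c d : ℝ → ℝ} (ha : Integrable a μ)
    (hb : Integrable b μ) (hc : Integrable c μ) (hd : Integrable d μ) :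
    ∫ x, (a x - b x + (c x - d x)) ∂μ
      = (∫ x, a x ∂μ) - (∫ x, b x ∂μ) + ((∫ x, c x ∂μ) - ∫ x, d x ∂μ) := by
  rw [← integral_sub ha hb, ← integral_sub hc hd]
  exact integral_add (ha.sub hb) (hc.sub hd)

theorem abs_groundPairing_profileMul_le (g : Profile) :
    |groundPairing (profileMul (sechPow 2) g)| ≤ 8 / 15 * ‖g‖ := by
  rw [groundPairing_apply, ← Real.norm_eq_abs]
  refine (norm_integral_le_of_norm_le
    ((integrableOn_sech_pow (n := 6) (by norm_num)).const_mul ‖g‖) (ae_of_all _ fun z => ?_)).trans_eq ?_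
  · have h1 := g.norm_coe_le_norm z
    have h2 := sech_pos z
    have h3 := sech_le_one z
    rw [profileMul_apply, sechPow_apply, norm_mul, norm_mul, norm_mul, norm_mul, norm_pow, norm_pow,
      Real.norm_eq_abs (sech z), abs_of_pos h2]
    calc sech z ^ 3 * (sech z * (sech z * sech z ^ 2 * ‖g z‖)) = sech z ^ 6 * (sech z * ‖g z‖) := by
          ring
      _ ≤ sech z ^ 6 * (1 * ‖g‖) := by gcongr
      _ = _ := by ring
  · rw [integral_const_mul]
    change ‖g‖ * sechMoment 6 = _
    rw [sechMoment_six]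
    ring

theorem groundPairing_profileMul_modeOp (g : Profile) :
    groundPairing (profileMul (sechPow 2) (modeOp 0 g))
      = ∫ x in Set.Ioi 0, (sech x ^ 4 - 2 * sech x ^ 2) / 8 * (sech x * g x) := by
  rw [← integral_sech_six_mul_modeOp, groundPairing_apply]
  congr 1
  ext x
  rw [profileMul_apply, sechPow_apply]
  ring

/-- Data of the branch at `t = 0` and of its derivative there. -/
theorem modeBranch_deriv {ε τ : ℝ} {f : ℝ → ModeSeq} {γ : ℝ → ℝ} (hε : 0 < ε) (hτ : 0 < τ)
    (h : ∀ t, |t| < τ → ContDiffAt ℝ 2 f t ∧ ContDiffAt ℝ 2 γ t ∧ |γ t| < 1 ∧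
      modeSystem ((ε, t), (f t, γ t)) = 0) (hf0 : lowProj (f 0) = 0) (hγ0 : γ 0 = 0) :
    ∃ γ' : ℝ, HasDerivAt γ γ' 0 ∧ ε ^ 2 / 27 < γ' ∧
      HasDerivAt (fun t => solitonPairing (modeOp 0 (f t 0))) (3 / 4 * γ' - ε ^ 2 / 20) 0 := by
  have hτ0 : |(0 : ℝ)| < τ := by rwa [abs_zero]
  obtain ⟨hfd, hγd, -, h0⟩ := h 0 hτ0
  have hf : HasDerivAt f (deriv f 0) 0 := (hfd.differentiableAt (by simp)).hasDerivAt
  have hγ : HasDerivAt γ (deriv γ 0) 0 := (hγd.differentiableAt (by simp)).hasDerivAt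
  set f' := deriv f 0
  set γ' := deriv γ 0
  have f00 : f 0 0 = 0 := by rw [← lowProj_apply_of_lt two_pos, hf0]; rfl
  have f01 : f 0 1 = 0 := by rw [← lowProj_apply_of_lt one_lt_two, hf0]; rfl
  set u : ModeSeq := baseSeq + solOp (f 0) with hu
  have u0 : u 0 = (6 : ℝ) • sechPow 1 := by
    rw [hu, SeqL1.add_apply, solOp_apply, f00, map_zero, add_zero, baseSeq_zero]
  have u1 : u 1 = sechPow 2 := by
    rw [hu, SeqL1.add_apply, solOp_apply, f01, map_zero, add_zero, baseSeq_one]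
  have u2 : u 2 = modeOp 2 (f 0 2) := by
    rw [hu, SeqL1.add_apply, solOp_apply, baseSeq_of_two_le le_rfl, zero_add]
  -- At t = 0 mode 2 has the source 12 sech · u_2 + (ε/2) sech⁵. With the bound 1/23 of `modeOp 2`
  -- this gives 23‖u_2‖ ≤ 12‖u_2‖ + ε/2.
  have hnorm : ‖u 2‖ ≤ ε / 22 := by
    have h1 : f 0 = modeRhs ε 0 (f 0) (γ 0) := sub_eq_zero.1 (Prod.mk_eq_zero.1 h0).1
    have h2 : f 0 2 = (12 : ℝ) • profileMul (sechPow 1) (u 2) + (ε / 2) • sechPow 5 := by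
      rw [h1, modeRhs, modeBilin_zero, hγ0, zero_smul, sub_zero, hf0, map_zero, map_zero, smul_zero,
        sub_zero, ← hu]
      simp only [SeqL1.add_apply, SeqL1.sub_apply, SeqL1.smul_apply, convSum_apply_two,
        convLow_apply_pos two_ne_zero, u0, u1, baseSeq_of_two_le le_rfl, profileMul_sechPow,
        map_zero, zero_apply, profileMul_comm (u 2), map_smul, smul_apply]
      module
    have h3 : ‖u 2‖ ≤ 1 / 23 * ‖f 0 2‖ := by
      rw [u2]; exact (modeOp 2).le_of_opNorm_le (norm_modeOp_le_of_two_le le_rfl) _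
    have h4 : ‖f 0 2‖ ≤ 12 * ‖u 2‖ + ε / 2 := by
      rw [h2]
      refine (norm_add_le _ _).trans (add_le_add ?_ ?_)
      · rw [norm_smul, Real.norm_eq_abs, abs_of_pos (by norm_num)]
        have := (norm_profileMul_apply_le (sechPow 1) (u 2)).trans
          (mul_le_mul_of_nonneg_right (norm_sechPow_le 1) (norm_nonneg _))
        linarith
      · rw [norm_smul, Real.norm_eq_abs, abs_of_pos (by positivity)]
        have := mul_le_mul_of_nonneg_left (norm_sechPow_le 5) (by positivity : 0 ≤ ε / 2)
        linarith
    linarith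
  have hf' : f' = convLow (solOp f') u + convLow u (solOp f')
        + (ε / 2) • (convSum (solOp f') u + convSum u (solOp f'))
        + ε • convDiff (modeProj 1 u) u + (ε ^ 2 / 2) • convDiag (modeProj 1 u) u
        - γ' • u - (2 : ℝ) • convLow solitonSeq (solOp (lowProj f')) := by
    refine hf.unique ((hasDerivAt_modeRhs_zero ε hf hγ hu.symm hγ0).congr_of_eventuallyEq ?_)
    have : ∀ᶠ t in 𝓝 (0 : ℝ), |t| < τ := by
      have := continuous_abs.tendsto (0 : ℝ)
      exact this.eventually_lt_const hτ0
    filter_upwards [this] with t ht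
    exact sub_eq_zero.1 (Prod.mk_eq_zero.1 (h t ht).2.2.2).1
  have s0 : solitonSeq 0 = (6 : ℝ) • sechPow 1 := SeqL1.single_apply_self _ _
  have s1 : solitonSeq 1 = 0 := SeqL1.single_apply_ne one_ne_zero _
  -- Two effects drive mode 0: the change of speed acting on the soliton, and the square of mode 1.
  -- The soliton potential has been absorbed, so no unknown remains on the right.
  have f'0 : f' 0 = -(6 * γ') • sechPow 1 + (ε ^ 2 / 2) • sechPow 5 := by
    have h1 : f' 0 = _ := congr($hf' 0)
    simp only [SeqL1.add_apply, SeqL1.sub_apply, SeqL1.smul_apply, convSum_apply_of_lt two_pos,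
      convLow_apply_zero, convDiff_apply_zero, convDiag_modeProj_apply_zero, u0, u1, s0,
      profileMul_sechPow, solOp_apply, lowProj_apply_of_lt two_pos,
      profileMul_comm (modeOp 0 (f' 0))] at h1
    rw [h1]
    module
  have f'1 : f' 1 = (2 : ℝ) • profileMul (sechPow 2) (modeOp 0 (f' 0))
      + ε • profileMul (sechPow 2) (u 2) - γ' • sechPow 2 := by
    have h1 : f' 1 = _ := congr($hf' 1)
    simp only [SeqL1.add_apply, SeqL1.sub_apply, SeqL1.smul_apply, convSum_apply_of_lt one_lt_two,
      convLow_apply_pos one_ne_zero, convDiff_modeProj_apply_one, convDiag_apply_one, u0, u1, s0,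
      s1, solOp_apply, lowProj_apply_of_lt two_pos, lowProj_apply_of_lt one_lt_two, map_zero,
      zero_apply, profileMul_comm (modeOp 0 (f' 0)), profileMul_comm (modeOp 1 (f' 1))] at h1
    rw [h1]
    module
  -- The solvability condition holds along the whole branch, hence also for the derivative. It is
  -- the equation that determines γ'.
  have hpair : groundPairing (f' 1) = 0 := by
    have h1 := hasDerivAt_clm (groundPairing.comp (SeqL1.coord 1)) hf
    refine h1.unique ((hasDerivAt_const (0 : ℝ) (0 : ℝ)).congr_of_eventuallyEq ?_)
    have : ∀ᶠ t in 𝓝 (0 : ℝ), |t| < τ := by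
      have := continuous_abs.tendsto (0 : ℝ)
      exact this.eventually_lt_const hτ0
    filter_upwards [this] with t ht
    exact (Prod.mk_eq_zero.1 (h t ht).2.2.2).2
  have hq : groundPairing (profileMul (sechPow 2) (modeOp 0 (f' 0)))
      = 3 / 5 * γ' - 2 * ε ^ 2 / 63 := by
    have h2 : ∀ x, (sech x ^ 4 - 2 * sech x ^ 2) / 8 * (sech x * f' 0 x)
        = (-(6 * γ') / 8) * sech x ^ 6 - (-(6 * γ') / 4) * sech x ^ 4
          + ((ε ^ 2 / 16) * sech x ^ 10 - (ε ^ 2 / 8) * sech x ^ 8) := fun x => by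
      rw [f'0, BddFun.add_apply, BddFun.smul_apply, BddFun.smul_apply, sechPow_apply,
        sechPow_apply, smul_eq_mul, smul_eq_mul]
      ring
    have i : ∀ (c : ℝ) (n : ℕ), 1 ≤ n → Integrable (fun x => c * sech x ^ n)
        (volume.restrict (Set.Ioi (0 : ℝ))) := fun c n hn => (integrableOn_sech_pow hn).const_mul c
    rw [groundPairing_profileMul_modeOp]
    simp only [h2]
    rw [integral_sub_add_sub (i _ 6 (by norm_num)) (i _ 4 (by norm_num)) (i _ 10 (by norm_num))
      (i _ 8 (by norm_num))]
    simp only [integral_const_mul]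
    change _ * sechMoment 6 - _ * sechMoment 4 + (_ * sechMoment 10 - _ * sechMoment 8) = _
    rw [sechMoment_six, sechMoment_four, sechMoment_ten, sechMoment_eight]
    ring
  refine ⟨γ', hγ, ?_, ?_⟩
  -- The equation reads (2/3)γ' = 4ε²/63 - ε⟨sech³, sech² u_2⟩, products being those of profiles.
  -- The last term is at most (8/15)ε²/22 = 4ε²/165, and (3/2)(4/63 - 4/165) exceeds 1/27.
  · have h1 := congrArg groundPairing f'1
    simp only [hpair, map_add, map_sub, map_smul, hq, smul_eq_mul, groundPairing_sechPow] at h1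
    rw [sechMoment_six] at h1
    have h2 := (abs_le.1 (abs_groundPairing_profileMul_le (u 2))).2
    have h3 : ε * groundPairing (profileMul (sechPow 2) (u 2)) ≤ ε * (8 / 15 * (ε / 22)) := by
      refine mul_le_mul_of_nonneg_left (h2.trans ?_) hε.le
      linarith
    nlinarith [pow_pos hε 2]
  · have h1 := hasDerivAt_clm (solitonPairing.comp ((modeOp 0).comp (SeqL1.coord 0))) hf
    convert! h1 using 1
    change _ = solitonPairing (modeOp 0 (f' 0))
    have h2 : ∀ x, (x * sech x ^ 2 * Real.tanh x - sech x ^ 2) / 4 * (sech x * f' 0 x)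
        = (-(6 * γ') / 4) * (x * sech x ^ 4 * Real.tanh x) - (-(6 * γ') / 4) * sech x ^ 4
          + ((ε ^ 2 / 8) * (x * sech x ^ 8 * Real.tanh x) - (ε ^ 2 / 8) * sech x ^ 8) := fun x => by
      rw [f'0, BddFun.add_apply, BddFun.smul_apply, BddFun.smul_apply, sechPow_apply,
        sechPow_apply, smul_eq_mul, smul_eq_mul]
      ring
    have i : ∀ (c : ℝ) (n : ℕ), 1 ≤ n → Integrable (fun x => c * sech x ^ n)
        (volume.restrict (Set.Ioi (0 : ℝ))) := fun c n hn => (integrableOn_sech_pow hn).const_mul c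
    have i' : ∀ (c : ℝ) (n : ℕ), 2 ≤ n → Integrable (fun x => c * (x * sech x ^ n * Real.tanh x))
        (volume.restrict (Set.Ioi (0 : ℝ))) := fun c n hn =>
      (integrableOn_mul_sech_pow_mul_tanh hn).const_mul c
    rw [solitonPairing_apply, integral_sech_two_mul_modeOp]
    simp only [h2]
    rw [integral_sub_add_sub (i' _ 4 (by norm_num)) (i _ 4 (by norm_num)) (i' _ 8 (by norm_num))
      (i _ 8 (by norm_num))]
    simp only [integral_const_mul]
    have h4 := integral_mul_sech_pow_mul_tanh (n := 4) (by norm_num)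
    have h8 := integral_mul_sech_pow_mul_tanh (n := 8) (by norm_num)
    rw [sechMoment_four] at h4
    rw [sechMoment_eight] at h8
    push_cast at h4 h8
    change _ = _ - _ * sechMoment 4 + (_ - _ * sechMoment 8)
    rw [sechMoment_four, sechMoment_eight]
    linear_combination (6 * γ' / 16) * h4 - (ε ^ 2 / 64) * h8

/-! ### Evenness and the differential equations of the modes -/

/-- The reflection `g ↦ g(-·)`. -/
noncomputable def reflect : Profile →L[ℝ] Profile :=
  have hb : ∀ (g : Profile) z, |g (-z)| ≤ ‖g‖ := fun g z => g.norm_coe_le_norm (-z)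
  LinearMap.mkContinuous
    { toFun := fun g => BddFun.ofBound (fun z => g (-z)) (g.continuous.comp continuous_neg) ‖g‖ (hb g)
      map_add' := fun _ _ => rfl
      map_smul' := fun _ _ => rfl } 1 fun g => by
    rw [one_mul]; exact BddFun.norm_ofBound_le _ _ (norm_nonneg _) (hb g)

theorem reflect_apply (g : Profile) (z : ℝ) : reflect g z = g (-z) := rfl

theorem norm_reflect_le : ‖reflect‖ ≤ 1 := by
  unfold reflect
  exact LinearMap.mkContinuous_norm_le _ zero_le_one _

theorem reflect_profileMul (g h : Profile) :
    reflect (profileMul g h) = profileMul (reflect g) (reflect h) := by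
  ext z
  rw [reflect_apply, profileMul_apply, profileMul_apply, reflect_apply, reflect_apply, sech_neg]

/-- The reflection of all modes. -/
noncomputable def reflectSeq : ModeSeq →L[ℝ] ModeSeq :=
  SeqL1.diag (fun _ => reflect) 1 fun _ => norm_reflect_le

theorem reflectSeq_single (i : ℕ) (x : Profile) :
    reflectSeq (SeqL1.single i x) = SeqL1.single i (reflect x) := SeqL1.diag_single _ _ _ i x

theorem reflectSeq_apply (u : ModeSeq) (i : ℕ) : reflectSeq u i = reflect (u i) :=
  SeqL1.diag_apply _ _ _ u i

theorem reflectSeq_modeConv (S : Set (ℕ × ℕ)) (σ : ℕ → ℕ → ℕ) (u v : ModeSeq) :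
    reflectSeq (modeConv S σ u v) = modeConv S σ (reflectSeq u) (reflectSeq v) := by
  suffices h : (ContinuousLinearMap.compL ℝ ModeSeq ModeSeq ModeSeq reflectSeq).comp (modeConv S σ)
      = (((modeConv S σ).comp reflectSeq).flip.comp reflectSeq).flip from congr($h u v)
  refine SeqL1.clm_ext₂ fun i j x y => ?_
  change reflectSeq (modeConv S σ (SeqL1.single i x) (SeqL1.single j y))
    = modeConv S σ (reflectSeq (SeqL1.single i x)) (reflectSeq (SeqL1.single j y))
  rw [reflectSeq_single, reflectSeq_single]
  by_cases h : (i, j) ∈ S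
  · rw [modeConv_single_of_mem h, modeConv_single_of_mem h, reflectSeq_single, reflect_profileMul]
  · rw [modeConv_single_of_notMem h, modeConv_single_of_notMem h, map_zero]

theorem reflectSeq_damp {t : ℝ} (ht : |t| < 1 / 4) (u : ModeSeq) :
    reflectSeq (damp t u) = damp t (reflectSeq u) := by
  suffices h : reflectSeq.comp (damp t) = (damp t).comp reflectSeq from congr($h u)
  refine SeqL1.clm_ext fun i x => ?_
  rw [ContinuousLinearMap.comp_apply, ContinuousLinearMap.comp_apply, damp_single ht,
    reflectSeq_single, damp_single ht, map_smul, reflectSeq_single]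

theorem reflectSeq_modeBilin (ε : ℝ) {t : ℝ} (ht : |t| < 1 / 4) (u v : ModeSeq) :
    reflectSeq (modeBilin ε t u v) = modeBilin ε t (reflectSeq u) (reflectSeq v) := by
  simp only [modeBilin, map_add, map_smul, convLow, convSum, convDiff, convDiag,
    reflectSeq_modeConv, reflectSeq_damp ht]

theorem reflectSeq_solOp (f : ModeSeq) : reflectSeq (solOp f) = solOp f := by
  suffices h : reflectSeq.comp solOp = solOp from congr($h f)
  refine SeqL1.clm_ext fun i x => ?_
  rw [ContinuousLinearMap.comp_apply, solOp_single, reflectSeq_single]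
  congr 1
  ext z
  rw [reflect_apply, modeOp_neg]

theorem reflect_sechPow (n : ℕ) : reflect (sechPow n) = sechPow n := by
  ext z
  rw [reflect_apply, sechPow_apply, sechPow_apply, sech_neg]

theorem reflectSeq_solitonSeq : reflectSeq solitonSeq = solitonSeq := by
  rw [solitonSeq, reflectSeq_single, map_smul, reflect_sechPow]

theorem reflectSeq_baseSeq : reflectSeq baseSeq = baseSeq := by
  rw [baseSeq, map_add, reflectSeq_solitonSeq, groundSeq, reflectSeq_single, reflect_sechPow]

/-- The modes of the solution that belongs to the right hand sides `f`. -/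
noncomputable def modeSol (f : ModeSeq) : ModeSeq := baseSeq + solOp f

theorem reflectSeq_modeSol (f : ModeSeq) : reflectSeq (modeSol f) = modeSol f := by
  rw [modeSol, map_add, reflectSeq_baseSeq, reflectSeq_solOp]

theorem modeSol_neg (f : ModeSeq) (m : ℕ) (z : ℝ) : modeSol f m (-z) = modeSol f m z := by
  conv_rhs => rw [← reflectSeq_modeSol, reflectSeq_apply, reflect_apply]

/-- The modes `modeSol f` are even for every f, hence so is the right-hand side, and a solution f
inherits evenness from f = `modeRhs`. This replaces the source f(|z|) of the reflected Green
operators by f(z). -/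
theorem reflectSeq_modeRhs (ε : ℝ) {t : ℝ} (ht : |t| < 1 / 4) (f : ModeSeq) (γ : ℝ) :
    reflectSeq (modeRhs ε t f γ) = modeRhs ε t f γ := by
  have h : reflectSeq (baseSeq + solOp f) = baseSeq + solOp f := reflectSeq_modeSol f
  simp only [modeRhs, map_sub, map_smul, reflectSeq_modeBilin ε ht, h]
  rw [convLow, reflectSeq_modeConv, reflectSeq_modeConv, reflectSeq_baseSeq, reflectSeq_solitonSeq,
    reflectSeq_solOp]

/-- The profile function `sech ^ n · tanh`. -/
noncomputable def sechTanh (n : ℕ) : Profile :=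
  BddFun.ofBound (fun z => sech z ^ n * Real.tanh z) ((continuous_sech.pow n).mul continuous_tanh) 1
    (abs_sech_pow_mul_tanh_le n)

theorem sechTanh_apply (n : ℕ) (z : ℝ) : sechTanh n z = sech z ^ n * Real.tanh z := rfl

/-- The derivatives of the modes of the base point. -/
noncomputable def baseSeq' : ModeSeq :=
  SeqL1.single 0 ((-12 : ℝ) • sechTanh 1) + SeqL1.single 1 ((-3 : ℝ) • sechTanh 2)

theorem baseSeq'_zero : baseSeq' 0 = (-12 : ℝ) • sechTanh 1 := by
  rw [baseSeq', SeqL1.add_apply, SeqL1.single_apply_self, SeqL1.single_apply_ne zero_ne_one,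
    add_zero]

theorem baseSeq'_one : baseSeq' 1 = (-3 : ℝ) • sechTanh 2 := by
  rw [baseSeq', SeqL1.add_apply, SeqL1.single_apply_self, SeqL1.single_apply_ne one_ne_zero,
    zero_add]

theorem baseSeq'_of_two_le {m : ℕ} (h : 2 ≤ m) : baseSeq' m = 0 := by
  rw [baseSeq', SeqL1.add_apply, SeqL1.single_apply_ne (by omega), SeqL1.single_apply_ne (by omega),
    zero_add]

/-- The derivatives of the modes given by `modeSol`. -/
noncomputable def modeSol' (f : ModeSeq) : ModeSeq := baseSeq' + solOp' f

theorem hasDerivAt_baseSeq (m : ℕ) (z : ℝ) :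
    HasDerivAt (fun z => sech z * baseSeq m z) (sech z * baseSeq' m z) z := by
  match m with
  | 0 =>
    rw [baseSeq_zero, baseSeq'_zero]
    simp only [BddFun.smul_apply, sechPow_apply, sechTanh_apply, smul_eq_mul]
    convert! (hasDerivAt_sech_pow 2 z).const_mul 6 using 1
    · funext z; ring
    · push_cast; ring
  | 1 =>
    rw [baseSeq_one, baseSeq'_one]
    simp only [BddFun.smul_apply, sechPow_apply, sechTanh_apply, smul_eq_mul]
    convert! hasDerivAt_sech_pow 3 z using 1
    · funext z; ring
    · push_cast; ring
  | m + 2 =>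
    rw [baseSeq_of_two_le (by omega), baseSeq'_of_two_le (by omega)]
    simpa only [BddFun.zero_apply, mul_zero] using hasDerivAt_const z (0 : ℝ)

/-- The two entries are the soliton equation for 6 sech² and the statement that sech³ lies in the
kernel of -∂² + 9 - 12 sech². -/
theorem hasDerivAt_baseSeq' (m : ℕ) (z : ℝ) :
    HasDerivAt (fun z => sech z * baseSeq' m z)
      ((4 + 5 * m ^ 2) * (sech z * baseSeq m z) - sech z * convLow baseSeq baseSeq m z) z := by
  have ht := tanh_sq z
  match m with
  | 0 =>
    rw [convLow_apply_zero, baseSeq_zero, baseSeq'_zero, profileMul_apply]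
    simp only [BddFun.smul_apply, sechPow_apply, sechTanh_apply, smul_eq_mul]
    convert! ((hasDerivAt_sech_pow 2 z).mul (hasDerivAt_tanh z)).const_mul (-12) using 1
    · funext z; simp only [Pi.mul_apply]; ring
    · push_cast; linear_combination (-24 * sech z ^ 2) * ht
  | 1 =>
    rw [convLow_apply_pos one_ne_zero, baseSeq_zero, baseSeq_one, baseSeq'_one, BddFun.add_apply,
      profileMul_apply, profileMul_apply]
    simp only [BddFun.smul_apply, sechPow_apply, sechTanh_apply, smul_eq_mul]
    convert! ((hasDerivAt_sech_pow 3 z).mul (hasDerivAt_tanh z)).const_mul (-3) using 1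
    · funext z; simp only [Pi.mul_apply]; ring
    · push_cast; linear_combination (-9 * sech z ^ 3) * ht
  | m + 2 =>
    have h0 : convLow baseSeq baseSeq (m + 2) = 0 := by
      have hb : baseSeq (m + 2) = 0 := baseSeq_of_two_le (by omega)
      rw [convLow_apply_pos (by omega), hb, map_zero, map_zero, zero_add]
      rfl
    rw [h0, baseSeq_of_two_le (by omega), baseSeq'_of_two_le (by omega)]
    simpa only [BddFun.zero_apply, mul_zero, sub_zero] using hasDerivAt_const z (0 : ℝ)

theorem hasDerivAt_modeSol {f : ModeSeq} (hf : groundPairing (f 1) = 0) (m : ℕ) (z : ℝ) :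
    HasDerivAt (fun z => sech z * modeSol f m z) (sech z * modeSol' f m z) z := by
  have h1 := hasDerivAt_modeOp m (g := f m) (fun h => by rw [h]; exact hf) z
  rw [← solOp_apply, ← solOp'_apply] at h1
  convert! (hasDerivAt_baseSeq m z).add h1 using 1
  · funext z
    exact mul_add _ _ _
  · exact mul_add _ _ _

/-- The equations of `baseSeq` and of the Green operators add up. The source f is replaced by
`modeRhs`, and its two subtracted terms cancel the source of `baseSeq` and the potential absorbed in
the modes 0 and 1. -/
theorem hasDerivAt_modeSol' {ε t γ : ℝ} {f : ModeSeq} (ht : |t| < 1 / 4)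
    (h : modeSystem ((ε, t), (f, γ)) = 0) (m : ℕ) (z : ℝ) :
    HasDerivAt (fun z => sech z * modeSol' f m z)
      ((4 + γ + 5 * m ^ 2) * (sech z * modeSol f m z)
        - sech z * modeBilin ε t (modeSol f) (modeSol f) m z) z := by
  have hf1 : groundPairing (f 1) = 0 := (Prod.mk_eq_zero.1 h).2
  have hf : f = modeRhs ε t f γ := sub_eq_zero.1 (Prod.mk_eq_zero.1 h).1
  have hev : f m |z| = f m z := by
    have h1 : reflectSeq f = f := by
      conv_lhs => rw [hf, reflectSeq_modeRhs ε ht, ← hf]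
    rcases abs_choice z with hz | hz
    · rw [hz]
    · rw [hz]
      conv_rhs => rw [← h1, reflectSeq_apply, reflect_apply]
  have h1 := hasDerivAt_modeOp' m (g := f m) (fun h => by rw [h]; exact hf1) z
  have h2 : f m z = modeBilin ε t (modeSol f) (modeSol f) m z - γ * modeSol f m z
      - convLow baseSeq baseSeq m z - 2 * convLow solitonSeq (solOp (lowProj f)) m z := by
    conv_lhs => rw [hf]
    rfl
  have h3 : 2 * convLow solitonSeq (solOp (lowProj f)) m z
      = modePotential m z * modeOp m (f m) z := by
    have s0 : solitonSeq 0 = (6 : ℝ) • sechPow 1 := SeqL1.single_apply_self _ _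
    match m with
    | 0 =>
      rw [convLow_apply_zero, s0, solOp_apply, lowProj_apply_of_lt two_pos, profileMul_apply,
        BddFun.smul_apply, sechPow_apply, modePotential, if_pos two_pos, smul_eq_mul]
      ring
    | 1 =>
      have s1 : solitonSeq 1 = 0 := SeqL1.single_apply_ne one_ne_zero _
      rw [convLow_apply_pos one_ne_zero, s0, s1, map_zero, zero_apply, add_zero, solOp_apply,
        lowProj_apply_of_lt one_lt_two, profileMul_apply, BddFun.smul_apply, sechPow_apply,
        modePotential, if_pos one_lt_two, smul_eq_mul]
      ring
    | m + 2 =>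
      have s2 : solitonSeq (m + 2) = 0 := SeqL1.single_apply_ne (by omega) _
      have l2 : lowProj f (m + 2) = 0 := by
        change (SeqL1.single 0 (f 0) : ModeSeq) (m + 2) + (SeqL1.single 1 (f 1) : ModeSeq) (m + 2) = 0
        rw [SeqL1.single_apply_ne (by omega), SeqL1.single_apply_ne (by omega), zero_add]
      rw [convLow_apply_pos (by omega), s2, map_zero, zero_apply, add_zero, solOp_apply, l2,
        map_zero, map_zero, modePotential, if_neg (by omega), zero_mul, BddFun.zero_apply, mul_zero]
  convert! (hasDerivAt_baseSeq' m z).add h1 using 1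
  · funext z
    rw [← solOp'_apply]
    exact mul_add _ _ _
  · have h4 : modeSol f m z = baseSeq m z + modeOp m (f m) z := by
      rw [← solOp_apply]; rfl
    rw [hev, h2]
    rw [h4] at *
    linear_combination (-sech z) * h3

/-! ### Synthesis of the modes on the cylinder -/

section Wave

variable (L : ℝ) (n : ℤ)

/-- The character `y ↦ exp(-i n y / L)` of the circle. -/
noncomputable def circleWave (y : AddCircle (2 * Real.pi * L)) : ℂ :=
  (cosMode L n y : ℂ) - sinMode L n y * Complex.I

/-- The wave number `n / L`. -/
noncomputable def waveNumber : ℝ := n / L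

theorem cosMode_coe (y : ℝ) : cosMode L n (y : AddCircle (2 * Real.pi * L)) = Real.cos (n * y / L) :=
  (periodic_cos_mode L n).lift_coe y

theorem sinMode_coe (y : ℝ) : sinMode L n (y : AddCircle (2 * Real.pi * L)) = Real.sin (n * y / L) :=
  (periodic_sin_mode L n).lift_coe y

theorem circleWave_coe (y : ℝ) : circleWave L n (y : AddCircle (2 * Real.pi * L))
    = Complex.exp (-(waveNumber L n * y) * Complex.I) := by
  rw [circleWave, cosMode_coe, sinMode_coe, Complex.exp_mul_I, Complex.cos_neg, Complex.sin_neg,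
    waveNumber, show (n : ℝ) * y / L = n / L * y by ring]
  push_cast
  ring

theorem norm_circleWave (y : AddCircle (2 * Real.pi * L)) : ‖circleWave L n y‖ = 1 := by
  induction y using QuotientAddGroup.induction_on with
  | H y =>
    rw [circleWave_coe, ← Complex.ofReal_mul, ← Complex.ofReal_neg, Complex.norm_exp_ofReal_mul_I]

theorem continuous_circleWave : Continuous (circleWave L n) := by
  refine (QuotientAddGroup.isQuotientMap_mk (N := AddSubgroup.zmultiples (2 * Real.pi * L))).continuous_iff.2 ?_
  have : (circleWave L n) ∘ QuotientAddGroup.mk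
      = fun y : ℝ => Complex.exp (-(waveNumber L n * y) * Complex.I) :=
    funext (circleWave_coe L n)
  rw [this]
  fun_prop

theorem hasDerivAt_circleWave_pow (m : ℕ) (y : ℝ) :
    HasDerivAt (fun y : ℝ => circleWave L n (y : AddCircle (2 * Real.pi * L)) ^ m)
      (-(m * waveNumber L n) * Complex.I * circleWave L n (y : AddCircle (2 * Real.pi * L)) ^ m) y := by
  simp only [circleWave_coe, ← Complex.exp_nat_mul]
  have h1 : HasDerivAt (fun y : ℝ => (y : ℂ)) 1 y := Complex.ofRealCLM.hasDerivAt
  have h2 := ((h1.const_mul (waveNumber L n : ℂ)).neg.mul_const Complex.I).const_mul (m : ℂ)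
  convert! h2.cexp using 1
  simp only [Pi.neg_apply]
  ring

end Wave

/-- The amplitude of the mode `m`. -/
noncomputable def modeAmp (ε : ℝ) (m : ℕ) : ℝ := if m = 0 then 1 else ε

theorem modeAmp_zero (ε : ℝ) : modeAmp ε 0 = 1 := if_pos rfl

theorem modeAmp_of_ne {ε : ℝ} {m : ℕ} (h : m ≠ 0) : modeAmp ε m = ε := if_neg h

theorem abs_modeAmp_le (ε : ℝ) (m : ℕ) : |modeAmp ε m| ≤ 1 + |ε| := by
  rw [modeAmp]
  split_ifs
  · rw [abs_one]; linarith [abs_nonneg ε]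
  · linarith

/-! ### Summing the modes as a power series in the complex amplitude. -/

section Synth

variable (L : ℝ) (n : ℤ) (σ ε : ℝ)

/-- The factor of the `j`-th derivative of the mode `m`. -/
noncomputable def waveFactor (j m : ℕ) : ℂ := (-(m * waveNumber L n) * Complex.I) ^ j

theorem norm_waveFactor (j m : ℕ) : ‖waveFactor L n j m‖ = (m * |waveNumber L n|) ^ j := by
  rw [waveFactor, norm_pow, norm_mul, norm_neg, norm_mul, Complex.norm_I, Complex.norm_natCast,
    Complex.norm_real, Real.norm_eq_abs, mul_one]

theorem waveFactor_zero (m : ℕ) : waveFactor L n 0 m = 1 := pow_zero _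

theorem waveFactor_two (m : ℕ) : waveFactor L n 2 m = (-(m * waveNumber L n) ^ 2 : ℝ) := by
  rw [waveFactor, mul_pow, Complex.I_sq]
  push_cast
  ring

theorem abs_waveTerm_le (j m : ℕ) (q : ℂ) (u : ModeSeq) (p : Cyl L) :
    |modeAmp ε m * u m (σ * p.1) * (waveFactor L n j m * (q * circleWave L n p.2 ^ m)).re|
      ≤ (1 + |ε|) * (m * |waveNumber L n|) ^ j * ‖q‖ * ‖u m‖ := by
  have h1 := abs_modeAmp_le ε m
  have h2 := (u m).norm_coe_le_norm (σ * p.1)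
  have h4 := Complex.abs_re_le_norm (waveFactor L n j m * (q * circleWave L n p.2 ^ m))
  rw [norm_mul, norm_mul, norm_pow, norm_circleWave, one_pow, mul_one, norm_waveFactor] at h4
  rw [Real.norm_eq_abs] at h2
  rw [abs_mul, abs_mul]
  calc |modeAmp ε m| * |u m (σ * p.1)| * |(waveFactor L n j m * (q * circleWave L n p.2 ^ m)).re|
      ≤ (1 + |ε|) * ‖u m‖ * ((m * |waveNumber L n|) ^ j * ‖q‖) := by
        gcongr
    _ = _ := by ring

theorem abs_waveTerm_le' (j m : ℕ) (q : ℂ) (u : ModeSeq) (p : Cyl L) :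
    |modeAmp ε m * u m (σ * p.1) * (waveFactor L n j m * (q * circleWave L n p.2 ^ m)).re|
      ≤ (1 + |ε|) * (m * |waveNumber L n|) ^ j * ‖q‖ * ‖u‖ :=
  (abs_waveTerm_le L n σ ε j m q u p).trans
    (mul_le_mul_of_nonneg_left (u.norm_apply_le m) (by positivity))

/-- The contribution of the mode `m` to the synthesis of the `j`-th derivative in `y`. -/
noncomputable def synthCoeff (j m : ℕ) : ℂ →L[ℝ] ModeSeq →L[ℝ] BddFun (Cyl L) :=
  LinearMap.mkContinuous₂
    (LinearMap.mk₂ ℝ (fun q u => BddFun.ofBound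
        (fun p : Cyl L => modeAmp ε m * u m (σ * p.1)
          * (waveFactor L n j m * (q * circleWave L n p.2 ^ m)).re)
        ((continuous_const.mul ((u m).continuous.comp (continuous_const.mul continuous_fst))).mul
          (Complex.continuous_re.comp (continuous_const.mul (continuous_const.mul
            (((continuous_circleWave L n).comp continuous_snd).pow m))))) _
        (abs_waveTerm_le' L n σ ε j m q u))
      (fun q q' u => by
        ext p
        simp only [BddFun.ofBound_apply, BddFun.add_apply, add_mul, mul_add, Complex.add_re])
      (fun c q u => by
        ext p
        simp only [BddFun.ofBound_apply, BddFun.smul_apply, smul_eq_mul, Complex.real_smul]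
        rw [mul_assoc (c : ℂ), mul_left_comm _ (c : ℂ), Complex.re_ofReal_mul]
        ring)
      (fun q u v => by
        ext p
        simp only [BddFun.ofBound_apply, BddFun.add_apply, SeqL1.add_apply]
        ring)
      (fun c q u => by
        ext p
        simp only [BddFun.ofBound_apply, BddFun.smul_apply, SeqL1.smul_apply, smul_eq_mul]
        ring))
    ((1 + |ε|) * (m * |waveNumber L n|) ^ j) fun q u =>
      BddFun.norm_ofBound_le _ _ (by positivity) (abs_waveTerm_le' L n σ ε j m q u)

theorem synthCoeff_apply (j m : ℕ) (q : ℂ) (u : ModeSeq) (p : Cyl L) :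
    synthCoeff L n σ ε j m q u p = modeAmp ε m * u m (σ * p.1)
      * (waveFactor L n j m * (q * circleWave L n p.2 ^ m)).re := rfl

/-- This limits the synthesis to two derivatives in y on the disc of radius 1/4: each derivative
costs a factor m, and m² ≤ 4^m. -/
theorem pow_le_four_pow {j : ℕ} (hj : j ≤ 2) (m : ℕ) : (m : ℝ) ^ j ≤ 4 ^ m := by
  have h1 : (m : ℝ) ≤ 2 ^ m := by exact_mod_cast m.lt_two_pow_self.le
  have h2 : (1 : ℝ) ≤ 2 ^ m := one_le_pow₀ one_le_two
  calc (m : ℝ) ^ j ≤ (2 ^ m) ^ j := pow_le_pow_left₀ (by positivity) h1 j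
    _ ≤ (2 ^ m) ^ 2 := pow_le_pow_right₀ h2 hj
    _ = 4 ^ m := by rw [← pow_mul, mul_comm, pow_mul]; norm_num

theorem mul_waveNumber_pow_le {j : ℕ} (hj : j ≤ 2) (m : ℕ) :
    (1 + |ε|) * (m * |waveNumber L n|) ^ j ≤ (1 + |ε|) * |waveNumber L n| ^ j * 4 ^ m := by
  rw [mul_pow, mul_assoc, mul_comm ((m : ℝ) ^ j)]
  have := pow_le_four_pow hj m
  gcongr

theorem norm_synthCoeff_le {j : ℕ} (hj : j ≤ 2) (m : ℕ) :
    ‖synthCoeff L n σ ε j m‖ ≤ (1 + |ε|) * |waveNumber L n| ^ j * 4 ^ m := by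
  refine (LinearMap.mkContinuous₂_norm_le _ (by positivity) _).trans ?_
  exact mul_waveNumber_pow_le L n ε hj m

/-- The synthesis of the `j`-th derivative in `y` of the function with modes `u`, up to the factor
`sech (σ x)`: the sum of `ε_m u_m(σ x) Re ((w exp(-i n y / L))^m)`. -/
noncomputable def synth (j : ℕ) (w : ℂ) : ModeSeq →L[ℝ] BddFun (Cyl L) :=
  opSum (synthCoeff L n σ ε j) w

theorem contDiffAt_synth {j : ℕ} (hj : j ≤ 2) {w : ℂ} (hw : ‖w‖ < 1 / 4) {k : ℕ∞ω} :
    ContDiffAt ℝ k (synth L n σ ε j) w :=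
  contDiffAt_opSum (norm_synthCoeff_le L n σ ε hj) hw

/-- The angular factor of the mode `m` in the synthesis. -/
noncomputable def synthFactor (j m : ℕ) (w : ℂ) (y : AddCircle (2 * Real.pi * L)) : ℝ :=
  modeAmp ε m * (waveFactor L n j m * (w * circleWave L n y) ^ m).re

theorem hasSum_synth {j : ℕ} (hj : j ≤ 2) {w : ℂ} (hw : ‖w‖ < 1 / 4) (u : ModeSeq) (p : Cyl L) :
    HasSum (fun m => synthFactor L n ε j m w p.2 * u m (σ * p.1)) (synth L n σ ε j w u p) := by
  have h := (hasSum_opSum (norm_synthCoeff_le L n σ ε hj) hw).mapL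
    ((BddFun.eval p).comp (ContinuousLinearMap.apply ℝ (BddFun (Cyl L)) u))
  convert! h using 1
  funext m
  change _ = synthCoeff L n σ ε j m (w ^ m) u p
  rw [synthCoeff_apply, synthFactor, mul_pow]
  ring

theorem synth_single {j : ℕ} (hj : j ≤ 2) {w : ℂ} (hw : ‖w‖ < 1 / 4) (i : ℕ) (g : Profile)
    (p : Cyl L) :
    synth L n σ ε j w (SeqL1.single i g) p = synthFactor L n ε j i w p.2 * g (σ * p.1) := by
  refine (hasSum_synth L n σ ε hj hw _ p).unique ?_
  have h := hasSum_single (f := fun m =>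
    synthFactor L n ε j m w p.2 * (SeqL1.single i g : ModeSeq) m (σ * p.1)) i fun m hm => by
      rw [SeqL1.single_apply_ne hm, BddFun.zero_apply, mul_zero]
  rwa [SeqL1.single_apply_self] at h

theorem abs_synthFactor_le {j : ℕ} (hj : j ≤ 2) (m : ℕ) {w : ℂ} (hw : ‖w‖ < 1 / 4)
    (y : AddCircle (2 * Real.pi * L)) :
    |synthFactor L n ε j m w y| ≤ (1 + |ε|) * |waveNumber L n| ^ j := by
  have h4 := Complex.abs_re_le_norm (waveFactor L n j m * (w * circleWave L n y) ^ m)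
  rw [norm_mul, norm_pow, norm_mul, norm_circleWave, mul_one, norm_waveFactor] at h4
  have h5 : ‖w‖ ^ m ≤ (1 / 4) ^ m := pow_le_pow_left₀ (norm_nonneg w) hw.le m
  rw [synthFactor, abs_mul]
  calc |modeAmp ε m| * |(waveFactor L n j m * (w * circleWave L n y) ^ m).re|
      ≤ (1 + |ε|) * ((m * |waveNumber L n|) ^ j * (1 / 4) ^ m) := by
        have := abs_modeAmp_le ε m
        gcongr
        exact h4.trans (by gcongr)
    _ = (1 + |ε|) * (m * |waveNumber L n|) ^ j * (1 / 4) ^ m := by ring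
    _ ≤ (1 + |ε|) * |waveNumber L n| ^ j * 4 ^ m * (1 / 4) ^ m := by
        have := mul_waveNumber_pow_le L n ε hj m
        gcongr
    _ = _ := by rw [mul_assoc, ← mul_pow]; norm_num

theorem hasDerivAt_synthFactor (j m : ℕ) (w : ℂ) (y : ℝ) :
    HasDerivAt (fun y : ℝ => synthFactor L n ε j m w y) (synthFactor L n ε (j + 1) m w y) y := by
  have h1 := ((hasDerivAt_circleWave_pow L n m y).const_mul (waveFactor L n j m * w ^ m))
  have h2 := (Complex.reCLM.hasFDerivAt.comp_hasDerivAt y h1).const_mul (modeAmp ε m)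
  convert! h2 using 1
  · funext y
    simp only [synthFactor, Function.comp, Complex.reCLM_apply, mul_pow, mul_assoc]
  · simp only [synthFactor, waveFactor, pow_succ, Complex.reCLM_apply, mul_pow]
    congr 2
    ring

/-- The derivative in `y` of the synthesis. -/
theorem hasDerivAt_synth_snd {j : ℕ} (hj : j + 1 ≤ 2) {w : ℂ} (hw : ‖w‖ < 1 / 4) (u : ModeSeq)
    (x y : ℝ) :
    HasDerivAt (fun y : ℝ => synth L n σ ε j w u (x, (y : AddCircle (2 * Real.pi * L))))
      (synth L n σ ε (j + 1) w u (x, (y : AddCircle (2 * Real.pi * L)))) y := by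
  have h := hasDerivAt_tsum (𝕜 := ℝ)
    (g := fun m (y : ℝ) => synthFactor L n ε j m w y * u m (σ * x))
    (g' := fun m (y : ℝ) => synthFactor L n ε (j + 1) m w y * u m (σ * x))
    (u := fun m => (1 + |ε|) * |waveNumber L n| ^ (j + 1) * ‖u m‖)
    (u.hasSum_norm.summable.mul_left _)
    (fun m y => (hasDerivAt_synthFactor L n ε j m w y).mul_const _)
    (fun m y => by
      rw [norm_mul]
      exact mul_le_mul (abs_synthFactor_le L n ε hj m hw y) ((u m).norm_coe_le_norm _)
        (norm_nonneg _) (by positivity))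
    (y₀ := y) (hasSum_synth L n σ ε (by omega) hw u (x, (y : AddCircle (2 * Real.pi * L)))).summable y
  convert! h using 1
  · funext y
    exact (hasSum_synth L n σ ε (by omega) hw u (x, (y : AddCircle (2 * Real.pi * L)))).tsum_eq.symm
  · exact (hasSum_synth L n σ ε hj hw u (x, (y : AddCircle (2 * Real.pi * L)))).tsum_eq.symm

/-- The derivative in `x` of the synthesis, if the modes `v` are the derivatives of `u`. -/
theorem hasDerivAt_synth_fst {w : ℂ} (hw : ‖w‖ < 1 / 4) {u v : ModeSeq}
    (huv : ∀ m z, HasDerivAt (fun z => sech z * u m z) (sech z * v m z) z) (x : ℝ)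
    (y : AddCircle (2 * Real.pi * L)) :
    HasDerivAt (fun x : ℝ => sech (σ * x) * synth L n σ ε 0 w u (x, y))
      (σ * (sech (σ * x) * synth L n σ ε 0 w v (x, y))) x := by
  have hs : ∀ (u : ModeSeq) x, HasSum (fun m => synthFactor L n ε 0 m w y * (sech (σ * x) * u m (σ * x)))
      (sech (σ * x) * synth L n σ ε 0 w u (x, y)) := fun u x => by
    convert! (hasSum_synth L n σ ε zero_le_two hw u (x, y)).mul_left (sech (σ * x)) using 1
    funext m
    ring
  have h := hasDerivAt_tsum (𝕜 := ℝ)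
    (g := fun m x => synthFactor L n ε 0 m w y * (sech (σ * x) * u m (σ * x)))
    (g' := fun m x => synthFactor L n ε 0 m w y * (sech (σ * x) * v m (σ * x) * σ))
    (u := fun m => (1 + |ε|) * |waveNumber L n| ^ 0 * (1 * ‖v m‖ * |σ|))
    (((v.hasSum_norm.summable.mul_left _).mul_right _).mul_left _)
    (fun m x => by
      have h1 : HasDerivAt (fun x => σ * x) σ x := by simpa using (hasDerivAt_id x).const_mul σ
      exact ((huv m (σ * x)).comp x h1).const_mul _)
    (fun m x => by
      rw [norm_mul, norm_mul, norm_mul, Real.norm_eq_abs (sech _), abs_of_pos (sech_pos _)]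
      have h1 := abs_synthFactor_le L n ε zero_le_two m hw y
      have h2 := (v m).norm_coe_le_norm (σ * x)
      have h3 := sech_le_one (σ * x)
      have h4 := (sech_pos (σ * x)).le
      rw [← Real.norm_eq_abs] at h1
      simp only [← Real.norm_eq_abs σ]
      gcongr)
    (y₀ := x) (hs u x).summable x
  convert! h using 1
  · funext x
    exact (hs u x).tsum_eq.symm
  · rw [← (hs v x).tsum_eq, ← tsum_mul_left]
    congr 1
    funext m
    ring

end Synth

/-! ### The solution on the cylinder -/

/-- The quadratic term of the mode system as a bilinear operator. -/
noncomputable def modeBilinOp (ε t : ℝ) : ModeSeq →L[ℝ] ModeSeq →L[ℝ] ModeSeq :=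
  convLow + (ε / 2) • convSum
    + (ε / 2) • (convDiff.comp (damp t) + (convDiff.comp (damp t)).flip)
    + (ε ^ 2 / 2) • convDiag.comp (damp t)

/-- The product formula for cosines with complex amplitudes. The factor |q|^{2i} in front of the
difference mode is all that remains of the amplitude once q^m has been factored out of mode m, and
it is the source of `damp`. -/
theorem two_mul_re_pow_mul_re_pow (q : ℂ) (i d : ℕ) :
    2 * ((q ^ i).re * (q ^ (i + d)).re) = (q ^ (i + (i + d))).re + (‖q‖ ^ 2) ^ i * (q ^ d).re := by
  have h1 : (‖q‖ ^ 2) ^ i = Complex.normSq (q ^ i) := by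
    rw [map_pow, Complex.normSq_eq_norm_sq]
  rw [h1, pow_add q i (i + d), pow_add q i d, Complex.normSq_apply]
  simp only [Complex.mul_re, Complex.mul_im]
  ring

section

variable (L : ℝ) (n : ℤ) (σ ε : ℝ)

theorem synthFactor_zero_eq (m : ℕ) (w : ℂ) (y : AddCircle (2 * Real.pi * L)) :
    synthFactor L n ε 0 m w y = modeAmp ε m * ((w * circleWave L n y) ^ m).re := by
  rw [synthFactor, waveFactor_zero, one_mul]

/-- The quadratic term of the mode system corresponds to the product of functions. -/
theorem synth_modeBilin {w : ℂ} (hw : ‖w‖ < 1 / 4) (u v : ModeSeq) (p : Cyl L) :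
    synth L n σ ε 0 w (modeBilin ε (‖w‖ ^ 2) u v) p
      = sech (σ * p.1) * (synth L n σ ε 0 w u p * synth L n σ ε 0 w v p) := by
  let ℓ : ModeSeq →L[ℝ] ℝ := (BddFun.eval p).comp (synth L n σ ε 0 w)
  have ht : |‖w‖ ^ 2| < 1 / 4 := by
    rw [abs_of_nonneg (by positivity)]
    nlinarith [norm_nonneg w]
  have hl : ∀ i g, ℓ (SeqL1.single i g)
      = modeAmp ε i * ((w * circleWave L n p.2) ^ i).re * g (σ * p.1) := fun i g => by
    rw [← synthFactor_zero_eq]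
    exact synth_single L n σ ε zero_le_two hw i g p
  have hn : ‖w * circleWave L n p.2‖ = ‖w‖ := by rw [norm_mul, norm_circleWave, mul_one]
  suffices h : (ContinuousLinearMap.compL ℝ ModeSeq ModeSeq ℝ ℓ).comp (modeBilinOp ε (‖w‖ ^ 2))
      = sech (σ * p.1) • ℓ.smulRight ℓ from congr($h u v)
  refine SeqL1.clm_ext₂ fun i j x y => ?_
  change ℓ (modeBilin ε (‖w‖ ^ 2) (SeqL1.single i x) (SeqL1.single j y))
    = sech (σ * p.1) * (ℓ (SeqL1.single i x) * ℓ (SeqL1.single j y))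
  have hlow : ∀ i j x y, i = 0 ∨ j = 0 → convLow (SeqL1.single i x) (SeqL1.single j y)
      = SeqL1.single (i + j) (profileMul x y) := fun i j x y h => modeConv_single_of_mem h x y
  have hlow' : ∀ i j x y, ¬ (i = 0 ∨ j = 0) → convLow (SeqL1.single i x) (SeqL1.single j y) = 0 :=
    fun i j x y h => modeConv_single_of_notMem h x y
  have hsum : ∀ i j x y, 1 ≤ i ∧ 1 ≤ j → convSum (SeqL1.single i x) (SeqL1.single j y)
      = SeqL1.single (i + j) (profileMul x y) := fun i j x y h => modeConv_single_of_mem h x y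
  have hsum' : ∀ i j x y, ¬ (1 ≤ i ∧ 1 ≤ j) → convSum (SeqL1.single i x) (SeqL1.single j y) = 0 :=
    fun i j x y h => modeConv_single_of_notMem h x y
  have hdif : ∀ i j x y, 1 ≤ i ∧ i < j → convDiff (SeqL1.single i x) (SeqL1.single j y)
      = SeqL1.single (j - i) (profileMul x y) := fun i j x y h => modeConv_single_of_mem h x y
  have hdif' : ∀ i j x y, ¬ (1 ≤ i ∧ i < j) → convDiff (SeqL1.single i x) (SeqL1.single j y) = 0 :=
    fun i j x y h => modeConv_single_of_notMem h x y
  have hdia : ∀ i j x y, 1 ≤ i ∧ i = j → convDiag (SeqL1.single i x) (SeqL1.single j y)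
      = SeqL1.single 0 (profileMul x y) := fun i j x y h => modeConv_single_of_mem h x y
  have hdia' : ∀ i j x y, ¬ (1 ≤ i ∧ i = j) → convDiag (SeqL1.single i x) (SeqL1.single j y) = 0 :=
    fun i j x y h => modeConv_single_of_notMem h x y
  have key := two_mul_re_pow_mul_re_pow (w * circleWave L n p.2)
  rw [hn] at key
  simp only [modeBilin, damp_single ht, map_smul, smul_apply, map_add]
  by_cases h0 : i = 0 ∨ j = 0
  · rw [hlow _ _ _ _ h0, hsum' _ _ _ _ (by omega), hdif' _ _ _ _ (by omega),
      hdif' _ _ _ _ (by omega), hdia' _ _ _ _ (by omega)]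
    simp only [hl, map_zero, smul_zero, add_zero, profileMul_apply]
    rcases h0 with rfl | rfl
    · simp only [zero_add, modeAmp_zero, pow_zero, Complex.one_re]
      ring
    · simp only [add_zero, modeAmp_zero, pow_zero, Complex.one_re]
      ring
  · rw [hlow' _ _ _ _ h0, hsum _ _ _ _ (by omega)]
    rcases lt_trichotomy i j with hij | rfl | hij
    · rw [hdif _ _ _ _ (by omega), hdif' _ _ _ _ (by omega), hdia' _ _ _ _ (by omega)]
      obtain ⟨d, rfl⟩ := Nat.exists_eq_add_of_lt hij
      have := key i (d + 1)
      rw [show i + d + 1 - i = d + 1 by omega]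
      simp only [hl, map_zero, zero_add, profileMul_apply, smul_eq_mul,
        modeAmp_of_ne (show i + (i + d + 1) ≠ 0 by omega), modeAmp_of_ne (show d + 1 ≠ 0 by omega),
        modeAmp_of_ne (show i + d + 1 ≠ 0 by omega), modeAmp_of_ne (show i ≠ 0 by omega)]
      rw [← add_assoc i d 1] at this
      linear_combination (-(ε ^ 2 / 2) * sech (σ * p.1) * x (σ * p.1) * y (σ * p.1)) * this
    · rw [hdif' i i x y (by omega), hdif' i i y x (by omega), hdia _ _ _ _ (by omega)]
      have := key i 0
      simp only [hl, map_zero, zero_add, profileMul_apply, smul_eq_mul,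
        modeAmp_of_ne (show i + i ≠ 0 by omega), modeAmp_zero, modeAmp_of_ne (show i ≠ 0 by omega)]
      simp only [add_zero] at this
      linear_combination (-(ε ^ 2 / 2) * sech (σ * p.1) * x (σ * p.1) * y (σ * p.1)) * this
    · rw [hdif' _ _ _ _ (by omega), hdif _ _ _ _ (by omega), hdia' _ _ _ _ (by omega)]
      obtain ⟨d, rfl⟩ := Nat.exists_eq_add_of_lt hij
      have := key j (d + 1)
      rw [show j + d + 1 - j = d + 1 by omega, add_comm (j + d + 1) j]
      simp only [hl, map_zero, zero_add, profileMul_apply, smul_eq_mul,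
        modeAmp_of_ne (show j + (j + d + 1) ≠ 0 by omega), modeAmp_of_ne (show d + 1 ≠ 0 by omega),
        modeAmp_of_ne (show j + d + 1 ≠ 0 by omega), modeAmp_of_ne (show j ≠ 0 by omega)]
      rw [← add_assoc j d 1] at this
      linear_combination (-(ε ^ 2 / 2) * sech (σ * p.1) * x (σ * p.1) * y (σ * p.1)) * this

theorem synthFactor_two (m : ℕ) (w : ℂ) (y : AddCircle (2 * Real.pi * L)) :
    synthFactor L n ε 2 m w y = -(m * waveNumber L n) ^ 2 * synthFactor L n ε 0 m w y := by
  rw [synthFactor, synthFactor, waveFactor_two, waveFactor_zero, one_mul, Complex.re_ofReal_mul]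
  ring

variable {L n σ}

/-- The second derivative in `x` of the synthesis. -/
theorem hasDerivAt_synth_fst_fst (hσ : waveNumber L n ^ 2 = 5 * σ ^ 2) {w : ℂ} (hw : ‖w‖ < 1 / 4)
    {u v N : ModeSeq} {γ : ℝ} (h : ∀ (m : ℕ) z, HasDerivAt (fun z => sech z * v m z)
      ((4 + γ + 5 * m ^ 2) * (sech z * u m z) - sech z * N m z) z) (x : ℝ)
    (y : AddCircle (2 * Real.pi * L)) :
    HasDerivAt (fun x : ℝ => σ * (sech (σ * x) * synth L n σ ε 0 w v (x, y)))
      (sech (σ * x) * (σ ^ 2 * ((4 + γ) * synth L n σ ε 0 w u (x, y) - synth L n σ ε 0 w N (x, y))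
        - synth L n σ ε 2 w u (x, y))) x := by
  have hs : ∀ (u : ModeSeq) x,
      HasSum (fun m => synthFactor L n ε 0 m w y * (sech (σ * x) * u m (σ * x)))
      (sech (σ * x) * synth L n σ ε 0 w u (x, y)) := fun u x => by
    convert! (hasSum_synth L n σ ε zero_le_two hw u (x, y)).mul_left (sech (σ * x)) using 1
    funext m
    ring
  have h2 : ∀ x, HasSum (fun m => synthFactor L n ε 2 m w y * (sech (σ * x) * u m (σ * x)))
      (sech (σ * x) * synth L n σ ε 2 w u (x, y)) := fun x => by
    convert! (hasSum_synth L n σ ε le_rfl hw u (x, y)).mul_left (sech (σ * x)) using 1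
    funext m
    ring
  set K : ℝ := (1 + |ε|) * |waveNumber L n| ^ 0 with hK
  set K₂ : ℝ := (1 + |ε|) * |waveNumber L n| ^ 2 with hK₂
  -- The resonance relation (n/L)² = 5σ² turns the term 5m² of the mode equations into minus the
  -- second derivative in y.
  have hg : ∀ m x, σ * (synthFactor L n ε 0 m w y
      * (((4 + γ + 5 * (m : ℝ) ^ 2) * (sech (σ * x) * u m (σ * x)) - sech (σ * x) * N m (σ * x)) * σ))
      = σ ^ 2 * (4 + γ) * (synthFactor L n ε 0 m w y * (sech (σ * x) * u m (σ * x)))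
        - σ ^ 2 * (synthFactor L n ε 0 m w y * (sech (σ * x) * N m (σ * x)))
        - synthFactor L n ε 2 m w y * (sech (σ * x) * u m (σ * x)) := fun m x => by
    rw [synthFactor_two]
    linear_combination (-(m : ℝ) ^ 2 * synthFactor L n ε 0 m w y * (sech (σ * x) * u m (σ * x))) * hσ
  have hb : ∀ (u : ModeSeq) m x, |sech (σ * x) * u m (σ * x)| ≤ ‖u m‖ := fun u m x => by
    rw [abs_mul, abs_of_pos (sech_pos _)]
    have h2 := (u m).norm_coe_le_norm (σ * x)
    have h3 := sech_le_one (σ * x)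
    rw [Real.norm_eq_abs] at h2
    exact (mul_le_mul h3 h2 (abs_nonneg _) zero_le_one).trans_eq (one_mul _)
  have hd := hasDerivAt_tsum (𝕜 := ℝ)
    (g := fun m x => σ * (synthFactor L n ε 0 m w y * (sech (σ * x) * v m (σ * x))))
    (g' := fun m x => σ * (synthFactor L n ε 0 m w y * (((4 + γ + 5 * (m : ℝ) ^ 2)
      * (sech (σ * x) * u m (σ * x)) - sech (σ * x) * N m (σ * x)) * σ)))
    (u := fun m => |σ ^ 2 * (4 + γ)| * K * ‖u m‖ + |σ ^ 2| * K * ‖N m‖ + K₂ * ‖u m‖)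
    (((u.hasSum_norm.summable.mul_left _).add (N.hasSum_norm.summable.mul_left _)).add
      (u.hasSum_norm.summable.mul_left _))
    (fun m x => by
      have h1 : HasDerivAt (fun x => σ * x) σ x := by simpa using (hasDerivAt_id x).const_mul σ
      exact (((h m (σ * x)).comp x h1).const_mul _).const_mul _)
    (fun m x => by
      rw [hg, Real.norm_eq_abs]
      have e1 := abs_synthFactor_le L n ε zero_le_two m hw y
      have e2 := abs_synthFactor_le L n ε le_rfl m hw y
      rw [← hK] at e1
      rw [← hK₂] at e2
      have e3 := hb u m x
      have e4 := hb N m x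
      have p1 : 0 ≤ K := (abs_nonneg _).trans e1
      refine (abs_sub _ _).trans (add_le_add ((abs_sub _ _).trans (add_le_add ?_ ?_)) ?_)
      · rw [abs_mul, abs_mul (synthFactor _ _ _ _ _ _ _), mul_assoc |σ ^ 2 * (4 + γ)|]
        gcongr
      · rw [abs_mul, abs_mul (synthFactor _ _ _ _ _ _ _), mul_assoc |σ ^ 2|]
        gcongr
      · rw [abs_mul]
        gcongr)
    (y₀ := x) ((hs v x).mul_left σ).summable x
  convert! hd using 1
  · funext x
    exact ((hs v x).mul_left σ).tsum_eq.symm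
  · simp only [hg]
    rw [((((hs u x).mul_left _).sub ((hs N x).mul_left _)).sub (h2 x)).tsum_eq]
    ring

end

/-! ### Weak derivatives of classically differentiable functions -/

section WeakDeriv

variable {L : ℝ} [Fact (0 < L)]

/-- `G` is the classical partial derivative of `F` in `x`. -/
def HasDx (F G : Cyl L → ℝ) : Prop :=
  ∀ (x : ℝ) (y : AddCircle (2 * Real.pi * L)), HasDerivAt (fun s => F (s, y)) (G (x, y)) x

/-- `G` is the classical partial derivative of `F` in `y`. -/
def HasDy (F G : Cyl L → ℝ) : Prop :=
  ∀ x y : ℝ, HasDerivAt (fun s : ℝ => F (x, (s : AddCircle (2 * Real.pi * L))))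
    (G (x, (y : AddCircle (2 * Real.pi * L)))) y

omit [Fact (0 < L)] in
theorem Cyl.IsTest.hasDx {ζ : Cyl L → ℝ} (h : Cyl.IsTest ζ) : HasDx ζ (Cyl.dx ζ) := by
  intro x y
  induction y using QuotientAddGroup.induction_on with
  | H y =>
    have h1 : HasFDerivAt (Cyl.lift ζ) (fderiv ℝ (Cyl.lift ζ) (x, y)) (x, y) :=
      ((h.smooth.differentiable (by simp)) (x, y)).hasFDerivAt
    have h2 : HasDerivAt (fun s : ℝ => ((s, y) : ℝ × ℝ)) (1, 0) x :=
      (hasDerivAt_id x).prodMk (hasDerivAt_const _ _)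
    have h3 := h1.comp_hasDerivAt (x := x) (f := fun s : ℝ => ((s, y) : ℝ × ℝ)) h2
    rw [← Cyl.lift_dx h.smooth (x, y)] at h3
    exact h3

omit [Fact (0 < L)] in
theorem Cyl.IsTest.hasDy {ζ : Cyl L → ℝ} (h : Cyl.IsTest ζ) : HasDy ζ (Cyl.dy ζ) := by
  intro x y
  have h1 : HasFDerivAt (Cyl.lift ζ) (fderiv ℝ (Cyl.lift ζ) (x, y)) (x, y) :=
    ((h.smooth.differentiable (by simp)) (x, y)).hasFDerivAt
  have h2 : HasDerivAt (fun s : ℝ => ((x, s) : ℝ × ℝ)) (0, 1) y :=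
    (hasDerivAt_const _ _).prodMk (hasDerivAt_id y)
  have h3 := h1.comp_hasDerivAt (x := y) (f := fun s : ℝ => ((x, s) : ℝ × ℝ)) h2
  rw [← Cyl.lift_dy h.smooth (x, y)] at h3
  exact h3

theorem integral_eq_zero_of_hasDx {H H' : Cyl L → ℝ} (hH : Continuous H) (hH' : Continuous H')
    (hc : HasCompactSupport H) (hc' : HasCompactSupport H') (h : HasDx H H') :
    ∫ p, H' p = 0 := by
  have hs : ∀ {G : Cyl L → ℝ}, Continuous G → HasCompactSupport G →
      ∀ y, Integrable fun x => G (x, y) := fun {G} hG hGc y =>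
    Continuous.integrable_of_hasCompactSupport (by fun_prop)
      (HasCompactSupport.intro (K := Prod.fst '' tsupport G) (hGc.isCompact.image continuous_fst)
        fun x hx => image_eq_zero_of_notMem_tsupport fun h => hx ⟨_, h, rfl⟩)
  rw [Measure.volume_eq_prod,
    integral_prod_symm _ (hH'.integrable_of_hasCompactSupport hc')]
  refine (integral_congr_ae (ae_of_all _ fun y => ?_)).trans (integral_zero' _ _)
  exact integral_eq_zero_of_hasDerivAt_of_integrable (fun x => h x y) (hs hH' hc' y) (hs hH hc y)

theorem integral_eq_zero_of_hasDy {H H' : Cyl L → ℝ} (hH' : Continuous H')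
    (hc' : HasCompactSupport H') (h : HasDy H H') :
    ∫ p, H' p = 0 := by
  rw [Measure.volume_eq_prod, integral_prod _ (hH'.integrable_of_hasCompactSupport hc')]
  refine (integral_congr_ae (ae_of_all _ fun x => ?_)).trans (integral_zero' _ _)
  change ∫ y, H' (x, y) = 0
  have hc : Continuous fun y : AddCircle (2 * Real.pi * L) => H' (x, y) := by fun_prop
  rw [← AddCircle.intervalIntegral_preimage (2 * Real.pi * L) 0 fun y => H' (x, y),
    intervalIntegral.integral_eq_sub_of_hasDerivAt (fun y _ => h x y)
      ((hc.comp (AddCircle.continuous_mk' _)).intervalIntegrable _ _)]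
  rw [zero_add, AddCircle.coe_period, AddCircle.coe_zero, sub_self]

theorem integral_mul_dx {F G : Cyl L → ℝ} (hF : Continuous F) (hG : Continuous G) (h : HasDx F G)
    {ζ : Cyl L → ℝ} (hζ : Cyl.IsTest ζ) : ∫ p, F p * Cyl.dx ζ p = -∫ p, G p * ζ p := by
  have c1 := Cyl.continuous_of_lift hζ.smooth.continuous
  have c2 := Cyl.continuous_of_lift hζ.dx.smooth.continuous
  have i1 : Integrable fun p => F p * Cyl.dx ζ p :=
    (hF.mul c2).integrable_of_hasCompactSupport hζ.dx.compact.mul_left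
  have i2 : Integrable fun p => G p * ζ p :=
    (hG.mul c1).integrable_of_hasCompactSupport hζ.compact.mul_left
  have := integral_eq_zero_of_hasDx (H := fun p => F p * ζ p)
    (H' := fun p => G p * ζ p + F p * Cyl.dx ζ p) (hF.mul c1) ((hG.mul c1).add (hF.mul c2))
    hζ.compact.mul_left (hζ.compact.mul_left.add hζ.dx.compact.mul_left)
    fun x y => (h x y).mul (hζ.hasDx x y)
  rw [integral_add i2 i1] at this
  linarith

theorem integral_mul_dy {F G : Cyl L → ℝ} (hF : Continuous F) (hG : Continuous G) (h : HasDy F G)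
    {ζ : Cyl L → ℝ} (hζ : Cyl.IsTest ζ) : ∫ p, F p * Cyl.dy ζ p = -∫ p, G p * ζ p := by
  have c1 := Cyl.continuous_of_lift hζ.smooth.continuous
  have c2 := Cyl.continuous_of_lift hζ.dy.smooth.continuous
  have i1 : Integrable fun p => F p * Cyl.dy ζ p :=
    (hF.mul c2).integrable_of_hasCompactSupport hζ.dy.compact.mul_left
  have i2 : Integrable fun p => G p * ζ p :=
    (hG.mul c1).integrable_of_hasCompactSupport hζ.compact.mul_left
  have := integral_eq_zero_of_hasDy (H := fun p => F p * ζ p)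
    (H' := fun p => G p * ζ p + F p * Cyl.dy ζ p) ((hG.mul c1).add (hF.mul c2))
    (hζ.compact.mul_left.add hζ.dy.compact.mul_left)
    fun x y => (h x y).mul (hζ.hasDy x y)
  rw [integral_add i2 i1] at this
  linarith

/-- A function in `L²` whose first and second order classical derivatives are continuous and in
`L²` gives an element of `H²`. -/
theorem mem_sobolevH_two {F : ℕ × ℕ → Cyl L → ℝ} (hF : ∀ α, Continuous (F α))
    (h10 : HasDx (F (0, 0)) (F (1, 0))) (h20 : HasDx (F (1, 0)) (F (2, 0)))
    (h01 : HasDy (F (0, 0)) (F (0, 1))) (h11 : HasDy (F (1, 0)) (F (1, 1)))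
    (h02 : HasDy (F (0, 1)) (F (0, 2))) (u : PiLp 2 fun _ : derivIdx 2 => L2 L)
    (hu : ∀ α : derivIdx 2, u α =ᵐ[volume] F α.1) : u ∈ SobolevH L 2 := by
  have key : ∀ i j : ℕ, i + j ≤ 2 → ∀ ζ : Cyl L → ℝ, Cyl.IsTest ζ →
      ∫ p, F (0, 0) p * Cyl.dxy i j ζ p = (-1) ^ (i + j) * ∫ p, F (i, j) p * ζ p := by
    intro i j hij ζ hζ
    have e10 := fun (ζ : Cyl L → ℝ) hζ => integral_mul_dx (hF _) (hF _) h10 (ζ := ζ) hζ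
    have e20 := fun (ζ : Cyl L → ℝ) hζ => integral_mul_dx (hF _) (hF _) h20 (ζ := ζ) hζ
    have e01 := fun (ζ : Cyl L → ℝ) hζ => integral_mul_dy (hF _) (hF _) h01 (ζ := ζ) hζ
    have e11 := fun (ζ : Cyl L → ℝ) hζ => integral_mul_dy (hF _) (hF _) h11 (ζ := ζ) hζ
    have e02 := fun (ζ : Cyl L → ℝ) hζ => integral_mul_dy (hF _) (hF _) h02 (ζ := ζ) hζ
    have hi : i ≤ 2 := by omega
    have hj : j ≤ 2 - i := by omega
    interval_cases i
    · interval_cases j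
      · simp [Cyl.dxy]
      · change ∫ p, F (0, 0) p * Cyl.dy ζ p = _
        rw [e01 _ hζ]; ring
      · change ∫ p, F (0, 0) p * Cyl.dy (Cyl.dy ζ) p = _
        rw [e01 _ hζ.dy, e02 _ hζ]; ring
    · norm_num at hj
      interval_cases j
      · change ∫ p, F (0, 0) p * Cyl.dx ζ p = _
        rw [e10 _ hζ]; ring
      -- The outer ∂_x is moved first, so the mixed derivative is needed as the y-derivative of ∂_x
      -- F.
      · change ∫ p, F (0, 0) p * Cyl.dx (Cyl.dy ζ) p = _
        rw [e10 _ hζ.dy, e11 _ hζ]; ring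
    · norm_num at hj
      subst hj
      change ∫ p, F (0, 0) p * Cyl.dx (Cyl.dx ζ) p = _
      rw [e10 _ hζ.dx, e20 _ hζ]; ring
  intro α ζ hζ
  have h0 := hu ⟨(0, 0), mem_derivIdx.2 (Nat.zero_le 2)⟩
  have h1 := hu α
  have e0 : ∫ p, u ⟨(0, 0), mem_derivIdx.2 (Nat.zero_le 2)⟩ p * Cyl.dxy α.1.1 α.1.2 ζ p
      = ∫ p, F (0, 0) p * Cyl.dxy α.1.1 α.1.2 ζ p :=
    integral_congr_ae (h0.mono fun p hp => congrArg (· * _) hp)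
  have e1 : ∫ p, u α p * ζ p = ∫ p, F α.1 p * ζ p :=
    integral_congr_ae (h1.mono fun p hp => congrArg (· * _) hp)
  rw [e0, e1]
  exact key _ _ (mem_derivIdx.1 α.2) ζ hζ

/-! ### Completeness of the Sobolev spaces -/

theorem continuous_integral_mul {η : Cyl L → ℝ} (hη : MemLp η 2 (volume : Measure (Cyl L))) :
    Continuous fun u : L2 L => ∫ p, u p * η p := by
  have : (fun u : L2 L => ∫ p, u p * η p) = fun u => inner ℝ (hη.toLp η) u := by
    funext u
    rw [L2.inner_def]
    refine integral_congr_ae (hη.coeFn_toLp.mono fun p hp => ?_)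
    simp only [hp, RCLike.inner_apply, conj_trivial]
  rw [this]
  fun_prop

/-- Each test function imposes an equation between continuous linear functionals. Closedness gives
the completeness on which the orthogonal projection in `solH` rests. -/
theorem isClosed_sobolevH (k : ℕ) :
    IsClosed (SobolevH L k : Set (PiLp 2 fun _ : derivIdx k => L2 L)) := by
  have : (SobolevH L k : Set (PiLp 2 fun _ : derivIdx k => L2 L))
      = ⋂ (α : derivIdx k) (ζ : Cyl L → ℝ) (_ : Cyl.IsTest ζ),
        {u | ∫ p, u ⟨(0, 0), mem_derivIdx.2 (Nat.zero_le k)⟩ p * Cyl.dxy α.1.1 α.1.2 ζ p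
          = (-1) ^ (α.1.1 + α.1.2) * ∫ p, u α p * ζ p} := by
    ext u
    simp only [Set.mem_iInter, Set.mem_ofPred_eq]
    rfl
  rw [this]
  refine isClosed_iInter fun α => isClosed_iInter fun ζ => isClosed_iInter fun hζ => ?_
  refine isClosed_eq ?_ (continuous_const.mul ?_)
  · exact (continuous_integral_mul (hζ.dxy _ _).memLp).comp (PiLp.continuous_apply 2 _ _)
  · exact (continuous_integral_mul hζ.memLp).comp (PiLp.continuous_apply 2 _ _)

instance completeSpace_sobolevH (k : ℕ) : CompleteSpace (SobolevH L k) :=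
  (isClosed_sobolevH k).completeSpace_coe

end WeakDeriv

/-! ### The solution as an element of `H²` -/

theorem sech_sq_le (z : ℝ) : sech z ^ 2 ≤ (1 + z ^ 2)⁻¹ := by
  have h : z ^ 2 ≤ Real.sinh z ^ 2 := by
    rcases le_total 0 z with hz | hz
    · exact pow_le_pow_left₀ hz (Real.self_le_sinh_iff.2 hz) 2
    · have := Real.self_le_sinh_iff.2 (neg_nonneg.2 hz)
      rw [Real.sinh_neg] at this
      nlinarith
  rw [sech, inv_pow]
  refine inv_anti₀ (by positivity) ?_
  rw [Real.cosh_sq]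
  linarith

theorem integrable_sech_sq : Integrable fun z => sech z ^ 2 :=
  integrable_inv_one_add_sq.mono' (continuous_sech.pow 2).aestronglyMeasurable
    (ae_of_all _ fun z => by
      rw [Real.norm_eq_abs, abs_of_nonneg (by positivity)]
      exact sech_sq_le z)

section ToL2

variable {L : ℝ} [Fact (0 < L)] {σ : ℝ}

theorem memLp_sech (hσ : 0 < σ) :
    MemLp (fun p : Cyl L => sech (σ * p.1)) 2 (volume : Measure (Cyl L)) := by
  have hc : Continuous fun p : Cyl L => sech (σ * p.1) := continuous_sech.comp (by fun_prop)
  refine (memLp_two_iff_integrable_sq hc.aestronglyMeasurable).2 ?_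
  exact (integrable_sech_sq.comp_mul_left' hσ.ne').comp_fst _

theorem memLp_sech_mul (hσ : 0 < σ) (h : BddFun (Cyl L)) :
    MemLp (fun p : Cyl L => sech (σ * p.1) * h p) 2 (volume : Measure (Cyl L)) := by
  refine ((memLp_sech (L := L) hσ).const_mul ‖h‖).mono
    ((continuous_sech.comp (by fun_prop)).mul h.continuous).aestronglyMeasurable
    (ae_of_all _ fun p => ?_)
  rw [norm_mul, norm_mul, norm_norm, mul_comm]
  exact mul_le_mul_of_nonneg_right (h.norm_coe_le_norm p) (norm_nonneg _)

/-- Multiplication by `sech (σ x)`, from bounded continuous functions to `L²`. -/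
noncomputable def toL2 (hσ : 0 < σ) : BddFun (Cyl L) →L[ℝ] L2 L :=
  LinearMap.mkContinuous
    { toFun := fun h => (memLp_sech_mul hσ h).toLp _
      map_add' := fun g h => by
        rw [← MemLp.toLp_add]
        congr 1
        funext p
        exact mul_add _ _ _
      map_smul' := fun c h => by
        rw [RingHom.id_apply, ← MemLp.toLp_const_smul]
        congr 1
        funext p
        exact mul_left_comm _ _ _ }
    ‖(memLp_sech (L := L) hσ).toLp _‖ fun h => by
      refine (Lp.norm_le_mul_norm_of_ae_le_mul (c := ‖h‖)
        (f := (memLp_sech_mul hσ h).toLp _) (g := (memLp_sech (L := L) hσ).toLp _) ?_).trans_eq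
        (mul_comm ‖h‖ _)
      filter_upwards [(memLp_sech_mul hσ h).coeFn_toLp, (memLp_sech (L := L) hσ).coeFn_toLp]
        with p h1 h2
      rw [h1, h2, norm_mul, mul_comm ‖sech _‖]
      exact mul_le_mul_of_nonneg_right (h.norm_coe_le_norm p) (norm_nonneg _)

theorem toL2_ae (hσ : 0 < σ) (h : BddFun (Cyl L)) :
    toL2 hσ h =ᵐ[volume] fun p => sech (σ * p.1) * h p :=
  (memLp_sech_mul hσ h).coeFn_toLp

end ToL2

section Jet

variable (L : ℝ) (n : ℤ) (σ ε : ℝ)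

/-- The partial derivatives, up to the factor `sech (σ x)`, of the function with modes `u`, if `v`
are the derivatives of the modes and `N` is the nonlinear term. -/
noncomputable def jet (w : ℂ) (γ : ℝ) (u v N : ModeSeq) : ℕ × ℕ → BddFun (Cyl L)
  | (0, 0) => synth L n σ ε 0 w u
  | (1, 0) => σ • synth L n σ ε 0 w v
  -- The second x-derivative as prescribed by the mode equations; it is the actual derivative only
  -- when these hold.
  | (2, 0) => σ ^ 2 • ((4 + γ) • synth L n σ ε 0 w u - synth L n σ ε 0 w N) - synth L n σ ε 2 w u
  | (0, 1) => synth L n σ ε 1 w u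
  | (1, 1) => σ • synth L n σ ε 1 w v
  | (0, 2) => synth L n σ ε 2 w u
  | _ => 0

theorem contDiffAt_jet {D : Type*} [NormedAddCommGroup D] [NormedSpace ℝ D] {w : D → ℂ}
    {γ : D → ℝ} {u v N : D → ModeSeq} {x : D} {k : ℕ∞ω} (hw : ‖w x‖ < 1 / 4)
    (cw : ContDiffAt ℝ k w x) (cγ : ContDiffAt ℝ k γ x) (cu : ContDiffAt ℝ k u x)
    (cv : ContDiffAt ℝ k v x) (cN : ContDiffAt ℝ k N x) (α : ℕ × ℕ) :
    ContDiffAt ℝ k (fun a => jet L n σ ε (w a) (γ a) (u a) (v a) (N a) α) x := by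
  have hs : ∀ {j : ℕ}, j ≤ 2 → ∀ {u : D → ModeSeq}, ContDiffAt ℝ k u x →
      ContDiffAt ℝ k (fun a => synth L n σ ε j (w a) (u a)) x := fun {j} hj {u} cu => by
    have h1 : ContDiffAt ℝ k (fun a => synth L n σ ε j (w a)) x :=
      (contDiffAt_synth L n σ ε hj hw).comp x cw
    exact h1.clm_apply cu
  have hσ : ∀ c : ℝ, ContDiffAt ℝ k (fun _ : D => c) x := fun c => contDiffAt_const
  unfold jet
  split
  · exact hs zero_le_two cu
  · exact (hσ σ).smul (hs zero_le_two cv)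
  · exact ((hσ (σ ^ 2)).smul ((((hσ 4).add cγ).smul (hs zero_le_two cu)).sub
      (hs zero_le_two cN))).sub (hs le_rfl cu)
  · exact hs one_le_two cu
  · exact (hσ σ).smul (hs one_le_two cv)
  · exact hs le_rfl cu
  · exact contDiffAt_const

variable {L n σ ε}

theorem hasDy_sech_mul {g h : BddFun (Cyl L)}
    (H : ∀ x y : ℝ, HasDerivAt (fun y : ℝ => g (x, (y : AddCircle (2 * Real.pi * L))))
      (h (x, (y : AddCircle (2 * Real.pi * L)))) y) :
    HasDy (fun p : Cyl L => σ ^ 2 * (sech (σ * p.1) * g p))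
      (fun p => σ ^ 2 * (sech (σ * p.1) * h p)) :=
  fun x y => ((H x y).const_mul (sech (σ * x))).const_mul (σ ^ 2)

end Jet

/-! ### The family of solutions with values in H². -/

section Solution

variable {L : ℝ} [Fact (0 < L)] {n : ℤ} {σ ε : ℝ}

/-- The family of the functions `σ² sech (σ x) (jet α)`. -/
noncomputable def solVec (hσ : 0 < σ) (n : ℤ) (ε : ℝ) (w : ℂ) (γ t : ℝ) (f : ModeSeq) :
    PiLp 2 fun _ : derivIdx 2 => L2 L :=
  WithLp.toLp 2 fun α => σ ^ 2 • toL2 hσ (jet L n σ ε w γ (modeSol f) (modeSol' f)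
    (modeBilin ε t (modeSol f) (modeSol f)) α.1)

theorem solVec_ae (hσ : 0 < σ) (w : ℂ) (γ t : ℝ) (f : ModeSeq) (α : derivIdx 2) :
    (solVec hσ n ε w γ t f : PiLp 2 fun _ : derivIdx 2 => L2 L) α =ᵐ[volume] fun p =>
      σ ^ 2 * (sech (σ * p.1) * jet L n σ ε w γ (modeSol f) (modeSol' f)
        (modeBilin ε t (modeSol f) (modeSol f)) α.1 p) := by
  have h1 := Lp.coeFn_smul (σ ^ 2) (toL2 hσ (jet L n σ ε w γ (modeSol f) (modeSol' f)
    (modeBilin ε t (modeSol f) (modeSol f)) α.1))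
  filter_upwards [h1, toL2_ae hσ (jet L n σ ε w γ (modeSol f) (modeSol' f)
    (modeBilin ε t (modeSol f) (modeSol f)) α.1)] with p h2 h3
  change (σ ^ 2 • toL2 hσ _ : L2 L) p = _
  rw [h2, Pi.smul_apply, h3, smul_eq_mul]

theorem contDiffAt_solVec (hσ : 0 < σ) {D : Type*} [NormedAddCommGroup D] [NormedSpace ℝ D]
    {w : D → ℂ} {γ t : D → ℝ} {f : D → ModeSeq} {x : D} {k : ℕ∞ω} (hw : ‖w x‖ < 1 / 4)
    (ht : |t x| < 1 / 4)
    (cw : ContDiffAt ℝ k w x) (cγ : ContDiffAt ℝ k γ x) (ct : ContDiffAt ℝ k t x)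
    (cf : ContDiffAt ℝ k f x) :
    ContDiffAt ℝ k (fun a => (solVec hσ n ε (w a) (γ a) (t a) (f a) :
      PiLp 2 fun _ : derivIdx 2 => L2 L)) x := by
  have cu : ContDiffAt ℝ k (fun a => modeSol (f a)) x :=
    contDiffAt_const.add (contDiffAt_clm solOp cf)
  have cv : ContDiffAt ℝ k (fun a => modeSol' (f a)) x :=
    contDiffAt_const.add (contDiffAt_clm solOp' cf)
  have cN := contDiffAt_modeBilin (e := fun _ => ε) ht contDiffAt_const ct cu
  refine contDiffAt_piLp' 2 fun α => ?_
  have h := contDiffAt_clm (toL2 (L := L) hσ) (contDiffAt_jet L n σ ε hw cw cγ cu cv cN α.1)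
  exact contDiffAt_clm (σ ^ 2 • ContinuousLinearMap.id ℝ (L2 L)) h

theorem solVec_mem (hσ : 0 < σ) (hk : waveNumber L n ^ 2 = 5 * σ ^ 2) {w : ℂ} (hw : ‖w‖ < 1 / 4)
    {γ : ℝ} {f : ModeSeq} (h : modeSystem ((ε, ‖w‖ ^ 2), (f, γ)) = 0) :
    (solVec hσ n ε w γ (‖w‖ ^ 2) f : PiLp 2 fun _ : derivIdx 2 => L2 L) ∈ SobolevH L 2 := by
  have ht : |‖w‖ ^ 2| < 1 / 4 := by
    rw [abs_of_nonneg (by positivity)]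
    nlinarith [norm_nonneg w]
  have hf1 : groundPairing (f 1) = 0 := (Prod.mk_eq_zero.1 h).2
  refine mem_sobolevH_two (F := fun α p => σ ^ 2 * (sech (σ * p.1) * jet L n σ ε w γ (modeSol f)
    (modeSol' f) (modeBilin ε (‖w‖ ^ 2) (modeSol f) (modeSol f)) α p)) (fun α => ?_) ?_ ?_ ?_ ?_ ?_ _
    (solVec_ae hσ w γ (‖w‖ ^ 2) f)
  · exact continuous_const.mul ((continuous_sech.comp (by fun_prop)).mul (BddFun.continuous _))
  · intro x y
    have h1 := (hasDerivAt_synth_fst L n σ ε hw (hasDerivAt_modeSol hf1) x y).const_mul (σ ^ 2)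
    convert! h1 using 1
    simp only [jet, BddFun.smul_apply, smul_eq_mul]
    ring
  · intro x y
    have h1 := (hasDerivAt_synth_fst_fst ε hk hw (hasDerivAt_modeSol' ht h) x y).const_mul (σ ^ 2)
    convert! h1 using 1
    funext s
    simp only [jet, BddFun.smul_apply, smul_eq_mul]
    ring
  · exact hasDy_sech_mul fun x y => hasDerivAt_synth_snd L n σ ε one_le_two hw (modeSol f) x y
  · exact hasDy_sech_mul fun x y =>
      (hasDerivAt_synth_snd L n σ ε one_le_two hw (modeSol' f) x y).const_mul σ
  · exact hasDy_sech_mul fun x y => hasDerivAt_synth_snd L n σ ε le_rfl hw (modeSol f) x y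

/-- The projection of `solVec` to `H²`. -/
noncomputable def solH (hσ : 0 < σ) (n : ℤ) (ε : ℝ) (w : ℂ) (γ t : ℝ) (f : ModeSeq) :
    SobolevH L 2 :=
  (SobolevH L 2).orthogonalProjectionOnto (solVec hσ n ε w γ t f)

theorem contDiffAt_solH (hσ : 0 < σ) {D : Type*} [NormedAddCommGroup D] [NormedSpace ℝ D]
    {w : D → ℂ} {γ t : D → ℝ} {f : D → ModeSeq} {x : D} {k : ℕ∞ω} (hw : ‖w x‖ < 1 / 4)
    (ht : |t x| < 1 / 4)
    (cw : ContDiffAt ℝ k w x) (cγ : ContDiffAt ℝ k γ x) (ct : ContDiffAt ℝ k t x)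
    (cf : ContDiffAt ℝ k f x) :
    ContDiffAt ℝ k (fun a => (solH hσ n ε (w a) (γ a) (t a) (f a) : SobolevH L 2)) x :=
  contDiffAt_clm (SobolevH L 2).orthogonalProjectionOnto
    (contDiffAt_solVec hσ hw ht cw cγ ct cf)

/-- When the system holds, the tuple already consists of weak derivatives and the projection does
nothing. The projection only provides a map into the subspace for all arguments, so that its
smoothness follows from that of the tuple. -/
theorem solH_coe (hσ : 0 < σ) (hk : waveNumber L n ^ 2 = 5 * σ ^ 2) {w : ℂ} (hw : ‖w‖ < 1 / 4)
    {γ : ℝ} {f : ModeSeq} (h : modeSystem ((ε, ‖w‖ ^ 2), (f, γ)) = 0) :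
    ((solH hσ n ε w γ (‖w‖ ^ 2) f : SobolevH L 2) : PiLp 2 fun _ : derivIdx 2 => L2 L)
      = solVec hσ n ε w γ (‖w‖ ^ 2) f :=
  congrArg Subtype.val (Submodule.orthogonalProjectionOnto_mem_subspace_eq_self
    (K := SobolevH L 2) ⟨_, solVec_mem hσ hk hw h⟩)

/-- The function on the cylinder with the modes `modeSol f`. -/
noncomputable def solFun (L : ℝ) (n : ℤ) (σ ε : ℝ) (w : ℂ) (f : ModeSeq) (p : Cyl L) : ℝ :=
  σ ^ 2 * (sech (σ * p.1) * synth L n σ ε 0 w (modeSol f) p)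

omit [Fact (0 < L)] in
theorem continuous_solFun (w : ℂ) (f : ModeSeq) : Continuous (solFun L n σ ε w f) :=
  continuous_const.mul ((continuous_sech.comp (by fun_prop)).mul (BddFun.continuous _))

theorem solH_fn_eq (hσ : 0 < σ) (hk : waveNumber L n ^ 2 = 5 * σ ^ 2) {w : ℂ} (hw : ‖w‖ < 1 / 4)
    {γ : ℝ} {f : ModeSeq} (h : modeSystem ((ε, ‖w‖ ^ 2), (f, γ)) = 0) :
    SobolevH.fn (solH hσ n ε w γ (‖w‖ ^ 2) f : SobolevH L 2)
      = σ ^ 2 • toL2 hσ (synth L n σ ε 0 w (modeSol f)) := by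
  rw [SobolevH.fn, SobolevH.D, solH_coe hσ hk hw h]
  rfl

theorem solH_D_ae (hσ : 0 < σ) (hk : waveNumber L n ^ 2 = 5 * σ ^ 2) {w : ℂ} (hw : ‖w‖ < 1 / 4)
    {γ : ℝ} {f : ModeSeq} (h : modeSystem ((ε, ‖w‖ ^ 2), (f, γ)) = 0) {i j : ℕ} (hij : i + j ≤ 2) :
    SobolevH.D (solH hσ n ε w γ (‖w‖ ^ 2) f : SobolevH L 2) i j hij =ᵐ[volume] fun p =>
      σ ^ 2 * (sech (σ * p.1) * jet L n σ ε w γ (modeSol f) (modeSol' f)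
        (modeBilin ε (‖w‖ ^ 2) (modeSol f) (modeSol f)) (i, j) p) := by
  rw [SobolevH.D, solH_coe hσ hk hw h]
  exact solVec_ae hσ w γ (‖w‖ ^ 2) f ⟨(i, j), mem_derivIdx.2 hij⟩

theorem solH_fn_ae (hσ : 0 < σ) (hk : waveNumber L n ^ 2 = 5 * σ ^ 2) {w : ℂ} (hw : ‖w‖ < 1 / 4)
    {γ : ℝ} {f : ModeSeq} (h : modeSystem ((ε, ‖w‖ ^ 2), (f, γ)) = 0) :
    SobolevH.fn (solH hσ n ε w γ (‖w‖ ^ 2) f : SobolevH L 2) =ᵐ[volume] solFun L n σ ε w f :=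
  solH_D_ae hσ hk hw h (Nat.zero_le 2)

/-- The stationary equation. -/
theorem solH_equation (hσ : 0 < σ) (hk : waveNumber L n ^ 2 = 5 * σ ^ 2) {w : ℂ}
    (hw : ‖w‖ < 1 / 4) {γ : ℝ} {f : ModeSeq} (h : modeSystem ((ε, ‖w‖ ^ 2), (f, γ)) = 0) :
    ∀ᵐ p : Cyl L, -SobolevH.laplacian (solH hσ n ε w γ (‖w‖ ^ 2) f : SobolevH L 2) p
      + σ ^ 2 * (4 + γ) * SobolevH.fn (solH hσ n ε w γ (‖w‖ ^ 2) f : SobolevH L 2) p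
      - SobolevH.fn (solH hσ n ε w γ (‖w‖ ^ 2) f : SobolevH L 2) p ^ 2 = 0 := by
  filter_upwards [solH_D_ae hσ hk hw h (i := 2) (j := 0) le_rfl,
    solH_D_ae hσ hk hw h (i := 0) (j := 2) le_rfl, solH_fn_ae hσ hk hw h,
    Lp.coeFn_add (SobolevH.D (solH hσ n ε w γ (‖w‖ ^ 2) f : SobolevH L 2) 2 0 le_rfl)
      (SobolevH.D (solH hσ n ε w γ (‖w‖ ^ 2) f : SobolevH L 2) 0 2 le_rfl)] with p h1 h2 h3 h4
  rw [SobolevH.laplacian, h4, Pi.add_apply, h1, h2, h3, solFun]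
  simp only [jet, BddFun.sub_apply, BddFun.smul_apply, smul_eq_mul]
  rw [synth_modeBilin L n σ ε hw]
  ring

omit [Fact (0 < L)] in
theorem solFun_neg {w : ℂ} (hw : ‖w‖ < 1 / 4) (f : ModeSeq) (x : ℝ)
    (y : AddCircle (2 * Real.pi * L)) :
    solFun L n σ ε w f (-x, y) = solFun L n σ ε w f (x, y) := by
  have h : synth L n σ ε 0 w (modeSol f) (-x, y) = synth L n σ ε 0 w (modeSol f) (x, y) := by
    refine (hasSum_synth L n σ ε zero_le_two hw (modeSol f) (-x, y)).unique ?_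
    convert! hasSum_synth L n σ ε zero_le_two hw (modeSol f) (x, y) using 1
    funext m
    rw [mul_neg, modeSol_neg]
  rw [solFun, solFun, h, mul_neg, sech_neg]

end Solution

/-! ### Positivity -/

/-- If the second derivative were negative, the point would also be a local maximum, so the function
would be locally constant and its second derivative zero. -/
theorem IsLocalMin.nonneg_of_hasDerivAt {f f' : ℝ → ℝ} {f'' x : ℝ} (h : IsLocalMin f x)
    (hf : ∀ x, HasDerivAt f (f' x) x) (hf' : HasDerivAt f' f'' x) : 0 ≤ f'' := by
  have e1 : deriv f = f' := funext fun x => (hf x).deriv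
  by_contra! hneg
  have h1 : IsLocalMax f x := isLocalMax_of_deriv_deriv_neg (by rwa [e1, hf'.deriv])
    (h.deriv_eq_zero) (hf x).continuousAt
  have h2 : f =ᶠ[𝓝 x] fun _ => f x := by
    filter_upwards [h, h1] with y hy hy'
    exact le_antisymm hy' hy
  have h3 : f' =ᶠ[𝓝 x] fun _ => 0 := by
    have := h2.deriv
    rwa [e1, show (deriv fun _ : ℝ => f x) = fun _ => 0 from funext fun _ => deriv_const _ _] at this
  have h4 := h3.deriv_eq
  rw [hf'.deriv, deriv_const] at h4
  exact hneg.ne h4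

/-- A minimum principle on the half cylinder `x ≥ X`: solutions of `Δ v = q v` with `0 < q ≤ κ²`
that are positive for `x = X` and vanish at infinity are positive. -/
theorem pos_of_laplacian_eq {L : ℝ} [Fact (0 < L)] {v vx vxx vy vyy : Cyl L → ℝ}
    (hv : Continuous v) (hx : HasDx v vx) (hxx : HasDx vx vxx) (hy : HasDy v vy)
    (hyy : HasDy vy vyy) {X κ : ℝ} (hκ : 0 < κ) (hX : ∀ y, 0 < v (X, y))
    (heq : ∀ x, X ≤ x → ∀ y, ∃ q, 0 < q ∧ q ≤ κ ^ 2 ∧ vxx (x, y) + vyy (x, y) = q * v (x, y))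
    (hlim : ∀ e, 0 < e → ∃ R, ∀ x, R ≤ x → ∀ y, |v (x, y)| < e) {x : ℝ} (hxX : X ≤ x)
    (y : AddCircle (2 * Real.pi * L)) : 0 < v (x, y) := by
  obtain ⟨y₀, -, hy₀⟩ := isCompact_univ.exists_isMinOn
    (Set.univ_nonempty (α := AddCircle (2 * Real.pi * L)))
    (f := fun y => v (X, y)) (by fun_prop)
  set δ := v (X, y₀) with hδ
  have hδ0 : 0 < δ := hX y₀
  -- A barrier with b'' = κ²b. At an interior minimum of v - b with negative value one would have 0
  -- ≤ Δ(v - b) = qv - κ²b ≤ q(v - b) < 0.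
  let b : ℝ → ℝ := fun x => δ * Real.exp (-(κ * (x - X)))
  have hb : ∀ x, HasDerivAt b (-κ * b x) x := fun x => by
    have := (((((hasDerivAt_id x).sub_const X).const_mul κ).neg).exp).const_mul δ
    convert! this using 1
    simp only [b, id, Pi.neg_apply]
    ring
  have hb0 : ∀ x, 0 < b x := fun x => mul_pos hδ0 (Real.exp_pos _)
  have hbc : Continuous b := continuous_iff_continuousAt.2 fun x => (hb x).continuousAt
  refine (hb0 x).trans_le ?_
  by_contra! hneg
  obtain ⟨R₁, hR₁⟩ := hlim ((b x - v (x, y)) / 2) (by linarith)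
  have hbl : Tendsto b atTop (𝓝 0) := by
    have h1 : Tendsto (fun x => κ * (x - X)) atTop atTop :=
      (tendsto_atTop_add_const_right _ (-X) tendsto_id).const_mul_atTop hκ
    simpa [b] using ((Real.tendsto_exp_neg_atTop_nhds_zero.comp h1).const_mul δ)
  obtain ⟨R₂, hR₂⟩ := eventually_atTop.1 (hbl.eventually (gt_mem_nhds
    (show (0 : ℝ) < (b x - v (x, y)) / 2 by linarith)))
  -- Beyond R₁ and R₂ both |v| and b are below half of the gap b - v at the given point, so the
  -- minimum over X ≤ x ≤ R cannot lie on the edge x = R. On the edge x = X the choice of δ makes v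
  -- - b nonnegative.
  set R := max (max R₁ R₂) (x + 1) with hR
  let d : Cyl L → ℝ := fun p => v p - b p.1
  have hK : IsCompact (Set.Icc X R ×ˢ (Set.univ : Set (AddCircle (2 * Real.pi * L)))) :=
    isCompact_Icc.prod isCompact_univ
  have hxR : x ≤ R := (by linarith : x ≤ x + 1).trans (le_max_right _ _)
  obtain ⟨⟨x₁, y₁⟩, hp, hmin⟩ := hK.exists_isMinOn ⟨(x, y), ⟨hxX, hxR⟩, trivial⟩
    (f := d) (hv.sub (hbc.comp continuous_fst)).continuousOn
  have hd1 : d (x₁, y₁) ≤ v (x, y) - b x := hmin (show (x, y) ∈ _ from ⟨⟨hxX, hxR⟩, trivial⟩)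
  have hx1 : X < x₁ := by
    refine lt_of_le_of_ne hp.1.1 fun h => ?_
    have h1 : δ ≤ v (X, y₁) := hy₀ (Set.mem_univ y₁)
    have h2 : b X = δ := by simp [b]
    have h3 : d (x₁, y₁) = v (X, y₁) - δ := by
      change v (x₁, y₁) - b x₁ = _
      have : x₁ = X := h.symm
      rw [this, h2]
    linarith
  have hx2 : x₁ < R := by
    refine lt_of_le_of_ne hp.1.2 fun h => ?_
    have h1 := hR₁ x₁ (by rw [show x₁ = R from h]; exact (le_max_left _ _).trans (le_max_left _ _)) y₁
    have h2 := hR₂ x₁ (by rw [show x₁ = R from h]; exact (le_max_right _ _).trans (le_max_left _ _))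
    have h3 : d (x₁, y₁) = v (x₁, y₁) - b x₁ := rfl
    have := neg_abs_le (v (x₁, y₁))
    linarith
  obtain ⟨s, rfl⟩ := QuotientAddGroup.mk_surjective y₁
  have hdx : 0 ≤ vxx (x₁, s) - -κ * (-κ * b x₁) := by
    refine IsLocalMin.nonneg_of_hasDerivAt (f := fun x => v (x, s) - b x)
      (f' := fun x => vx (x, s) - -κ * b x) ?_ (fun x => (hx x s).sub (hb x))
      ((hxx x₁ s).sub ((hb x₁).const_mul (-κ)))
    filter_upwards [Icc_mem_nhds hx1 hx2] with x hx
    exact hmin (show (x, (s : AddCircle (2 * Real.pi * L))) ∈ _ from ⟨hx, trivial⟩)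
  have hdy : 0 ≤ vyy (x₁, s) := by
    refine IsLocalMin.nonneg_of_hasDerivAt
      (f := fun s : ℝ => v (x₁, (s : AddCircle (2 * Real.pi * L))))
      (f' := fun s : ℝ => vy (x₁, (s : AddCircle (2 * Real.pi * L)))) ?_ (fun s => hy x₁ s)
      (hyy x₁ s)
    refine Eventually.of_forall fun r => ?_
    have h1 : d (x₁, (s : AddCircle (2 * Real.pi * L))) ≤ d (x₁, (r : AddCircle (2 * Real.pi * L))) :=
      hmin (show (x₁, (r : AddCircle (2 * Real.pi * L))) ∈ _ from ⟨hp.1, trivial⟩)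
    change v _ - b x₁ ≤ v _ - b x₁ at h1
    linarith
  obtain ⟨q, hq0, hq, he⟩ := heq x₁ hx1.le s
  have h1 : v (x₁, (s : AddCircle (2 * Real.pi * L))) - b x₁ < 0 := by
    refine lt_of_le_of_lt hd1 (by linarith)
  have h2 := mul_le_mul_of_nonneg_right hq (hb0 x₁).le
  have h3 := mul_neg_of_pos_of_neg hq0 h1
  nlinarith

section

variable {L : ℝ} [Fact (0 < L)] {n : ℤ} {σ ε : ℝ}

omit [Fact (0 < L)] in
theorem hasDx_sech_mul_synth {w : ℂ} (hw : ‖w‖ < 1 / 4) {f : ModeSeq}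
    (hf : groundPairing (f 1) = 0) :
    HasDx (fun p : Cyl L => sech (σ * p.1) * synth L n σ ε 0 w (modeSol f) p)
      (fun p => σ * (sech (σ * p.1) * synth L n σ ε 0 w (modeSol' f) p)) :=
  fun x y => hasDerivAt_synth_fst L n σ ε hw (hasDerivAt_modeSol hf) x y

/-- For 0 ≤ σx ≤ 2 the quotient by sech is at least 6 sech 2 - 3 sech 2 > 0. For σx ≥ 2 one has sech
≤ 1/2, so the quotient is at most 9/2 and φ/σ² at most 9/4 in modulus. With |γ| < 1 the coefficient
4 + γ - φ/σ² then lies between 0 and 9, and the minimum principle applies with κ = 3σ. Evenness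
covers x < 0. -/
theorem solFun_pos (hσ : 0 < σ) (hk : waveNumber L n ^ 2 = 5 * σ ^ 2) {w : ℂ}
    (hw : ‖w‖ < 1 / 4) {γ : ℝ} (hγ : |γ| < 1) {f : ModeSeq}
    (h : modeSystem ((ε, ‖w‖ ^ 2), (f, γ)) = 0)
    (hc : ∀ p : Cyl L, |synth L n σ ε 0 w (modeSol f) p - 6 * sech (σ * p.1)| ≤ 3 * sech 2)
    (p : Cyl L) : 0 < solFun L n σ ε w f p := by
  have ht : |‖w‖ ^ 2| < 1 / 4 := by
    rw [abs_of_nonneg (by positivity)]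
    nlinarith [norm_nonneg w]
  have hf1 : groundPairing (f 1) = 0 := (Prod.mk_eq_zero.1 h).2
  have hs2 : sech 2 ≤ 1 / 2 := by linarith [mul_sech_le_one (z := 2) zero_le_two]
  have hs0 := sech_pos 2
  have hanti : ∀ {a b : ℝ}, 0 ≤ a → a ≤ b → sech b ≤ sech a := fun {a b} ha hab =>
    inv_anti₀ (Real.cosh_pos a) (Real.cosh_le_cosh.2 (by
      rwa [abs_of_nonneg ha, abs_of_nonneg (ha.trans hab)]))
  have key : ∀ x, 0 ≤ x → ∀ y, 0 < sech (σ * x) * synth L n σ ε 0 w (modeSol f) (x, y) := by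
    have hin : ∀ x, 0 ≤ x → x ≤ 2 / σ → ∀ y,
        0 < sech (σ * x) * synth L n σ ε 0 w (modeSol f) (x, y) := fun x hx0 hx y => by
      refine mul_pos (sech_pos _) ?_
      have h1 := (abs_le.1 (hc (x, y))).1
      have h2 : sech 2 ≤ sech (σ * x) := hanti (by positivity) (by
        rwa [le_div_iff₀ hσ, mul_comm] at hx)
      dsimp only at h1
      linarith
    intro x hx0 y
    rcases le_total x (2 / σ) with hx | hx
    · exact hin x hx0 hx y
    refine pos_of_laplacian_eq (v := fun p => sech (σ * p.1) * synth L n σ ε 0 w (modeSol f) p)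
      (vxx := fun p => sech (σ * p.1) * (σ ^ 2 * ((4 + γ) * synth L n σ ε 0 w (modeSol f) p
        - synth L n σ ε 0 w (modeBilin ε (‖w‖ ^ 2) (modeSol f) (modeSol f)) p)
        - synth L n σ ε 2 w (modeSol f) p))
      (vy := fun p => sech (σ * p.1) * synth L n σ ε 1 w (modeSol f) p)
      (vyy := fun p => sech (σ * p.1) * synth L n σ ε 2 w (modeSol f) p)
      (X := 2 / σ) (κ := 3 * σ)
      ((continuous_sech.comp (by fun_prop)).mul (BddFun.continuous _))
      (hasDx_sech_mul_synth hw hf1)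
      (fun x y => hasDerivAt_synth_fst_fst ε hk hw (hasDerivAt_modeSol' ht h) x y)
      (fun x y => (hasDerivAt_synth_snd L n σ ε one_le_two hw (modeSol f) x y).const_mul (sech (σ * x)))
      (fun x y => (hasDerivAt_synth_snd L n σ ε le_rfl hw (modeSol f) x y).const_mul (sech (σ * x)))
      (by positivity) (fun y => hin _ (by positivity) le_rfl y) ?_ ?_ hx y
    · intro x hx y
      have hsx : sech (σ * x) ≤ sech 2 := hanti zero_le_two (by
        rwa [div_le_iff₀ hσ, mul_comm] at hx)
      have h0 := sech_pos (σ * x)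
      have h1 := abs_le.1 (hc (x, y))
      dsimp only at h1
      set g := synth L n σ ε 0 w (modeSol f) (x, y) with hg
      have hg1 : |g| ≤ 9 / 2 := abs_le.2 ⟨by linarith, by linarith⟩
      have hv : |sech (σ * x) * g| ≤ 9 / 4 := by
        rw [abs_mul, abs_of_pos h0]
        calc sech (σ * x) * |g| ≤ 1 / 2 * (9 / 2) := by gcongr; exact hsx.trans hs2
          _ = 9 / 4 := by norm_num
      have hv' := abs_le.1 hv
      have hγ' := abs_lt.1 hγ
      have hσ2 : 0 < σ ^ 2 := by positivity
      refine ⟨σ ^ 2 * (4 + γ - sech (σ * x) * g), mul_pos hσ2 (by linarith), ?_, ?_⟩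
      · rw [mul_pow, mul_comm]
        exact mul_le_mul_of_nonneg_right (by linarith) hσ2.le
      · dsimp only
        rw [synth_modeBilin L n σ ε hw]
        ring
    · intro e he
      have h1 : Tendsto (fun x => sech (σ * x) * ‖synth L n σ ε 0 w (modeSol f)‖) atTop (𝓝 0) := by
        simpa using (tendsto_sech_atTop.comp (tendsto_id.const_mul_atTop hσ)).mul_const
          ‖synth L n σ ε 0 w (modeSol f)‖
      obtain ⟨R, hR⟩ := eventually_atTop.1 (h1.eventually (gt_mem_nhds he))
      refine ⟨R, fun x hx y => lt_of_le_of_lt ?_ (hR x hx)⟩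
      rw [abs_mul, abs_of_pos (sech_pos _)]
      exact mul_le_mul_of_nonneg_left (BddFun.norm_coe_le_norm _ _) (sech_pos _).le
  obtain ⟨x, y⟩ := p
  have hpos : ∀ x, 0 ≤ x → 0 < solFun L n σ ε w f (x, y) := fun x hx =>
    mul_pos (by positivity) (key x hx y)
  rcases le_total 0 x with hx | hx
  · exact hpos x hx
  · rw [← solFun_neg hw]
    exact hpos (-x) (by linarith)

end

/-! ### Taylor expansion to first order -/

/-- The derivative is differentiable at 0, so it differs from its value there by O(|x|), and the
mean value inequality on the ball of radius |a| gives the second factor. -/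
theorem ContDiffAt.taylor_one_isBigO {E F : Type*} [NormedAddCommGroup E] [NormedSpace ℝ E]
    [NormedAddCommGroup F] [NormedSpace ℝ F] {f : E → F} {f' : E →L[ℝ] F} (hf : ContDiffAt ℝ 2 f 0)
    (hf' : HasFDerivAt f f' 0) : (fun a => f a - f 0 - f' a) =O[𝓝 0] fun a => ‖a‖ ^ 2 := by
  have h1 : ContDiffAt ℝ 1 (fderiv ℝ f) 0 := hf.fderiv_right (by norm_num)
  have h2 : (fun x => fderiv ℝ f x - fderiv ℝ f 0) =O[𝓝 0] fun x => x - 0 :=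
    (h1.differentiableAt one_ne_zero).isBigO_sub
  obtain ⟨K, hK⟩ := h2.bound
  have hd : ∀ᶠ x in 𝓝 (0 : E), DifferentiableAt ℝ f x :=
    (hf.eventually (by simp)).mono fun x hx => hx.differentiableAt two_ne_zero
  obtain ⟨r, hr, hball⟩ := Metric.eventually_nhds_iff_ball.1 (hK.and hd)
  have hK0 : ∀ x ∈ Metric.ball (0 : E) r, ‖fderiv ℝ f x - f'‖ ≤ |K| * ‖x‖ := fun x hx => by
    have := (hball x hx).1
    rw [sub_zero, hf'.fderiv] at this
    exact this.trans (mul_le_mul_of_nonneg_right (le_abs_self K) (norm_nonneg x))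
  refine IsBigO.of_bound |K| ?_
  filter_upwards [Metric.ball_mem_nhds (0 : E) hr] with a ha
  have ha' : ‖a‖ < r := by simpa using ha
  have hsub : ∀ x ∈ Metric.closedBall (0 : E) ‖a‖, x ∈ Metric.ball (0 : E) r := fun x hx =>
    Metric.closedBall_subset_ball ha' hx
  have h := Convex.norm_image_sub_le_of_norm_fderiv_le' (𝕜 := ℝ) (f := f) (φ := f')
    (C := |K| * ‖a‖) (s := Metric.closedBall (0 : E) ‖a‖) (x := 0) (y := a)
    (fun x hx => (hball x (hsub x hx)).2)
    (fun x hx => (hK0 x (hsub x hx)).trans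
      (mul_le_mul_of_nonneg_left (by simpa using hx) (abs_nonneg K)))
    (convex_closedBall _ _) (by simp) (by simp)
  rw [sub_zero] at h
  refine h.trans_eq ?_
  rw [Real.norm_eq_abs, abs_of_nonneg (by positivity : (0 : ℝ) ≤ ‖a‖ ^ 2)]
  ring

/-! ### Integrals over the cylinder -/

theorem integral_even_comp_mul {g : ℝ → ℝ} (hg : ∀ x, g (-x) = g x) {σ : ℝ} (hσ : 0 < σ) :
    ∫ x, g (σ * x) = 2 / σ * ∫ x in Set.Ioi 0, g x := by
  have h1 : ∀ x, g |x| = g x := fun x => by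
    rcases abs_choice x with h | h <;> rw [h]
    exact hg x
  rw [Measure.integral_comp_mul_left, ← integral_congr_ae (ae_of_all _ h1),
    integral_comp_abs (f := g), smul_eq_mul, abs_of_pos (inv_pos.2 hσ)]
  ring

theorem integral_sech_pow_comp_mul (m : ℕ) {σ : ℝ} (hσ : 0 < σ) :
    ∫ x, sech (σ * x) ^ m = 2 / σ * sechMoment m :=
  integral_even_comp_mul (g := fun x => sech x ^ m) (fun x => by simp only [sech_neg]) hσ

section Circle

variable {L : ℝ} [hL : Fact (0 < L)]

theorem integral_circle (f : AddCircle (2 * Real.pi * L) → ℝ) :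
    ∫ y, f y = ∫ y in (0 : ℝ)..2 * Real.pi * L, f y := by
  rw [← AddCircle.intervalIntegral_preimage (2 * Real.pi * L) 0 f, zero_add]

theorem integral_circle_const (r : ℝ) :
    ∫ _ : AddCircle (2 * Real.pi * L), r = 2 * Real.pi * L * r := by
  rw [integral_circle, intervalIntegral.integral_const, sub_zero, smul_eq_mul]

omit hL in
theorem continuous_re_mul_circleWave_pow (n : ℤ) (q : ℂ) (m : ℕ) :
    Continuous fun y : AddCircle (2 * Real.pi * L) => (q * circleWave L n y ^ m).re :=
  Complex.continuous_re.comp (continuous_const.mul ((continuous_circleWave L n).pow m))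

theorem integrable_circle {f : AddCircle (2 * Real.pi * L) → ℝ} (hf : Continuous f) :
    Integrable f :=
  hf.integrable_of_hasCompactSupport (HasCompactSupport.of_compactSpace f)

theorem integral_re_mul_circleWave_pow {n : ℤ} (hn : n ≠ 0) (q : ℂ) {m : ℕ} (hm : m ≠ 0) :
    ∫ y : AddCircle (2 * Real.pi * L), (q * circleWave L n y ^ m).re = 0 := by
  have hk : (-(m * waveNumber L n) * Complex.I : ℂ) ≠ 0 := by
    have h1 : (waveNumber L n : ℂ) ≠ 0 := by
      rw [waveNumber]
      exact_mod_cast div_ne_zero (Int.cast_ne_zero.2 hn) hL.out.ne'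
    have h2 : (m : ℂ) ≠ 0 := Nat.cast_ne_zero.2 hm
    exact mul_ne_zero (neg_ne_zero.2 (mul_ne_zero h2 h1)) Complex.I_ne_zero
  set k : ℂ := -(m * waveNumber L n) * Complex.I with hk'
  let G : AddCircle (2 * Real.pi * L) → ℝ := fun y => (q / k * circleWave L n y ^ m).re
  have hd : ∀ y : ℝ, HasDerivAt (fun y : ℝ => G y) (q * circleWave L n y ^ m).re y := fun y => by
    have h := Complex.reCLM.hasFDerivAt.comp_hasDerivAt y
      ((hasDerivAt_circleWave_pow L n m y).const_mul (q / k))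
    convert! h using 1
    rw [Complex.reCLM_apply, ← hk', ← mul_assoc, div_mul_cancel₀ _ hk]
  rw [integral_circle, intervalIntegral.integral_eq_sub_of_hasDerivAt (fun y _ => hd y)
    (((continuous_re_mul_circleWave_pow n q m).comp (AddCircle.continuous_mk' _)).intervalIntegrable
      _ _)]
  rw [AddCircle.coe_period, QuotientAddGroup.mk_zero, sub_self]

theorem integral_re_mul_circleWave_sq {n : ℤ} (hn : n ≠ 0) (q : ℂ) :
    ∫ y : AddCircle (2 * Real.pi * L), (q * circleWave L n y).re ^ 2 = Real.pi * L * ‖q‖ ^ 2 := by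
  have h : ∀ y : AddCircle (2 * Real.pi * L), (q * circleWave L n y).re ^ 2
      = 1 / 2 * (‖q‖ ^ 2 + (q ^ 2 * circleWave L n y ^ 2).re) := fun y => by
    have h1 := norm_circleWave L n y
    have h2 : ‖q‖ ^ 2 = ‖q * circleWave L n y‖ ^ 2 := by rw [norm_mul, h1, mul_one]
    rw [h2, ← mul_pow, ← Complex.normSq_eq_norm_sq, Complex.normSq_apply, pow_two (q * _),
      Complex.mul_re (q * _)]
    ring
  simp only [h]
  rw [integral_const_mul, integral_add (integrable_const _)
    (integrable_circle (continuous_re_mul_circleWave_pow n _ 2)), integral_circle_const,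
    integral_re_mul_circleWave_pow hn _ two_ne_zero]
  ring

theorem integral_cyl_mul (F : ℝ → ℝ) (G : AddCircle (2 * Real.pi * L) → ℝ) :
    ∫ p : Cyl L, F p.1 * G p.2 = (∫ x, F x) * ∫ y, G y :=
  integral_prod_mul F G

end Circle

/-! ### The line soliton and its transverse directions -/

section Soliton

variable {L : ℝ} {σ : ℝ}

theorem lineSoliton_eq (hσ : 0 < σ) (x : ℝ) :
    lineSoliton (4 * σ ^ 2) x = 6 * σ ^ 2 * sech (σ * x) ^ 2 := by
  have h : Real.sqrt (4 * σ ^ 2) = 2 * σ := by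
    rw [show 4 * σ ^ 2 = (2 * σ) ^ 2 by ring, Real.sqrt_sq (by positivity)]
  rw [lineSoliton, h, sech, inv_pow, show 2 * σ * x / 2 = σ * x by ring]
  ring

theorem lineSoliton_rpow (hσ : 0 < σ) (x : ℝ) :
    lineSoliton (4 * σ ^ 2) x ^ (3 / 2 : ℝ) = 6 * Real.sqrt 6 * σ ^ 3 * sech (σ * x) ^ 3 := by
  have hs := sech_pos (σ * x)
  have h0 : 6 * σ ^ 2 * sech (σ * x) ^ 2 = (Real.sqrt 6 * (σ * sech (σ * x))) ^ 2 := by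
    rw [mul_pow, Real.sq_sqrt (by norm_num)]
    ring
  have hp : 0 ≤ Real.sqrt 6 * (σ * sech (σ * x)) := by positivity
  rw [lineSoliton_eq hσ, h0, ← Real.rpow_natCast, ← Real.rpow_mul hp,
    show ((2 : ℕ) : ℝ) * (3 / 2) = (3 : ℕ) by norm_num, Real.rpow_natCast]
  have h6 : Real.sqrt 6 ^ 3 = 6 * Real.sqrt 6 := by
    rw [pow_succ, Real.sq_sqrt (by norm_num)]
  rw [mul_pow, h6]
  ring

theorem lineQ_eq (hσ : 0 < σ) (p : Cyl L) :
    lineQ L (4 * σ ^ 2) p = 6 * σ ^ 2 * sech (σ * p.1) ^ 2 := lineSoliton_eq hσ p.1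

theorem re_mul_circleWave (n : ℤ) (q : ℂ) (y : AddCircle (2 * Real.pi * L)) :
    (q * circleWave L n y).re = q.re * cosMode L n y + q.im * sinMode L n y := by
  simp [circleWave, Complex.mul_re]

/-- A combination of the two transverse directions. -/
theorem cosDir_add_sinDir (hσ : 0 < σ) (n : ℤ) (q : ℂ) (p : Cyl L) :
    q.re * cosDir L (4 * σ ^ 2) n p + q.im * sinDir L (4 * σ ^ 2) n p
      = 6 * Real.sqrt 6 * σ ^ 3 * sech (σ * p.1) ^ 3 * (q * circleWave L n p.2).re := by
  rw [cosDir, sinDir, lineSoliton_rpow hσ, re_mul_circleWave]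
  ring

variable [hL : Fact (0 < L)]

theorem normSqL2_lineQ (hσ : 0 < σ) : normSqL2 (lineQ L (4 * σ ^ 2)) = 96 * Real.pi * L * σ ^ 3 := by
  have h : ∀ p : Cyl L, |lineQ L (4 * σ ^ 2) p| ^ 2 = 36 * σ ^ 4 * sech (σ * p.1) ^ 4 * 1 := fun p => by
    rw [sq_abs, lineQ_eq hσ]
    ring
  rw [normSqL2]
  simp only [h]
  rw [integral_cyl_mul (fun x => 36 * σ ^ 4 * sech (σ * x) ^ 4) fun _ => 1, integral_const_mul,
    integral_sech_pow_comp_mul 4 hσ, sechMoment_four, integral_circle_const]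
  field_simp
  ring

theorem integral_transverse_sq (hσ : 0 < σ) {n : ℤ} (hn : n ≠ 0) (q : ℂ) :
    ∫ p : Cyl L, (6 * Real.sqrt 6 * σ ^ 3 * sech (σ * p.1) ^ 3 * (q * circleWave L n p.2).re) ^ 2
      = 1152 / 5 * Real.pi * L * σ ^ 5 * ‖q‖ ^ 2 := by
  have h : ∀ p : Cyl L,
      (6 * Real.sqrt 6 * σ ^ 3 * sech (σ * p.1) ^ 3 * (q * circleWave L n p.2).re) ^ 2
        = 216 * σ ^ 6 * sech (σ * p.1) ^ 6 * (q * circleWave L n p.2).re ^ 2 := fun p => by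
    have h6 := Real.sq_sqrt (show (0 : ℝ) ≤ 6 by norm_num)
    linear_combination (36 * σ ^ 6 * sech (σ * p.1) ^ 6 * (q * circleWave L n p.2).re ^ 2) * h6
  simp only [h]
  rw [integral_cyl_mul (fun x => 216 * σ ^ 6 * sech (σ * x) ^ 6)
    fun y => (q * circleWave L n y).re ^ 2, integral_const_mul, integral_sech_pow_comp_mul 6 hσ,
    sechMoment_six, integral_re_mul_circleWave_sq hn]
  field_simp
  ring

theorem normSqL2_cosDir (hσ : 0 < σ) {n : ℤ} (hn : n ≠ 0) :
    normSqL2 (cosDir L (4 * σ ^ 2) n) = 1152 / 5 * Real.pi * L * σ ^ 5 := by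
  have h : ∀ p : Cyl L, |cosDir L (4 * σ ^ 2) n p| ^ 2
      = (6 * Real.sqrt 6 * σ ^ 3 * sech (σ * p.1) ^ 3 * (1 * circleWave L n p.2).re) ^ 2 := fun p => by
    rw [sq_abs, ← cosDir_add_sinDir hσ]
    simp
  rw [normSqL2]
  simp only [h]
  rw [integral_transverse_sq hσ hn, norm_one]
  ring

end Soliton

/-! ### Expansion of the family of solutions -/

theorem HasFDerivAt.norm_sq_sub_isLittleO {E F : Type*} [NormedAddCommGroup E] [NormedSpace ℝ E]
    [NormedAddCommGroup F] [NormedSpace ℝ F] {f : E → F} {f' : E →L[ℝ] F}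
    (hf : HasFDerivAt f f' 0) :
    (fun a => ‖f a - f 0‖ ^ 2 - ‖f' a‖ ^ 2) =o[𝓝 0] fun a => ‖a‖ ^ 2 := by
  have h1 : (fun a => f a - f 0 - f' a) =o[𝓝 0] fun a => a := by
    simpa using hf.isLittleO
  have h2 : (fun a => f' a) =O[𝓝 0] fun a => a := f'.isBigO_id _
  have h3 : (fun a => f a - f 0) =O[𝓝 0] fun a => a := by
    simpa using hf.isBigO_sub
  have h4 : (fun a => ‖f a - f 0‖ - ‖f' a‖) =o[𝓝 0] fun a => ‖a‖ :=
    (IsBigO.of_bound 1 (Eventually.of_forall fun a => by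
      rw [one_mul, Real.norm_eq_abs]
      exact abs_norm_sub_norm_le _ _) : _ =O[𝓝 0] fun a => f a - f 0 - f' a).trans_isLittleO
      h1.norm_right
  have h5 : (fun a => ‖f a - f 0‖ + ‖f' a‖) =O[𝓝 0] fun a => ‖a‖ :=
    (h3.norm_norm).add h2.norm_norm
  refine (h4.mul_isBigO h5).congr (fun a => by ring) fun a => by ring

/-- The amplitude `κ (a₀ + i a₁)`. -/
noncomputable def amplitude (κ : ℝ) : EuclideanSpace ℝ (Fin 2) →L[ℝ] ℂ :=
  κ • (Complex.orthonormalBasisOneI.repr.symm.toContinuousLinearEquiv :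
    EuclideanSpace ℝ (Fin 2) →L[ℝ] ℂ)

theorem amplitude_apply (κ : ℝ) (a : EuclideanSpace ℝ (Fin 2)) :
    amplitude κ a = κ • ((a 0 : ℂ) + a 1 * Complex.I) := by
  rw [← Complex.orthonormalBasisOneI_repr_symm_apply]
  rfl

theorem norm_amplitude_sq (κ : ℝ) (a : EuclideanSpace ℝ (Fin 2)) :
    ‖amplitude κ a‖ ^ 2 = κ ^ 2 * ‖a‖ ^ 2 := by
  rw [amplitude_apply, ← Complex.orthonormalBasisOneI_repr_symm_apply, norm_smul,
    LinearIsometryEquiv.norm_map, mul_pow, Real.norm_eq_abs, sq_abs]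

/-- The square of the norm has a minimum at 0. Hence everything that depends on the amplitude
through t is stationary, and the first order variation of the solution comes from w in mode 1 alone.
-/
theorem hasFDerivAt_norm_amplitude_sq (κ : ℝ) :
    HasFDerivAt (fun a => ‖amplitude κ a‖ ^ 2) (0 : EuclideanSpace ℝ (Fin 2) →L[ℝ] ℝ) 0 := by
  have hd : DifferentiableAt ℝ (fun a => ‖amplitude κ a‖ ^ 2) 0 :=
    ((amplitude κ).differentiableAt.norm_sq ℝ)
  have hm : IsLocalMin (fun a => ‖amplitude κ a‖ ^ 2) 0 :=
    Eventually.of_forall fun a => by simp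
  rw [← hm.fderiv_eq_zero]
  exact hd.hasFDerivAt

theorem modeSol_apply (f : ModeSeq) (m : ℕ) : modeSol f m = baseSeq m + modeOp m (f m) := by
  rw [modeSol, SeqL1.add_apply, solOp_apply]

theorem modeSol_of_lowProj {f : ModeSeq} (h : lowProj f = 0) {m : ℕ} (hm : m < 2) :
    modeSol f m = baseSeq m := by
  have h0 : f m = 0 := by rw [← lowProj_apply_of_lt hm, h, SeqL1.zero_apply]
  rw [modeSol_apply, h0, map_zero, add_zero]

/-! ### First derivative and inner products of the synthesis. -/

section Synthesis

variable {L : ℝ} {n : ℤ} {σ ε : ℝ}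

theorem hasFDerivAt_synth_comp {E : Type*} [NormedAddCommGroup E] [NormedSpace ℝ E]
    (w : E →L[ℝ] ℂ) {u : E → ModeSeq} (hu : HasFDerivAt u (0 : E →L[ℝ] ModeSeq) 0) :
    HasFDerivAt (fun a => synth L n σ ε 0 (w a) (u a))
      (((synthCoeff L n σ ε 0 1).flip (u 0)).comp w) 0 := by
  have h1 : HasFDerivAt (synth L n σ ε 0) (synthCoeff L n σ ε 0 1) (w 0) := by
    rw [map_zero]
    exact hasFDerivAt_opSum_zero (norm_synthCoeff_le L n σ ε zero_le_two)
  have h2 := (h1.comp (0 : E) w.hasFDerivAt).clm_apply hu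
  convert! h2 using 1
  ext a p
  simp

/-- The function `sech (σ x)` on the cylinder. -/
noncomputable def sechCyl (L σ : ℝ) : BddFun (Cyl L) :=
  BddFun.ofBound (fun p => sech (σ * p.1)) (continuous_sech.comp (by fun_prop)) 1 fun p => by
    rw [abs_of_pos (sech_pos _)]
    exact sech_le_one _

theorem sechCyl_apply (p : Cyl L) : sechCyl L σ p = sech (σ * p.1) := rfl

theorem synth_zero_apply (u : ModeSeq) (p : Cyl L) : synth L n σ ε 0 0 u p = u 0 (σ * p.1) := by
  rw [synth, opSum_zero, synthCoeff_apply, modeAmp_zero, waveFactor_zero]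
  simp

theorem synth_zero_modeSol {f : ModeSeq} (h : lowProj f = 0) :
    synth L n σ ε 0 0 (modeSol f) = (6 : ℝ) • sechCyl L σ := by
  ext p
  rw [synth_zero_apply, modeSol_of_lowProj h two_pos, baseSeq_zero, BddFun.smul_apply,
    BddFun.smul_apply, sechPow_apply, sechCyl_apply, pow_one]

theorem synthCoeff_modeSol {f : ModeSeq} (h : lowProj f = 0) (q : ℂ) (p : Cyl L) :
    synthCoeff L n σ ε 0 1 q (modeSol f) p
      = ε * sech (σ * p.1) ^ 2 * (q * circleWave L n p.2).re := by
  rw [synthCoeff_apply, modeSol_of_lowProj h one_lt_two, baseSeq_one, sechPow_apply,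
    modeAmp_of_ne one_ne_zero, waveFactor_zero, one_mul, pow_one]

variable [hL : Fact (0 < L)]

theorem inner_toL2 (hσ : 0 < σ) (g h : BddFun (Cyl L)) :
    inner ℝ (toL2 hσ g) (toL2 hσ h) = ∫ p : Cyl L, sech (σ * p.1) ^ 2 * (g p * h p) := by
  rw [MeasureTheory.L2.inner_def]
  refine integral_congr_ae ?_
  filter_upwards [toL2_ae hσ g, toL2_ae hσ h] with p h1 h2
  rw [h1, h2, real_inner_eq_re_inner]
  simp
  ring

/-- The positive modes average to zero over the circle, so the soliton sees only mode 0. -/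
theorem inner_sechCyl_synth (hσ : 0 < σ) (hn : n ≠ 0) {w : ℂ} (hw : ‖w‖ < 1 / 4) {u : ModeSeq}
    (hu : ∀ z, u 0 (-z) = u 0 z) :
    inner ℝ (toL2 hσ (sechCyl L σ)) (toL2 hσ (synth L n σ ε 0 w u))
      = 4 * Real.pi * L / σ * solitonPairing (u 0) := by
  let ℓ : BddFun (Cyl L) →L[ℝ] ℝ := (innerSL ℝ (toL2 hσ (sechCyl L σ))).comp (toL2 hσ)
  have hterm : ∀ m, ℓ (synthCoeff L n σ ε 0 m (w ^ m) u)
      = (∫ x, sech (σ * x) ^ 2 * (sech (σ * x) * u m (σ * x)))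
        * ∫ y : AddCircle (2 * Real.pi * L), modeAmp ε m * (w ^ m * circleWave L n y ^ m).re := by
    intro m
    rw [← integral_cyl_mul (fun x => sech (σ * x) ^ 2 * (sech (σ * x) * u m (σ * x)))]
    refine (inner_toL2 hσ _ _).trans (integral_congr_ae (ae_of_all _ fun p => ?_))
    simp only [sechCyl_apply, synthCoeff_apply, waveFactor_zero, one_mul]
    ring
  have h := (hasSum_opSum (norm_synthCoeff_le L n σ ε zero_le_two) hw).mapL
    (ℓ.comp (ContinuousLinearMap.apply ℝ (BddFun (Cyl L)) u))
  have h0 := hasSum_single (f := fun m => ℓ (synthCoeff L n σ ε 0 m (w ^ m) u)) 0 fun m hm => by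
    rw [hterm, integral_const_mul, integral_re_mul_circleWave_pow hn _ hm, mul_zero, mul_zero]
  refine (h.unique h0).trans ?_
  rw [hterm, integral_even_comp_mul (g := fun z => sech z ^ 2 * (sech z * u 0 z))
    (fun z => by simp only [sech_neg, hu]) hσ, ← solitonPairing_apply]
  simp only [pow_zero, mul_one, Complex.one_re, modeAmp_zero]
  rw [integral_circle_const]
  ring

theorem normSqL2_coe (u : L2 L) : normSqL2 u = ‖u‖ ^ 2 := by
  rw [← real_inner_self_eq_norm_sq, MeasureTheory.L2.inner_def, normSqL2]
  refine integral_congr_ae (ae_of_all _ fun p => ?_)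
  simp [pow_two]

theorem normSqL2_congr {f g : Cyl L → ℝ} (h : f =ᵐ[volume] g) : normSqL2 f = normSqL2 g :=
  integral_congr_ae (h.mono fun p hp => by simp only [hp])

/-- The function underlying an element of `H²`, as a continuous linear map. -/
noncomputable def SobolevH.fnL : SobolevH L 2 →L[ℝ] L2 L :=
  (PiLp.proj 2 (fun _ : derivIdx 2 => L2 L) ⟨(0, 0), mem_derivIdx.2 (Nat.zero_le 2)⟩).comp
    (SobolevH L 2).subtypeL

theorem toL2_sechCyl_ae (hσ : 0 < σ) :
    (σ ^ 2 • toL2 hσ ((6 : ℝ) • sechCyl L σ) : L2 L) =ᵐ[volume] lineQ L (4 * σ ^ 2) := by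
  filter_upwards [Lp.coeFn_smul (σ ^ 2) (toL2 hσ ((6 : ℝ) • sechCyl L σ)),
    toL2_ae hσ ((6 : ℝ) • sechCyl L σ)] with p h1 h2
  rw [h1, Pi.smul_apply, h2, lineQ_eq hσ, BddFun.smul_apply, sechCyl_apply, smul_eq_mul,
    smul_eq_mul]
  ring

/-- The constant in the amplitude is chosen here: mode 1 contributes σ² ε sech³ Re(w e^{-iny/L}),
while Q^{3/2} = 6√6 σ³ sech³, so w must be 6√6 σ/ε times a₀ + i a₁. -/
theorem toL2_synthCoeff_ae (hσ : 0 < σ) (hε : ε ≠ 0) {f : ModeSeq} (h : lowProj f = 0)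
    (a : EuclideanSpace ℝ (Fin 2)) :
    (σ ^ 2 • toL2 hσ (synthCoeff L n σ ε 0 1 (amplitude (6 * Real.sqrt 6 * σ / ε) a) (modeSol f))
      : L2 L) =ᵐ[volume] fun p => 6 * Real.sqrt 6 * σ ^ 3 * sech (σ * p.1) ^ 3
        * (((a 0 : ℂ) + a 1 * Complex.I) * circleWave L n p.2).re := by
  filter_upwards [Lp.coeFn_smul (σ ^ 2) (toL2 hσ (synthCoeff L n σ ε 0 1
    (amplitude (6 * Real.sqrt 6 * σ / ε) a) (modeSol f))), toL2_ae hσ (synthCoeff L n σ ε 0 1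
    (amplitude (6 * Real.sqrt 6 * σ / ε) a) (modeSol f))] with p h1 h2
  rw [h1, Pi.smul_apply, h2, synthCoeff_modeSol h, amplitude_apply, Complex.real_smul, mul_assoc
    ((6 * Real.sqrt 6 * σ / ε : ℝ) : ℂ), Complex.re_ofReal_mul, smul_eq_mul]
  field_simp

end Synthesis

/-! ### The bifurcating branch -/

theorem norm_sq_eq_add (a : EuclideanSpace ℝ (Fin 2)) : ‖a‖ ^ 2 = a 0 ^ 2 + a 1 ^ 2 := by
  rw [EuclideanSpace.norm_sq_eq, Fin.sum_univ_two, Real.norm_eq_abs, Real.norm_eq_abs, sq_abs,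
    sq_abs]

theorem norm_lt_of_mem_openSquare {δ : ℝ} {a : EuclideanSpace ℝ (Fin 2)} (ha : a ∈ openSquare δ) :
    ‖a‖ < 2 * δ := by
  have h0 := ha 0
  have h1 := ha 1
  have hδ : 0 < δ := by linarith [h0.1, h0.2]
  refine lt_of_pow_lt_pow_left₀ 2 (by positivity) ?_
  rw [norm_sq_eq_add]
  nlinarith [h0.1, h0.2, h1.1, h1.2]

/-- The branch of amplitude solutions, evaluated along `t = |w|²`. -/
structure ModeBranch (ε τ : ℝ) (f : ℝ → ModeSeq) (γ : ℝ → ℝ) : Prop where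
  ε_pos : 0 < ε
  τ_pos : 0 < τ
  τ_le : τ ≤ 1 / 8
  contDiffAt_fst : ∀ t, |t| < τ → ContDiffAt ℝ 2 f t
  contDiffAt_snd : ∀ t, |t| < τ → ContDiffAt ℝ 2 γ t
  abs_lt : ∀ t, |t| < τ → |γ t| < 1
  system : ∀ t, |t| < τ → modeSystem ((ε, t), (f t, γ t)) = 0
  lowProj_zero : lowProj (f 0) = 0
  snd_zero : γ 0 = 0

namespace ModeBranch

variable {ε τ : ℝ} {f : ℝ → ModeSeq} {γ : ℝ → ℝ} (B : ModeBranch ε τ f γ)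
  {L : ℝ} {n : ℤ} {σ : ℝ}

/-- The amplitude of the mode `1`, normalised so that the branch is tangent to `Q^{3/2} cos` and
`Q^{3/2} sin`. -/
noncomputable def amp (ε σ : ℝ) : EuclideanSpace ℝ (Fin 2) →L[ℝ] ℂ :=
  amplitude (6 * Real.sqrt 6 * σ / ε)

theorem norm_amp_sq (ε σ : ℝ) (a : EuclideanSpace ℝ (Fin 2)) :
    ‖amp ε σ a‖ ^ 2 = 216 * σ ^ 2 / ε ^ 2 * ‖a‖ ^ 2 := by
  rw [amp, norm_amplitude_sq, div_pow, mul_pow, mul_pow, Real.sq_sqrt (by norm_num)]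
  ring

/-- The speed along the branch. -/
noncomputable def speed (ε σ : ℝ) (γ : ℝ → ℝ) (a : EuclideanSpace ℝ (Fin 2)) : ℝ :=
  σ ^ 2 * (4 + γ (‖amp ε σ a‖ ^ 2))

/-- The quotient of the solution by `σ² sech (σ x)`. -/
noncomputable def quot (L : ℝ) (n : ℤ) (ε σ : ℝ) (f : ℝ → ModeSeq)
    (a : EuclideanSpace ℝ (Fin 2)) : BddFun (Cyl L) :=
  synth L n σ ε 0 (amp ε σ a) (modeSol (f (‖amp ε σ a‖ ^ 2)))

theorem speed_radial (a : EuclideanSpace ℝ (Fin 2)) :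
    speed ε σ γ a = speed ε σ γ !₂[‖a‖, 0] := by
  have h : ‖(!₂[‖a‖, 0] : EuclideanSpace ℝ (Fin 2))‖ ^ 2 = ‖a‖ ^ 2 := by
    rw [norm_sq_eq_add]
    simp
  rw [speed, speed, norm_amp_sq, norm_amp_sq, h]

include B

theorem abs_zero_lt : |(0 : ℝ)| < τ := by rw [abs_zero]; exact B.τ_pos

theorem hasFDerivAt_modeSol :
    HasFDerivAt (fun a => modeSol (f (‖amp ε σ a‖ ^ 2)))
      (0 : EuclideanSpace ℝ (Fin 2) →L[ℝ] ModeSeq) 0 := by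
  have hf : HasFDerivAt f (fderiv ℝ f 0) (‖amp ε σ 0‖ ^ 2) := by
    rw [map_zero, norm_zero, zero_pow two_ne_zero]
    exact ((B.contDiffAt_fst 0 B.abs_zero_lt).differentiableAt two_ne_zero).hasFDerivAt
  have h1 := hf.comp (0 : EuclideanSpace ℝ (Fin 2))
    (hasFDerivAt_norm_amplitude_sq (6 * Real.sqrt 6 * σ / ε))
  have h2 := ((solOp.hasFDerivAt (x := f (‖amp ε σ 0‖ ^ 2))).comp
    (0 : EuclideanSpace ℝ (Fin 2)) h1).const_add baseSeq
  convert! h2 using 1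
  simp

theorem hasFDerivAt_quot :
    HasFDerivAt (quot L n ε σ f)
      (((synthCoeff L n σ ε 0 1).flip (modeSol (f 0))).comp (amp ε σ)) 0 := by
  have h := hasFDerivAt_synth_comp (L := L) (n := n) (σ := σ) (ε := ε) (amp ε σ)
    (B.hasFDerivAt_modeSol (σ := σ))
  rwa [map_zero, norm_zero, zero_pow two_ne_zero] at h

theorem quot_zero : quot L n ε σ f 0 = (6 : ℝ) • sechCyl L σ := by
  rw [quot, map_zero, norm_zero, zero_pow two_ne_zero, synth_zero_modeSol B.lowProj_zero]

/-- Near the origin the amplitude stays in the domain of the branch, and the solution is close to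
the soliton. -/
theorem exists_radius : ∃ r, 0 < r ∧ ∀ a : EuclideanSpace ℝ (Fin 2), ‖a‖ < r →
    ‖amp ε σ a‖ < 1 / 4 ∧ ‖amp ε σ a‖ ^ 2 < τ ∧
      ‖quot L n ε σ f a - (6 : ℝ) • sechCyl L σ‖ ≤ 3 * sech 2 := by
  have c1 : Tendsto (fun a => ‖amp ε σ a‖) (𝓝 0) (𝓝 0) := by
    have : Continuous fun a => ‖amp ε σ a‖ := by fun_prop
    simpa using this.tendsto 0
  have c2 : Tendsto (fun a => ‖amp ε σ a‖ ^ 2) (𝓝 0) (𝓝 0) := by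
    simpa using c1.pow 2
  have c3 : Tendsto (fun a => ‖quot L n ε σ f a - (6 : ℝ) • sechCyl L σ‖) (𝓝 0) (𝓝 0) := by
    rw [← B.quot_zero (L := L) (n := n) (σ := σ)]
    exact tendsto_iff_norm_sub_tendsto_zero.1 (B.hasFDerivAt_quot (L := L) (n := n)
      (σ := σ)).continuousAt
  obtain ⟨r, hr, h⟩ := Metric.eventually_nhds_iff_ball.1
    ((c1.eventually (gt_mem_nhds (by norm_num : (0 : ℝ) < 1 / 4))).and
      ((c2.eventually (gt_mem_nhds B.τ_pos)).and
        (c3.eventually (gt_mem_nhds (mul_pos three_pos (sech_pos 2))))))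
  refine ⟨r, hr, fun a ha => ?_⟩
  obtain ⟨h1, h2, h3⟩ := h a (by simpa using ha)
  exact ⟨h1, h2, h3.le⟩

theorem contDiffAt_speed {a : EuclideanSpace ℝ (Fin 2)} (ha : ‖amp ε σ a‖ ^ 2 < τ) :
    ContDiffAt ℝ 2 (speed ε σ γ) a := by
  have h1 : ContDiffAt ℝ 2 (fun a => ‖amp ε σ a‖ ^ 2) a :=
    ((amp ε σ).contDiff.norm_sq ℝ).contDiffAt
  have h2 : ContDiffAt ℝ 2 γ (‖amp ε σ a‖ ^ 2) :=
    B.contDiffAt_snd _ (by rwa [abs_of_nonneg (by positivity)])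
  exact contDiffAt_const.mul (contDiffAt_const.add (h2.comp a h1))

/-- With t = 216σ²|a|²/ε² the increment σ²γ't is 216σ⁴(γ'/ε²)|a|²; doubling the coefficient gives
432σ⁴γ'/ε². -/
theorem speed_isLittleO {γ' : ℝ} (hγ' : HasDerivAt γ γ' 0) :
    (fun a => speed ε σ γ a - (4 * σ ^ 2 + 432 * σ ^ 4 * (γ' / ε ^ 2) / 2 * ‖a‖ ^ 2))
      =o[𝓝 0] fun a : EuclideanSpace ℝ (Fin 2) => ‖a‖ ^ 2 := by
  have c2 : Tendsto (fun a : EuclideanSpace ℝ (Fin 2) => 216 * σ ^ 2 / ε ^ 2 * ‖a‖ ^ 2)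
      (𝓝 0) (𝓝 0) := by
    have : Continuous fun a : EuclideanSpace ℝ (Fin 2) => 216 * σ ^ 2 / ε ^ 2 * ‖a‖ ^ 2 := by
      fun_prop
    simpa using this.tendsto 0
  have h1 := (hasDerivAt_iff_isLittleO_nhds_zero.1 hγ').comp_tendsto c2
  have h2 : (fun a : EuclideanSpace ℝ (Fin 2) => 216 * σ ^ 2 / ε ^ 2 * ‖a‖ ^ 2)
      =O[𝓝 0] fun a => ‖a‖ ^ 2 := isBigO_const_mul_self _ _ _
  refine ((h1.trans_isBigO h2).const_mul_left (σ ^ 2)).congr_left fun a => ?_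
  simp only [Function.comp, zero_add, smul_eq_mul, B.snd_zero, speed, norm_amp_sq]
  ring

variable [hL : Fact (0 < L)]

omit B in
/-- The solutions along the branch. -/
noncomputable def sol (hσ : 0 < σ) (L : ℝ) [Fact (0 < L)] (n : ℤ) (ε : ℝ) (f : ℝ → ModeSeq)
    (γ : ℝ → ℝ) (a : EuclideanSpace ℝ (Fin 2)) : SobolevH L 2 :=
  solH hσ n ε (amp ε σ a) (γ (‖amp ε σ a‖ ^ 2)) (‖amp ε σ a‖ ^ 2) (f (‖amp ε σ a‖ ^ 2))

theorem contDiffAt_sol (hσ : 0 < σ) {a : EuclideanSpace ℝ (Fin 2)} (hw : ‖amp ε σ a‖ < 1 / 4)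
    (ha : ‖amp ε σ a‖ ^ 2 < τ) : ContDiffAt ℝ 2 (sol hσ L n ε f γ) a := by
  have h1 : ContDiffAt ℝ 2 (fun a => ‖amp ε σ a‖ ^ 2) a :=
    ((amp ε σ).contDiff.norm_sq ℝ).contDiffAt
  have h0 : |‖amp ε σ a‖ ^ 2| < τ := by rwa [abs_of_nonneg (by positivity)]
  exact contDiffAt_solH hσ hw (h0.trans_le (B.τ_le.trans (by norm_num)))
    (amp ε σ).contDiff.contDiffAt ((B.contDiffAt_snd _ h0).comp a h1) h1
    ((B.contDiffAt_fst _ h0).comp a h1)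

theorem system_amp {a : EuclideanSpace ℝ (Fin 2)} (ha : ‖amp ε σ a‖ ^ 2 < τ) :
    modeSystem ((ε, ‖amp ε σ a‖ ^ 2), (f (‖amp ε σ a‖ ^ 2), γ (‖amp ε σ a‖ ^ 2))) = 0 :=
  B.system _ (by rwa [abs_of_nonneg (by positivity)])

theorem fn_sol (hσ : 0 < σ) (hk : waveNumber L n ^ 2 = 5 * σ ^ 2) {a : EuclideanSpace ℝ (Fin 2)}
    (hw : ‖amp ε σ a‖ < 1 / 4) (ha : ‖amp ε σ a‖ ^ 2 < τ) :
    SobolevH.fn (sol hσ L n ε f γ a) = σ ^ 2 • toL2 hσ (quot L n ε σ f a) :=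
  solH_fn_eq hσ hk hw (B.system_amp ha)

theorem fnL_fderiv_sol (hσ : 0 < σ) (hk : waveNumber L n ^ 2 = 5 * σ ^ 2)
    {φ' : EuclideanSpace ℝ (Fin 2) →L[ℝ] SobolevH L 2}
    (hφ' : HasFDerivAt (sol hσ L n ε f γ) φ' 0) (a : EuclideanSpace ℝ (Fin 2)) :
    SobolevH.fn (φ' a) = σ ^ 2 • toL2 hσ (synthCoeff L n σ ε 0 1 (amp ε σ a) (modeSol (f 0))) := by
  have h1 := (SobolevH.fnL (L := L)).hasFDerivAt.comp (0 : EuclideanSpace ℝ (Fin 2)) hφ'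
  have h2 := ((σ ^ 2 • toL2 (L := L) hσ).hasFDerivAt.comp (0 : EuclideanSpace ℝ (Fin 2))
    (B.hasFDerivAt_quot (L := L) (n := n) (σ := σ)))
  obtain ⟨r, hr, hB⟩ := B.exists_radius (L := L) (n := n) (σ := σ)
  have h3 : (SobolevH.fnL (L := L) ∘ sol hσ L n ε f γ)
      =ᶠ[𝓝 0] ((σ ^ 2 • toL2 (L := L) hσ) ∘ quot L n ε σ f) := by
    filter_upwards [Metric.ball_mem_nhds (0 : EuclideanSpace ℝ (Fin 2)) hr] with a ha
    obtain ⟨hw, ht, -⟩ := hB a (by simpa using ha)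
    exact B.fn_sol hσ hk hw ht
  exact congr($(h1.unique (h2.congr_of_eventuallyEq h3)) a)

theorem transverse_ae (hσ : 0 < σ) (a : EuclideanSpace ℝ (Fin 2)) :
    (σ ^ 2 • toL2 hσ (synthCoeff L n σ ε 0 1 (amp ε σ a) (modeSol (f 0))) : L2 L) =ᵐ[volume]
      fun p => a 0 * cosDir L (4 * σ ^ 2) n p + a 1 * sinDir L (4 * σ ^ 2) n p := by
  filter_upwards [toL2_synthCoeff_ae (L := L) (n := n) hσ B.ε_pos.ne' B.lowProj_zero a] with p hp
  have hre : ((a 0 : ℂ) + a 1 * Complex.I).re = a 0 := by simp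
  have him : ((a 0 : ℂ) + a 1 * Complex.I).im = a 1 := by simp
  have h := cosDir_add_sinDir hσ n ((a 0 : ℂ) + a 1 * Complex.I) p
  rw [hre, him] at h
  rw [h]
  exact hp

theorem norm_transverse_sq (hσ : 0 < σ) (hn : n ≠ 0) (a : EuclideanSpace ℝ (Fin 2)) :
    ‖(σ ^ 2 • toL2 hσ (synthCoeff L n σ ε 0 1 (amp ε σ a) (modeSol (f 0))) : L2 L)‖ ^ 2
      = 1152 / 5 * Real.pi * L * σ ^ 5 * ‖a‖ ^ 2 := by
  rw [← normSqL2_coe]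
  refine (normSqL2_congr
    (toL2_synthCoeff_ae (L := L) (n := n) hσ B.ε_pos.ne' B.lowProj_zero a)).trans ?_
  rw [normSqL2]
  simp only [sq_abs]
  rw [integral_transverse_sq hσ hn, ← Complex.orthonormalBasisOneI_repr_symm_apply,
    LinearIsometryEquiv.norm_map]

theorem inner_quot (hσ : 0 < σ) (hn : n ≠ 0) {a : EuclideanSpace ℝ (Fin 2)}
    (hw : ‖amp ε σ a‖ < 1 / 4) :
    inner ℝ (σ ^ 2 • toL2 hσ (quot L n ε σ f 0)) (σ ^ 2 • toL2 hσ (quot L n ε σ f a))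
      = 24 * Real.pi * L * σ ^ 3 * (solitonPairing ((6 : ℝ) • sechPow 1)
        + solitonPairing (modeOp 0 (f (‖amp ε σ a‖ ^ 2) 0))) := by
  rw [B.quot_zero, map_smul, inner_smul_left, inner_smul_right, inner_smul_left, quot,
    inner_sechCyl_synth hσ hn hw (modeSol_neg _ 0), modeSol_apply, baseSeq_zero, map_add]
  simp only [conj_trivial]
  field_simp
  ring

/-- Expand ‖F a‖² around ‖F 0‖². The cross term sees only mode 0 and contributes 48πLσ³ · (3γ'/4 -
ε²/20) · 216σ²/ε² = (7776γ'/ε² - 518.4)πLσ⁵. The square of the increment is, to leading order, that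
of the transverse direction and contributes 230.4πLσ⁵. Together they are (7776γ'/ε² - 288)πLσ⁵ per
|a|². -/
theorem mass_isLittleO (hσ : 0 < σ) (hk : waveNumber L n ^ 2 = 5 * σ ^ 2) (hn : n ≠ 0) {γ' : ℝ}
    (hP : HasDerivAt (fun t => solitonPairing (modeOp 0 (f t 0))) (3 / 4 * γ' - ε ^ 2 / 20) 0) :
    (fun a => normSqL2 (SobolevH.fn (sol hσ L n ε f γ a)) - (normSqL2 (lineQ L (4 * σ ^ 2))
        + (15552 * (γ' / ε ^ 2) - 576) * Real.pi * L * σ ^ 5 / 2 * ‖a‖ ^ 2))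
      =o[𝓝 0] fun a : EuclideanSpace ℝ (Fin 2) => ‖a‖ ^ 2 := by
  let F : EuclideanSpace ℝ (Fin 2) → L2 L := fun a => σ ^ 2 • toL2 hσ (quot L n ε σ f a)
  have hF := (σ ^ 2 • toL2 (L := L) hσ).hasFDerivAt.comp (0 : EuclideanSpace ℝ (Fin 2))
    (B.hasFDerivAt_quot (L := L) (n := n) (σ := σ))
  have e1 := hF.norm_sq_sub_isLittleO
  have c2 : Tendsto (fun a : EuclideanSpace ℝ (Fin 2) => 216 * σ ^ 2 / ε ^ 2 * ‖a‖ ^ 2)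
      (𝓝 0) (𝓝 0) := by
    have : Continuous fun a : EuclideanSpace ℝ (Fin 2) => 216 * σ ^ 2 / ε ^ 2 * ‖a‖ ^ 2 := by
      fun_prop
    simpa using this.tendsto 0
  have h1 := (hasDerivAt_iff_isLittleO_nhds_zero.1 hP).comp_tendsto c2
  have h2 : (fun a : EuclideanSpace ℝ (Fin 2) => 216 * σ ^ 2 / ε ^ 2 * ‖a‖ ^ 2)
      =O[𝓝 0] fun a => ‖a‖ ^ 2 := isBigO_const_mul_self _ _ _
  have e2 := (h1.trans_isBigO h2).const_mul_left (48 * Real.pi * L * σ ^ 3)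
  refine (e1.add e2).congr' ?_ EventuallyEq.rfl
  obtain ⟨r, hr, hB⟩ := B.exists_radius (L := L) (n := n) (σ := σ)
  filter_upwards [Metric.ball_mem_nhds (0 : EuclideanSpace ℝ (Fin 2)) hr] with a ha
  obtain ⟨hw, ht, -⟩ := hB a (by simpa using ha)
  have hw0 : ‖amp ε σ 0‖ < 1 / 4 := by rw [map_zero, norm_zero]; norm_num
  have hQ : normSqL2 (lineQ L (4 * σ ^ 2)) = ‖F 0‖ ^ 2 := by
    rw [← normSqL2_coe, ← normSqL2_congr (toL2_sechCyl_ae (L := L) hσ), ← B.quot_zero]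
  have hM : normSqL2 (SobolevH.fn (sol hσ L n ε f γ a)) = ‖F a‖ ^ 2 := by
    rw [normSqL2_coe, B.fn_sol hσ hk hw ht]
  have i1 : inner ℝ (F 0) (F a) = _ := B.inner_quot hσ hn hw
  have i0 : inner ℝ (F 0) (F 0) = _ := B.inner_quot hσ hn hw0
  rw [map_zero, norm_zero, zero_pow two_ne_zero] at i0
  have hexp : ‖F a‖ ^ 2 = ‖F 0‖ ^ 2 + 2 * (inner ℝ (F 0) (F a) - inner ℝ (F 0) (F 0))
      + ‖F a - F 0‖ ^ 2 := by
    rw [norm_sub_sq_real, real_inner_self_eq_norm_sq, real_inner_comm]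
    ring
  have ht' : ‖(σ ^ 2 • toL2 hσ (synthCoeff L n σ ε 0 1 (amp ε σ a) (modeSol (f 0))) : L2 L)‖ ^ 2
    = _ := B.norm_transverse_sq hσ hn a
  have e3 : ‖(((σ ^ 2 • toL2 (L := L) hσ).comp
      (((synthCoeff L n σ ε 0 1).flip (modeSol (f 0))).comp (amp ε σ))) a)‖ ^ 2 = _ := ht'
  have e4 : ‖((σ ^ 2 • toL2 (L := L) hσ) ∘ quot L n ε σ f) a
      - ((σ ^ 2 • toL2 (L := L) hσ) ∘ quot L n ε σ f) 0‖ ^ 2 = ‖F a - F 0‖ ^ 2 := rfl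
  rw [e3, e4, hM, hQ, hexp, i1, i0, norm_amp_sq]
  simp only [Function.comp, zero_add, smul_eq_mul]
  have := B.ε_pos.ne'
  field_simp
  ring

/-- The remainder is the Taylor remainder of an H²-valued map, so its size in H² needs no
computation. Only the underlying functions of the value and of the derivative at 0 have to be
identified, which is done in L². -/
theorem expansion (hσ : 0 < σ) (hk : waveNumber L n ^ 2 = 5 * σ ^ 2) :
    ∃ R : EuclideanSpace ℝ (Fin 2) → SobolevH L 2,
      (∀ a, SobolevH.fn (sol hσ L n ε f γ a) =ᵐ[volume] fun p =>
        lineQ L (4 * σ ^ 2) p + a 0 * cosDir L (4 * σ ^ 2) n p + a 1 * sinDir L (4 * σ ^ 2) n p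
          + SobolevH.fn (R a) p) ∧
      R =O[𝓝 0] fun a => ‖a‖ ^ 2 := by
  have hw0 : ‖amp ε σ 0‖ < 1 / 4 := by rw [map_zero, norm_zero]; norm_num
  have ht0 : ‖amp ε σ 0‖ ^ 2 < τ := by
    rw [map_zero, norm_zero, zero_pow two_ne_zero]; exact B.τ_pos
  have hc := B.contDiffAt_sol (L := L) (n := n) hσ hw0 ht0
  have hd := (hc.differentiableAt two_ne_zero).hasFDerivAt
  set φ' := fderiv ℝ (sol hσ L n ε f γ) 0
  refine ⟨_, fun a => ?_, hc.taylor_one_isBigO hd⟩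
  have h0 : SobolevH.fn (sol hσ L n ε f γ 0) =ᵐ[volume] lineQ L (4 * σ ^ 2) := by
    rw [B.fn_sol hσ hk hw0 ht0, B.quot_zero]
    exact toL2_sechCyl_ae hσ
  have h1 : SobolevH.fn (φ' a) =ᵐ[volume]
      fun p => a 0 * cosDir L (4 * σ ^ 2) n p + a 1 * sinDir L (4 * σ ^ 2) n p := by
    rw [B.fnL_fderiv_sol hσ hk hd]
    exact B.transverse_ae hσ a
  have h2 : SobolevH.fn (sol hσ L n ε f γ a - sol hσ L n ε f γ 0 - φ' a)
      = SobolevH.fn (sol hσ L n ε f γ a) - SobolevH.fn (sol hσ L n ε f γ 0) - SobolevH.fn (φ' a) :=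
    rfl
  filter_upwards [h0, h1, Lp.coeFn_sub (SobolevH.fn (sol hσ L n ε f γ a)
      - SobolevH.fn (sol hσ L n ε f γ 0)) (SobolevH.fn (φ' a)),
    Lp.coeFn_sub (SobolevH.fn (sol hσ L n ε f γ a)) (SobolevH.fn (sol hσ L n ε f γ 0))]
    with p e0 e1 e2 e3
  rw [h2, e2, Pi.sub_apply, e3, Pi.sub_apply, e0, e1]
  ring

theorem exists_pos_rep (hσ : 0 < σ) (hk : waveNumber L n ^ 2 = 5 * σ ^ 2)
    {a : EuclideanSpace ℝ (Fin 2)} (hw : ‖amp ε σ a‖ < 1 / 4) (ht : ‖amp ε σ a‖ ^ 2 < τ)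
    (hc : ‖quot L n ε σ f a - (6 : ℝ) • sechCyl L σ‖ ≤ 3 * sech 2) :
    ∃ F : Cyl L → ℝ, Continuous F ∧ SobolevH.fn (sol hσ L n ε f γ a) =ᵐ[volume] F ∧
      (∀ p, 0 < F p) ∧ ∀ x y, F (x, y) = F (-x, y) :=
  ⟨solFun L n σ ε (amp ε σ a) (f (‖amp ε σ a‖ ^ 2)), continuous_solFun _ _,
    solH_fn_ae hσ hk hw (B.system_amp ht),
    solFun_pos hσ hk hw (B.abs_lt _ (by rwa [abs_of_nonneg (by positivity)])) (B.system_amp ht)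
      fun p => (BddFun.norm_coe_le_norm _ p).trans hc,
    fun x y => (solFun_neg hw _ x y).symm⟩

end ModeBranch

theorem proposition3 (L : ℝ) [Fact (0 < L)] (n₀ : ℤ) (hn₀ : n₀ ∉ ({-1, 0, 1} : Set ℤ))
    (c : ℝ) (hc : c = 4 * (n₀ : ℝ) ^ 2 / (5 * L ^ 2)) :
    ∃ (C δ₀ C₂ : ℝ) (speed : EuclideanSpace ℝ (Fin 2) → ℝ)
      (φ : EuclideanSpace ℝ (Fin 2) → SobolevH L 2),
      0 < C ∧ 0 < δ₀ ∧
      -- both maps are of class `C²` on the square, and the speed is positive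
      ContDiffOn ℝ 2 speed (openSquare δ₀) ∧ ContDiffOn ℝ 2 φ (openSquare δ₀) ∧
      (∀ a ∈ openSquare δ₀, 0 < speed a) ∧
      -- `φ a` is positive and even in `x` (everywhere, for its continuous representative)
      (∀ a ∈ openSquare δ₀, ∃ f : Cyl L → ℝ, Continuous f ∧ SobolevH.fn (φ a) =ᵐ[volume] f ∧
        (∀ p, 0 < f p) ∧ ∀ x y, f (x, y) = f (-x, y)) ∧
      -- the speed depends on `|a|` only
      (∀ a ∈ openSquare δ₀, speed a = speed !₂[‖a‖, 0]) ∧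
      -- the stationary equation
      (∀ a ∈ openSquare δ₀, ∀ᵐ p : Cyl L,
        -SobolevH.laplacian (φ a) p + speed a * SobolevH.fn (φ a) p - (SobolevH.fn (φ a) p) ^ 2 = 0) ∧
      -- `φ a = Q + a₀ Q^{3/2} cos + a₁ Q^{3/2} sin + O(|a|²)` in `H²`
      (∃ R : EuclideanSpace ℝ (Fin 2) → SobolevH L 2,
        (∀ a ∈ openSquare δ₀, SobolevH.fn (φ a) =ᵐ[volume] fun p =>
          lineQ L c p + a 0 * cosDir L c n₀ p + a 1 * sinDir L c n₀ p + SobolevH.fn (R a) p) ∧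
        R =O[𝓝 0] fun a => ‖a‖ ^ 2) ∧
      -- expansion of the mass
      (fun a => normSqL2 (SobolevH.fn (φ a)) - (normSqL2 (lineQ L c) + C₂ / 2 * ‖a‖ ^ 2))
        =o[𝓝 0] (fun a => ‖a‖ ^ 2) ∧
      -- expansion of the speed
      (fun a => speed a - (c + C / 2 * ‖a‖ ^ 2)) =o[𝓝 0] (fun a => ‖a‖ ^ 2) ∧
      C₂ = 3 * C * normSqL2 (lineQ L c) / (2 * c) - 5 * normSqL2 (cosDir L c n₀) / 2 ∧
      0 < C₂ := by
  have hL : 0 < L := Fact.out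
  have hn0 : n₀ ≠ 0 := fun h => hn₀ (by simp [h])
  -- σ is half the square root of c. This makes c = 4σ² and puts mode 1 at 4σ² + (n₀/L)² = 9σ²,
  -- where sech³ is the kernel.
  obtain ⟨σ, hσ, hσ2⟩ : ∃ σ : ℝ, 0 < σ ∧ σ ^ 2 = (n₀ : ℝ) ^ 2 / (5 * L ^ 2) := by
    have h : 0 < (n₀ : ℝ) ^ 2 / (5 * L ^ 2) := by
      have : (n₀ : ℝ) ≠ 0 := Int.cast_ne_zero.2 hn0
      positivity
    exact ⟨Real.sqrt _, Real.sqrt_pos.2 h, Real.sq_sqrt h.le⟩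
  have hk : waveNumber L n₀ ^ 2 = 5 * σ ^ 2 := by
    rw [hσ2, waveNumber]
    field_simp
  obtain rfl : c = 4 * σ ^ 2 := by
    rw [hc, hσ2]
    ring
  obtain ⟨ε, τ, f, γ, hε, hτ, hτ8, hbr, hf0, hγ0⟩ := exists_modeBranch
  obtain ⟨γ', hγ', hlt, hP⟩ := modeBranch_deriv hε hτ hbr hf0 hγ0
  have B : ModeBranch ε τ f γ := ⟨hε, hτ, hτ8, fun t h => (hbr t h).1, fun t h => (hbr t h).2.1,
    fun t h => (hbr t h).2.2.1, fun t h => (hbr t h).2.2.2, hf0, hγ0⟩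
  obtain ⟨r, hr, hB⟩ := B.exists_radius (L := L) (n := n₀) (σ := σ)
  -- The square of half-width r/2 lies in the Euclidean ball of radius r.
  have hB' : ∀ a ∈ openSquare (r / 2), _ := fun a ha =>
    hB a ((norm_lt_of_mem_openSquare ha).trans_eq (by ring))
  have hg : 1 / 27 < γ' / ε ^ 2 := by
    rw [lt_div_iff₀ (by positivity)]
    linarith
  obtain ⟨R, hR, hRO⟩ := B.expansion (n := n₀) hσ hk
  refine ⟨432 * σ ^ 4 * (γ' / ε ^ 2), r / 2, (15552 * (γ' / ε ^ 2) - 576) * Real.pi * L * σ ^ 5,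
    ModeBranch.speed ε σ γ, ModeBranch.sol hσ L n₀ ε f γ, ?_, by positivity, ?_, ?_, ?_, ?_,
    fun a _ => ModeBranch.speed_radial a, ?_, ⟨R, fun a _ => hR a, hRO⟩,
    B.mass_isLittleO hσ hk hn0 hP, B.speed_isLittleO hγ', ?_, ?_⟩
  · have : 0 < γ' / ε ^ 2 := lt_trans (by norm_num) hg
    positivity
  · exact fun a ha => (B.contDiffAt_speed (hB' a ha).2.1).contDiffWithinAt
  · exact fun a ha => (B.contDiffAt_sol hσ (hB' a ha).1 (hB' a ha).2.1).contDiffWithinAt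
  · intro a ha
    have h1 := B.abs_lt (‖ModeBranch.amp ε σ a‖ ^ 2)
      (by rw [abs_of_nonneg (by positivity)]; exact (hB' a ha).2.1)
    exact mul_pos (by positivity) (by linarith [(abs_lt.1 h1).1])
  · exact fun a ha => B.exists_pos_rep hσ hk (hB' a ha).1 (hB' a ha).2.1 (hB' a ha).2.2
  · exact fun a ha => solH_equation hσ hk (hB' a ha).1 (B.system_amp (hB' a ha).2.1)
  -- With ‖Q‖² = 96πLσ³ and ‖Q^{3/2} cos‖² = (1152/5)πLσ⁵ the two coefficients are 3 · 432 · 96/8 =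
  -- 15552 and (5/2)(1152/5) = 576.
  · rw [normSqL2_lineQ hσ, normSqL2_cosDir hσ hn0]
    field_simp
    ring
  -- This is equivalent to γ'/ε² > 1/27.
  · have : 0 < 15552 * (γ' / ε ^ 2) - 576 := by linarith
    positivity
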